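/- Work in the smooth category. Let $\Sigma$ be a closed surface smoothly embedded in a (Hausdorff) smooth 4-manifold $M$, let $B^4\subset M$ be a smoothly embedded closed 4-ball, and suppose that $\Sigma\cap B^4=\Sigma\cap\partial B^4=S$, where $S\subset S^3=\partial B^4$ is a Seifert surface (a compact oriented embedded surface with boundary) of a link $\partial S$ that is not proper, i.e. some component of $\partial S$ has odd total linking number with the remaining components. Suppose that $\Sigma\setminus\operatorname{int}(S)$ is a disjoint union of closed 2-disks, one bounded by each component of $\partial S$. For a simple closed curve $\gamma\subset S$ put $\theta_S(\gamma)=\operatorname{lk}(\gamma,\gamma^+)\bmod 2$, where $\gamma^+$ is a small push-off of $\gamma$ in the positive normal direction of $S$ in $S^3$. Then there is a component $\Delta$ of $\partial S$, bounding the disk $D_\Delta\subset\Sigma\setminus\operatorname{int}(S)$, such that for every pair of simple closed curves $\gamma,\widetilde\gamma\subset S$ for which $\widetilde\gamma$ is obtained from $\gamma$ by isotoping it once across $D_\Delta$, $$\theta_S(\widetilde\gamma)=\theta_S(\gamma)+1 \pmod 2 .$$ Here $\widetilde\gamma$ is obtained from $\gamma$ by isotoping it once across $D_\Delta$ if, up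 to isotopies inside $S$, the curves $\gamma$ and $\widetilde\gamma$ are the initial and final curves of an isotopy in $S\cup D_\Delta$ that sweeps out a smoothly embedded annulus whose interior contains $D_\Delta$. -/

import Mathlib

open Set Filter Topology Metric
open scoped Manifold ContDiff

/-- Euclidean four-space; the closed unit ball is `B⁴`, the unit sphere is `S³`. -/
abbrev E4 : Type := EuclideanSpace ℝ (Fin 4)

/-- The Euclidean plane. -/
abbrev E2 : Type := EuclideanSpace ℝ (Fin 2)

section Linking

/-- Stereographic projection of `S³ \ {p}` onto the hyperplane `p^⊥`, for a unit vector `p`. -/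
noncomputable def stereoFrom (p x : E4) : E4 :=
  (1 - inner ℝ p x)⁻¹ • (x - (inner ℝ p x : ℝ) • p)

/-- The determinant of four vectors of `ℝ⁴`. -/
noncomputable def det4 (a b c d : E4) : ℝ :=
  Matrix.det (Matrix.of ![fun k => a k, fun k => b k, fun k => c k, fun k => d k])

/-- The Gauss linking integral
`(1/4π) ∮∮ ⟨r₁ - r₂, dr₁ × dr₂⟩ / |r₁ - r₂|³`
of two closed curves (of period `1`) in `S³ \ {p}`, computed in the Euclidean 3-space `p^⊥` after
stereographic projection. The triple product of `p^⊥` is `det (-p, ·, ·, ·)`: this is the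
orientation for which stereographic projection preserves the orientation of `S³` as the boundary
of the unit ball. -/
noncomputable def gaussIntegral (p : E4) (γ δ : ℝ → E4) : ℝ :=
  (4 * Real.pi)⁻¹ * ∫ s in (0 : ℝ)..1, ∫ t in (0 : ℝ)..1,
    det4 (-p) (stereoFrom p (γ s) - stereoFrom p (δ t))
        (deriv (fun u => stereoFrom p (γ u)) s) (deriv (fun u => stereoFrom p (δ u)) t)
      / ‖stereoFrom p (γ s) - stereoFrom p (δ t)‖ ^ 3

open Classical in
/-- The linking number in `S³` of two disjoint smooth closed curves (of period `1`): the Gauss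
linking integral, seen from any point of `S³` which lies on neither curve. For disjoint closed
curves this integral is an integer which does not depend on the point; `round` only turns this
real number into an element of `ℤ`. -/
noncomputable def linkingNumber (γ δ : ℝ → E4) : ℤ :=
  if h : ∃ p : E4, ‖p‖ = 1 ∧ p ∉ range γ ∧ p ∉ range δ then
    round (gaussIntegral h.choose γ δ)
  else 0

/-- A family of closed curves in `S³` is *proper* if the linking number of any component with the
union of the remaining components is even. (Reversing some components does not affect this.) -/
def IsProperLink {n : ℕ} (L : Fin n → ℝ → E4) : Prop :=
  ∀ k, Even (∑ j ∈ Finset.univ.erase k, linkingNumber (L j) (L k))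

end Linking

section Manifolds

variable {E : Type*} [NormedAddCommGroup E] [NormedSpace ℝ E]
  {H : Type*} [TopologicalSpace H]
  {X : Type*} [TopologicalSpace X] [ChartedSpace H X]
  {E' : Type*} [NormedAddCommGroup E'] [NormedSpace ℝ E']
  {H' : Type*} [TopologicalSpace H']
  {Y : Type*} [TopologicalSpace Y] [ChartedSpace H' Y]

/-- `f` is an injective smooth immersion on the set `A`. It is used for compact `A` and Hausdorff
targets, where this says that `f` restricts to a smooth embedding of `A`. -/
structure SmoothEmbeddingOn (I : ModelWithCorners ℝ E H) (J : ModelWithCorners ℝ E' H')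
    (f : X → Y) (A : Set X) : Prop where
  smooth : ContMDiffOn I J ∞ f A
  injOn : InjOn f A
  immersion : ∀ x ∈ A, Function.Injective (mfderivWithin I J f A x)

/-- Smooth simple closed curves in a manifold, parametrized by `ℝ / ℤ`. -/
structure IsSimpleClosedCurve (J : ModelWithCorners ℝ E' H') (γ : ℝ → Y) : Prop where
  smooth : ContMDiff 𝓘(ℝ, ℝ) J ∞ γ
  periodic : Function.Periodic γ 1
  injOn : InjOn γ (Ico 0 1)
  immersion : ∀ s, Function.Injective (mfderiv 𝓘(ℝ, ℝ) J γ s)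

/-- Two simple closed curves in `Y` are smoothly isotopic in `Y`: they are joined by a smooth
one-parameter family of simple closed curves in `Y`. The first coordinate is the time. -/
def IsotopicCurves (J : ModelWithCorners ℝ E' H') (γ δ : ℝ → Y) : Prop :=
  ∃ h : ℝ × ℝ → Y, ContMDiffOn 𝓘(ℝ, ℝ × ℝ) J ∞ h (Icc 0 1 ×ˢ univ) ∧
    (∀ t ∈ Icc (0 : ℝ) 1, IsSimpleClosedCurve J fun s => h (t, s)) ∧
    (∀ s, h (0, s) = γ s) ∧ (∀ s, h (1, s) = δ s)

/-- A smoothly embedded annulus `[0,1] × ℝ/ℤ → Y`. -/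
structure IsEmbeddedAnnulus (J : ModelWithCorners ℝ E' H') (a : ℝ × ℝ → Y) : Prop where
  smooth : ContMDiffOn 𝓘(ℝ, ℝ × ℝ) J ∞ a (Icc 0 1 ×ˢ univ)
  periodic : ∀ t ∈ Icc (0 : ℝ) 1, Function.Periodic (fun s => a (t, s)) 1
  injOn : InjOn a (Icc 0 1 ×ˢ Ico 0 1)
  immersion : ∀ z ∈ Icc (0 : ℝ) 1 ×ˢ (univ : Set ℝ),
    Function.Injective (mfderivWithin 𝓘(ℝ, ℝ × ℝ) J a (Icc 0 1 ×ˢ univ) z)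

end Manifolds

section Seifert

/-- A Seifert surface in `S³` for a link with `n` components: a smoothly embedded compact surface
`S ⊆ S³` with a parametrization of the components of its boundary, which form the link, and with an
orientation, given by the positive unit normal field of `S` in `S³`. Connectedness is not
required. -/
structure SeifertSurface (S : Type*) [TopologicalSpace S] [CompactSpace S] [T2Space S]
    [ChartedSpace (EuclideanHalfSpace 2) S] [IsManifold (𝓡∂ 2) ∞ S] (n : ℕ) where
  /-- the inclusion of the surface in `S³ ⊆ ℝ⁴` -/
  emb : S → E4
  emb_embedding : SmoothEmbeddingOn (𝓡∂ 2) 𝓘(ℝ, E4) emb univ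
  norm_emb : ∀ x, ‖emb x‖ = 1
  /-- the components of the boundary -/
  bdry : Fin n → ℝ → S
  bdry_simple : ∀ k, IsSimpleClosedCurve (𝓡∂ 2) (bdry k)
  bdry_disjoint : ∀ j k, j ≠ k → Disjoint (range (bdry j)) (range (bdry k))
  bdry_union : ⋃ k, range (bdry k) = (𝓡∂ 2).boundary S
  /-- the positive unit normal field -/
  normal : S → E4
  normal_continuous : Continuous normal
  norm_normal : ∀ x, ‖normal x‖ = 1
  normal_sphere : ∀ x, inner ℝ (normal x) (emb x) = 0
  normal_surface : ∀ x (v : TangentSpace (𝓡∂ 2) x),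
    inner ℝ (normal x) (show E4 from mfderiv (𝓡∂ 2) 𝓘(ℝ, E4) emb x v) = 0

namespace SeifertSurface

variable {S : Type*} [TopologicalSpace S] [CompactSpace S] [T2Space S]
  [ChartedSpace (EuclideanHalfSpace 2) S] [IsManifold (𝓡∂ 2) ∞ S] {n : ℕ}
  (Q : SeifertSurface S n)

/-- The link in `S³` of which `Q` is a Seifert surface. -/
def link (k : Fin n) (s : ℝ) : E4 := Q.emb (Q.bdry k s)

/-- A curve on the surface, pushed off in the positive normal direction along geodesics of `S³` of
length `ε`. -/
noncomputable def pushOff (γ : ℝ → S) (ε : ℝ) (s : ℝ) : E4 :=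
  Real.cos ε • Q.emb (γ s) + Real.sin ε • Q.normal (γ s)

/-- The self-linking number `lk(γ, γ⁺)` of a simple closed curve on the surface: the value of
`lk(γ, γ⁺)` for all sufficiently small positive push-offs `γ⁺`. -/
noncomputable def selfLinking (γ : ℝ → S) : ℤ :=
  limUnder (𝓝[>] (0 : ℝ)) fun ε => linkingNumber (fun s => Q.emb (γ s)) (Q.pushOff γ ε)

/-- The mod 2 self-linking form `θ_S`, on simple closed curves of the surface. -/
noncomputable def theta (γ : ℝ → S) : ZMod 2 := (Q.selfLinking γ : ZMod 2)

end SeifertSurface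

/-- Let `κ : S → F` be the inclusion of a subsurface and `D ⊆ F` a disk. `SlidesAcross κ D γ γ'`
says that the simple closed curve `γ'` in `S` is obtained from the simple closed curve `γ` in `S`
by isotoping it once across `D`: up to isotopies inside `S`, the curves `γ` and `γ'` are the initial
and the final curve of an isotopy in `S ∪ D` which sweeps out an embedded annulus whose interior
contains `D`. -/
def SlidesAcross {S : Type*} [TopologicalSpace S] [ChartedSpace (EuclideanHalfSpace 2) S]
    {F : Type*} [TopologicalSpace F] [ChartedSpace E2 F]
    (κ : S → F) (D : Set F) (γ γ' : ℝ → S) : Prop :=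
  ∃ γ₀ γ₁ : ℝ → S, IsotopicCurves (𝓡∂ 2) γ γ₀ ∧ IsotopicCurves (𝓡∂ 2) γ₁ γ' ∧
    ∃ a : ℝ × ℝ → F, IsEmbeddedAnnulus (𝓡 2) a ∧
      (∀ s, a (0, s) = κ (γ₀ s)) ∧ (∀ s, a (1, s) = κ (γ₁ s)) ∧
      D ⊆ a '' (Ioo 0 1 ×ˢ univ) ∧ a '' (Icc 0 1 ×ˢ univ) ⊆ range κ ∪ D

end Seifert

/-!
The ambient 4-manifold and the ball play no role beyond presenting the closed surface `F`, which is
cut into the surface `S ⊆ S³` and disks. For a small `ε₀ > 0` let `ℓ(α, β)` be the linking number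
of `α` with the push-off of `β` by `ε₀` (`SeifertSurface.linkingForm`), for arbitrary smooth loops
`α` and `β` on `S`. Then `θ(γ) = ℓ(γ, γ)` modulo `2`, and the proof rests on three facts.

* *The form `ℓ` is a degree in each variable*: for fixed `β` there is a nonvanishing continuous
  function on `S` whose degree along `α` is `ℓ(α, β)`, for all `α`, and similarly for fixed `α`
  (`exists_hasDeg_left`, `exists_hasDeg_right`). Moreover `ℓ` is symmetric on pairs of disjoint
  loops (`linkingForm_comm_of_disjoint`).

* *Sliding a curve across a disk* `D` from `γ₀` to `γ₁` changes the degree of a nonvanishing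
  function on `S` by its degree along the boundary `Δ` of `D`, modulo `2` (`deg_annulus_modTwo`). If
  this is applied to each variable of `ℓ`, then modulo `2`
  `ℓ(γ₁, γ₁) = ℓ(γ₀, γ₁) + ℓ(Δ, γ₁) = ℓ(γ₀, γ₀) + ℓ(γ₀, Δ) + ℓ(Δ, γ₀) + ℓ(Δ, Δ)`,
  and the mixed terms cancel, as `γ₀` and `Δ` are disjoint.

* *A nonvanishing function on `S` has even total degree along the boundary of `S`*
  (`sum_deg_disks_modTwo`). Hence `ℓ(Δ_k, Δ_k)` is the sum of the `ℓ(Δ_j, Δ_k) = lk(Δ_j, Δ_k)` over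
  `j ≠ k`, modulo `2`; a component `Δ_k` with odd total linking number with the other ones is the
  one which is asked for.

Only parities of degrees enter, so orientations of `F` play no role. For the last fact the function
is extended to `F` and then perturbed, so that all its zeros are regular and lie in the disks. By
the argument principle modulo `2` the sum of the degrees is the parity of the number of zeros. This
number is even (`even_ncard_zeros`): subtracting multiples of bump functions does not change its
parity, since such a perturbation takes place inside a disk, and finitely many perturbations move
the real part of all values above zero.

For the first fact, the linking number is given by the Gauss integral in a hyperplane `p^⊥`, which
has to be recognized as a degree. The solid angle of a closed curve `y`, seen from `ξ`, is the
integral along `y` of a vector potential of the magnetic monopole at `ξ`; this depends on the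
choice of a Dirac string, but two choices differ by a gauge transformation, which changes the
integral by a multiple of `4π` (`dphase_sub`). Hence the exponential of `i / 2` times the solid
angle is a well-defined function off `y`, and by the law of Biot and Savart its degree along a loop
`x` is the Gauss integral of `x` and `y` (`exists_hasDeg_monopole`). In particular this integral is
an integer, and so it does not change as the centre of the stereographic projection moves in the
complement of the curves (`gaussIntegral_eq_gaussIntegral`). Since a Seifert surface is compact and
its unit normal field is continuous, all short chords are nearly tangent to it, and short push-offs
to different sides are disjoint (`exists_push_ne`); along smooth curves the normal field is of
class `C¹` (`contDiff_normal_comp`), as the Gauss integral requires.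
-/

/-! ### Degrees of loops in the punctured plane -/

/-- The loop `u : ℝ → ℂ ∖ {0}`, of period `1`, winds `n` times around `0`: it has a continuous
logarithm which grows by `2πin` over each period. -/
def HasDeg (u : ℝ → ℂ) (n : ℤ) : Prop :=
  ∃ L : ℝ → ℂ, Continuous L ∧ (∀ s, Complex.exp (L s) = u s) ∧
    ∀ s, L (s + 1) = L s + n * (2 * Real.pi * Complex.I)

theorem exists_continuous_log {X : Type*} [TopologicalSpace X] [SimplyConnectedSpace X]
    [LocallyPathConnectedSpace X] {f : X → ℂ} (hf : Continuous f) (h0 : ∀ x, f x ≠ 0) :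
    ∃ L : X → ℂ, Continuous L ∧ ∀ x, Complex.exp (L x) = f x := by
  obtain ⟨x₀⟩ : Nonempty X := inferInstance
  obtain ⟨L, ⟨-, hL⟩, -⟩ := Complex.isCoveringMapOn_exp.existsUnique_continuousMap_lifts
    (⟨f, hf⟩ : C(X, ℂ)) (a₀ := x₀) (e₀ := Complex.log (f x₀)) (Complex.exp_log (h0 x₀)) h0
  exact ⟨L, L.continuous, fun x => congrFun hL x⟩

/-- A continuous function with values in `2πiℤ` on a connected space is constant. -/
theorem exists_int_of_exp_eq_one {X : Type*} [TopologicalSpace X] [PreconnectedSpace X] [Nonempty X]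
    {f : X → ℂ} (hf : Continuous f) (h : ∀ x, Complex.exp (f x) = 1) :
    ∃ n : ℤ, ∀ x, f x = n * (2 * Real.pi * Complex.I) := by
  obtain ⟨x₀⟩ : Nonempty X := inferInstance
  choose k hk using fun x => Complex.exp_eq_one_iff.1 (h x)
  refine ⟨k x₀, fun x => ?_⟩
  have hc : Continuous k := by
    have h1 : Continuous fun x => ((k x : ℤ) : ℂ) := by
      have : (fun x => ((k x : ℤ) : ℂ)) = fun x => f x / (2 * Real.pi * Complex.I) := by
        funext x
        rw [hk x, mul_div_cancel_right₀ _ Complex.two_pi_I_ne_zero]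
      rw [this]
      exact hf.div_const _
    have h2 : Continuous fun x => ((k x : ℤ) : ℝ) := by
      have := Complex.continuous_re.comp h1
      simpa [Function.comp_def] using this
    exact Int.isClosedEmbedding_coe_real.isEmbedding.continuous_iff.2 h2
  rw [hk x, PreconnectedSpace.constant ‹_› hc (x := x) (y := x₀)]

namespace HasDeg

variable {u v : ℝ → ℂ} {m n : ℤ}

theorem of_continuous (hu : Continuous u) (hp : Function.Periodic u 1) (h0 : ∀ s, u s ≠ 0) :
    ∃ n, HasDeg u n := by
  obtain ⟨L, hL, he⟩ := exists_continuous_log hu h0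
  obtain ⟨n, hn⟩ := exists_int_of_exp_eq_one
    (f := fun s => L (s + 1) - L s) (by fun_prop) (fun s => by
      rw [Complex.exp_sub, he, he, hp, div_self (h0 s)])
  exact ⟨n, L, hL, he, fun s => by rw [← hn s]; ring⟩

theorem unique (hm : HasDeg u m) (hn : HasDeg u n) : m = n := by
  obtain ⟨L, hL, he, hp⟩ := hm
  obtain ⟨L', hL', he', hp'⟩ := hn
  obtain ⟨k, hk⟩ := exists_int_of_exp_eq_one
    (f := fun s => L s - L' s) (by fun_prop) (fun s => by
      rw [Complex.exp_sub, he, he', div_self (he s ▸ Complex.exp_ne_zero _)])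
  have h0 := hk 0
  have h1 := hk (0 + 1)
  simp only [hp, hp'] at h1
  have h2 : ((m : ℂ) - n) * (2 * Real.pi * Complex.I) = 0 := by linear_combination h1 - h0
  have h3 := (mul_eq_zero.1 h2).resolve_right Complex.two_pi_I_ne_zero
  exact_mod_cast sub_eq_zero.1 h3

theorem mul (hu : HasDeg u m) (hv : HasDeg v n) : HasDeg (fun s => u s * v s) (m + n) := by
  obtain ⟨L, hL, he, hp⟩ := hu
  obtain ⟨L', hL', he', hp'⟩ := hv
  refine ⟨fun s => L s + L' s, by fun_prop, fun s => by rw [Complex.exp_add, he, he'], fun s => ?_⟩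
  simp only [hp, hp']
  push_cast
  ring

theorem zpow (hu : HasDeg u m) (k : ℤ) : HasDeg (fun s => u s ^ k) (k * m) := by
  obtain ⟨L, hL, he, hp⟩ := hu
  refine ⟨fun s => k * L s, by fun_prop, fun s => by rw [Complex.exp_int_mul, he], fun s => ?_⟩
  simp only [hp]
  push_cast
  ring

theorem congr (hu : HasDeg u m) (h : ∀ s, v s = u s) : HasDeg v m := by
  rwa [funext h]

/-- The degree of a loop is invariant under homotopies. -/
theorem homotopy {H : ℝ × ℝ → ℂ} (hc : ContinuousOn H (Icc 0 1 ×ˢ univ))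
    (hp : ∀ t ∈ Icc (0 : ℝ) 1, ∀ s, H (t, s + 1) = H (t, s))
    (h0 : ∀ t ∈ Icc (0 : ℝ) 1, ∀ s, H (t, s) ≠ 0) (h : HasDeg (fun s => H (0, s)) n) :
    HasDeg (fun s => H (1, s)) n := by
  -- extend the homotopy to the plane, which is simply connected
  set c : ℝ → ℝ := fun t => projIcc (0 : ℝ) 1 zero_le_one t with hcdef
  have hcm : ∀ t, c t ∈ Icc (0 : ℝ) 1 := fun t => (projIcc (0 : ℝ) 1 zero_le_one t).2
  have hcc : Continuous c := continuous_subtype_val.comp continuous_projIcc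
  have hG : Continuous fun q : ℝ × ℝ => H (c q.1, q.2) :=
    hc.comp_continuous (by fun_prop) fun q => ⟨hcm _, mem_univ _⟩
  obtain ⟨L, hL, he⟩ := exists_continuous_log hG fun q => h0 _ (hcm _) _
  obtain ⟨k, hk⟩ := exists_int_of_exp_eq_one
    (f := fun q : ℝ × ℝ => L (q.1, q.2 + 1) - L q) (by fun_prop) (fun q => by
      rw [Complex.exp_sub, he, he]
      simp only
      rw [hp _ (hcm _), div_self (h0 _ (hcm _) _)])
  have hcz : c 0 = 0 := by simp [hcdef]
  have hco : c 1 = 1 := by simp [hcdef]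
  have key : ∀ t, HasDeg (fun s => H (c t, s)) k := fun t =>
    ⟨fun s => L (t, s), by fun_prop, fun s => he (t, s), fun s => by rw [← hk (t, s)]; ring⟩
  have hz := key 0
  rw [hcz] at hz
  have ho := key 1
  rw [hco] at ho
  rwa [h.unique hz]

/-- The dog-on-a-leash lemma: a loop which is closer to `v` than the origin has the degree of
`v`. -/
theorem near (hu : Continuous u) (hup : Function.Periodic u 1) (hv : Continuous v)
    (hvp : Function.Periodic v 1) (h : ∀ s, ‖u s - v s‖ < ‖v s‖) (hn : HasDeg v n) :
    HasDeg u n := by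
  have := homotopy (H := fun q : ℝ × ℝ => v q.2 + q.1 * (u q.2 - v q.2)) (n := n)
    (by fun_prop) (fun t _ s => by simp [hup s, hvp s]) (fun t ht s h0 => ?_) (by simpa using hn)
  · simpa using this
  · have h1 : ‖v s‖ = ‖(t : ℂ) * (u s - v s)‖ := by
      rw [← norm_neg]
      congr 1
      linear_combination -h0
    rw [norm_mul, Complex.norm_real, Real.norm_of_nonneg ht.1] at h1
    have := h s
    nlinarith [ht.2, norm_nonneg (u s - v s)]

theorem const {z : ℂ} (hz : z ≠ 0) : HasDeg (fun _ => z) 0 :=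
  ⟨fun _ => Complex.log z, continuous_const, fun _ => Complex.exp_log hz, fun s => by simp⟩

/-- A loop with `u (s + 1/2) = -u s` has odd degree. -/
theorem odd (h : HasDeg u n) (ho : ∀ s, u (s + 1 / 2) = -u s) : Odd n := by
  obtain ⟨L, hL, he, hp⟩ := h
  obtain ⟨k, hk⟩ := exists_int_of_exp_eq_one
    (f := fun s => L (s + 1 / 2) - L s - Real.pi * Complex.I) (by fun_prop) (fun s => by
      rw [Complex.exp_sub, Complex.exp_sub, Complex.exp_pi_mul_I, he, he, ho]
      have := he s ▸ Complex.exp_ne_zero (L s)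
      field_simp)
  have h0 := hk 0
  have h1 := hk (0 + 1 / 2)
  have h2 := hp 0
  have e : (0 : ℝ) + 1 / 2 + 1 / 2 = 0 + 1 := by norm_num
  simp only [e] at h1
  have h3 : ((n : ℂ) - (2 * k + 1)) * (2 * Real.pi * Complex.I) = 0 := by
    linear_combination h1 + h0 - h2
  have h4 := (mul_eq_zero.1 h3).resolve_right Complex.two_pi_I_ne_zero
  exact ⟨k, by exact_mod_cast sub_eq_zero.1 h4⟩

end HasDeg

/-- The standard parametrization of the unit circle by `ℝ / ℤ`. -/
noncomputable def circ (s : ℝ) : ℂ := Complex.exp (s * (2 * Real.pi * Complex.I))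

@[fun_prop]
theorem continuous_circ : Continuous circ := by unfold circ; fun_prop

theorem norm_circ (s : ℝ) : ‖circ s‖ = 1 := by
  have : (s : ℂ) * (2 * Real.pi * Complex.I) = ((s * (2 * Real.pi) : ℝ) : ℂ) * Complex.I := by
    push_cast; ring
  rw [circ, this, Complex.norm_exp_ofReal_mul_I]

theorem circ_ne_zero (s : ℝ) : circ s ≠ 0 := Complex.exp_ne_zero _

theorem circ_periodic : Function.Periodic circ 1 := fun s => by
  simp only [circ]
  push_cast
  rw [add_mul, Complex.exp_add, one_mul, Complex.exp_two_pi_mul_I, mul_one]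

theorem circ_add_half (s : ℝ) : circ (s + 1 / 2) = -circ s := by
  simp only [circ]
  push_cast
  rw [add_mul, Complex.exp_add, show (1 / 2 : ℂ) * (2 * Real.pi * Complex.I)
    = Real.pi * Complex.I by ring, Complex.exp_pi_mul_I]
  ring

theorem circ_eq_iff {s t : ℝ} : circ s = circ t ↔ ∃ k : ℤ, s = t + k := by
  rw [circ, circ, Complex.exp_eq_exp_iff_exists_int]
  refine exists_congr fun k => ?_
  rw [← add_mul, mul_left_inj' Complex.two_pi_I_ne_zero]
  exact_mod_cast Iff.rfl

theorem exists_circ_eq {z : ℂ} (hz : ‖z‖ = 1) : ∃ s ∈ Icc (0 : ℝ) 1, circ s = z := by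
  have h : ∃ s, circ s = z := by
    refine ⟨Complex.arg z / (2 * Real.pi), ?_⟩
    rw [circ]
    have : ((Complex.arg z / (2 * Real.pi) : ℝ) : ℂ) * (2 * Real.pi * Complex.I)
        = Complex.arg z * Complex.I := by
      push_cast
      field_simp [Real.pi_ne_zero]
    rw [this]
    simpa [hz] using Complex.norm_mul_exp_arg_mul_I z
  obtain ⟨s, hs⟩ := h
  exact ⟨Int.fract s, ⟨Int.fract_nonneg _, (Int.fract_lt_one _).le⟩, by
    rw [← hs, circ_eq_iff]
    exact ⟨-⌊s⌋, by push_cast; linarith [Int.self_sub_floor s]⟩⟩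

theorem hasDeg_circ : HasDeg circ 1 :=
  ⟨fun s => s * (2 * Real.pi * Complex.I), by fun_prop, fun s => rfl, fun s => by push_cast; ring⟩

/-- A loop which extends to a nonvanishing function on the disk has degree zero. -/
theorem hasDeg_zero_of_disk {f : ℂ → ℂ} {c : ℂ} {r : ℝ} (hr : 0 ≤ r)
    (hf : ContinuousOn f (closedBall c r)) (h0 : ∀ z ∈ closedBall c r, f z ≠ 0) :
    HasDeg (fun s => f (c + r * circ s)) 0 := by
  have hm : ∀ t ∈ Icc (0 : ℝ) 1, ∀ s, c + (t * r : ℝ) * circ s ∈ closedBall c r := by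
    intro t ht s
    rw [mem_closedBall, dist_eq_norm, add_sub_cancel_left, norm_mul, norm_circ, mul_one,
      Complex.norm_real, Real.norm_of_nonneg (mul_nonneg ht.1 hr)]
    nlinarith [ht.2]
  have := HasDeg.homotopy (n := 0) (H := fun q : ℝ × ℝ => f (c + (q.1 * r : ℝ) * circ q.2))
    (hf.comp (by fun_prop) fun q hq => hm q.1 hq.1 q.2)
    (fun t _ s => by simp only [circ_periodic s])
    (fun t ht s => h0 _ (hm t ht s)) (by simpa using HasDeg.const (h0 c (mem_closedBall_self hr)))
  simpa using this

/-- An injective continuous map of a disk to the plane winds an odd number of times around the image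
of the centre: the loop is homotopic to an odd one. -/
theorem exists_odd_hasDeg_of_injOn {g : ℂ → ℂ} {c : ℂ} {r : ℝ} (hr : 0 < r)
    (hg : ContinuousOn g (closedBall c r)) (hi : InjOn g (closedBall c r)) :
    ∃ n, Odd n ∧ HasDeg (fun s => g (c + r * circ s) - g c) n := by
  -- the points `c + r e(s) / (1 + t)` and `c - t r e(s) / (1 + t)` are never equal
  have hm : ∀ t ∈ Icc (0 : ℝ) 1, ∀ s, c + (r / (1 + t) : ℝ) * circ s ∈ closedBall c r := by
    intro t ht s
    rw [mem_closedBall, dist_eq_norm, add_sub_cancel_left, norm_mul, norm_circ, mul_one,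
      Complex.norm_real, Real.norm_of_nonneg (div_nonneg hr.le (by linarith [ht.1]))]
    exact div_le_self hr.le (by linarith [ht.1])
  have hm' : ∀ t ∈ Icc (0 : ℝ) 1, ∀ s, c + (-(t * r / (1 + t)) : ℝ) * circ s ∈ closedBall c r := by
    intro t ht s
    rw [mem_closedBall, dist_eq_norm, add_sub_cancel_left, norm_mul, norm_circ, mul_one,
      Complex.norm_real, norm_neg,
      Real.norm_of_nonneg (div_nonneg (mul_nonneg ht.1 hr.le) (by linarith [ht.1])),
      div_le_iff₀ (by linarith [ht.1])]
    nlinarith [ht.1]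
  set H : ℝ × ℝ → ℂ := fun q => g (c + (r / (1 + q.1) : ℝ) * circ q.2)
    - g (c + (-(q.1 * r / (1 + q.1)) : ℝ) * circ q.2) with hH
  have hd : ∀ q ∈ Icc (0 : ℝ) 1 ×ˢ (univ : Set ℝ), 1 + q.1 ≠ 0 := fun q hq => by
    linarith [hq.1.1]
  have hHc : ContinuousOn H (Icc 0 1 ×ˢ univ) := by
    refine (hg.comp ?_ fun q hq => hm q.1 hq.1 q.2).sub (hg.comp ?_ fun q hq => hm' q.1 hq.1 q.2)
    · refine continuousOn_const.add (ContinuousOn.mul ?_ (by fun_prop))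
      exact Complex.continuous_ofReal.comp_continuousOn
        (continuousOn_const.div (by fun_prop) hd)
    · refine continuousOn_const.add (ContinuousOn.mul ?_ (by fun_prop))
      refine Complex.continuous_ofReal.comp_continuousOn (ContinuousOn.neg ?_)
      exact ContinuousOn.div (by fun_prop) (by fun_prop) hd
  have hHp : ∀ t ∈ Icc (0 : ℝ) 1, ∀ s, H (t, s + 1) = H (t, s) := fun t _ s => by
    simp only [hH, circ_periodic s]
  have hH0 : ∀ t ∈ Icc (0 : ℝ) 1, ∀ s, H (t, s) ≠ 0 := by
    intro t ht s h
    have h1 := hi (hm t ht s) (hm' t ht s) (sub_eq_zero.1 h)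
    have h2 := mul_right_cancel₀ (circ_ne_zero s) (add_left_cancel h1)
    have h3 : r / (1 + t) = -(t * r / (1 + t)) := by exact_mod_cast h2
    have h4 : 0 < 1 + t := by linarith [ht.1]
    field_simp at h3
    nlinarith [ht.1]
  have h0c : Continuous fun s => H (0, s) := hHc.comp_continuous (f := fun s : ℝ => ((0 : ℝ), s))
    (by fun_prop) fun s => ⟨by simp, mem_univ _⟩
  obtain ⟨n, hn⟩ := HasDeg.of_continuous (u := fun s => H (0, s)) h0c
    (fun s => hHp 0 (by simp) s) (hH0 0 (by simp))
  have h1 := HasDeg.homotopy hHc hHp hH0 hn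
  refine ⟨n, h1.odd fun s => ?_, by simpa [hH] using hn⟩
  simp only [hH, circ_add_half]
  rw [neg_sub]
  congr 2
  · push_cast; ring
  · push_cast; ring

/-! ### Simple loops and disks -/

/-- A function on the continuous image of a compact set is continuous if its pull-back is. -/
theorem ContinuousOn.of_comp_image {A X Y : Type*} [TopologicalSpace A] [TopologicalSpace X]
    [T2Space X] [TopologicalSpace Y] {K : Set A} (hK : IsCompact K) {φ : A → X}
    (hφ : ContinuousOn φ K) {f : X → Y} (hf : ContinuousOn (f ∘ φ) K) :
    ContinuousOn f (φ '' K) := by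
  rw [continuousOn_iff_isClosed]
  intro t ht
  obtain ⟨u, hu, h⟩ := continuousOn_iff_isClosed.1 hf t ht
  refine ⟨φ '' (u ∩ K), ((hK.inter_left hu).image_of_continuousOn
    (hφ.mono inter_subset_right)).isClosed, ?_⟩
  ext x
  constructor
  · rintro ⟨hx, a, ha, rfl⟩
    have : a ∈ u ∩ K := h ▸ ⟨hx, ha⟩
    exact ⟨⟨a, this, rfl⟩, a, ha, rfl⟩
  · rintro ⟨⟨a, ha, rfl⟩, -⟩
    have : a ∈ (f ∘ φ) ⁻¹' t ∩ K := h ▸ ha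
    exact ⟨this.1, a, this.2, rfl⟩

/-- A continuous injective loop of period `1`. -/
structure IsSimpleLoop {X : Type*} [TopologicalSpace X] (b : ℝ → X) : Prop where
  continuous : Continuous b
  periodic : Function.Periodic b 1
  injOn : InjOn b (Ico 0 1)

namespace IsSimpleLoop

variable {X : Type*} [TopologicalSpace X] {b c : ℝ → X}

theorem exists_int (hb : IsSimpleLoop b) {s t : ℝ} (h : b s = b t) : ∃ k : ℤ, s = t + k := by
  have h1 : b (Int.fract s) = b (Int.fract t) := by
    rw [← Int.self_sub_floor, ← Int.self_sub_floor]
    have e : ∀ x : ℝ, b (x - ⌊x⌋) = b x := fun x => by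
      simpa using hb.periodic.sub_int_mul_eq (x := x) ⌊x⌋
    rw [e, e, h]
  have h2 := hb.injOn ⟨Int.fract_nonneg _, Int.fract_lt_one _⟩
    ⟨Int.fract_nonneg _, Int.fract_lt_one _⟩ h1
  exact ⟨⌊s⌋ - ⌊t⌋, by push_cast; rw [← Int.self_sub_floor, ← Int.self_sub_floor] at h2; linarith⟩

theorem range_eq (hb : IsSimpleLoop b) : range b = b '' Icc 0 1 := by
  refine subset_antisymm ?_ (image_subset_range _ _)
  rintro _ ⟨s, rfl⟩
  refine ⟨Int.fract s, ⟨Int.fract_nonneg _, (Int.fract_lt_one _).le⟩, ?_⟩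
  rw [← Int.self_sub_floor]
  simpa using hb.periodic.sub_int_mul_eq (x := s) ⌊s⌋

theorem apply_add_int (hb : IsSimpleLoop b) (s : ℝ) (k : ℤ) : b (s + k) = b s := by
  simpa using hb.periodic.int_mul k s

/-- A function on the circle can be read off any of its parametrizations. -/
theorem exists_factor [T2Space X] {Y : Type*} [TopologicalSpace Y] [Nonempty Y]
    (hb : IsSimpleLoop b) {u : ℝ → Y} (hu : Continuous u) (hp : Function.Periodic u 1) :
    ∃ f : X → Y, ContinuousOn f (range b) ∧ ∀ s, f (b s) = u s := by
  have hf : ∀ s, Function.extend b u (fun _ => Classical.arbitrary Y) (b s) = u s := by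
    have : u.FactorsThrough b := by
      intro s t h
      obtain ⟨k, rfl⟩ := hb.exists_int h
      simpa using hp.int_mul k t
    exact fun s => this.extend_apply _ s
  refine ⟨_, ?_, hf⟩
  rw [hb.range_eq]
  exact .of_comp_image isCompact_Icc hb.continuous.continuousOn
    (by simpa only [Function.comp_def, hf] using hu.continuousOn)

/-- Degrees along the loop `c` in the circle `b` are the multiples of the degrees along `b` by a
fixed integer, the degree of the change of parameter. -/
theorem exists_deg_mul [T2Space X] (hb : IsSimpleLoop b) (hc : IsSimpleLoop c)
    (h : range c ⊆ range b) : ∃ d : ℤ, ∀ (U : X → ℂ) (n : ℤ), HasDeg (U ∘ b) n →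
      HasDeg (U ∘ c) (d * n) := by
  obtain ⟨w, hw, hwb⟩ := hb.exists_factor continuous_circ circ_periodic
  have hcb : ∀ s, ∃ t, b t = c s := fun s => h (mem_range_self s)
  obtain ⟨d, L, hL, he, hp⟩ := HasDeg.of_continuous (u := w ∘ c)
    (hw.comp_continuous hc.continuous fun s => h (mem_range_self s))
    (fun s => by simp [hc.periodic s])
    (fun s => by
      obtain ⟨t, ht⟩ := hcb s
      simp only [Function.comp, ← ht, hwb]
      exact circ_ne_zero t)
  have hre : ∀ s, L s = ((L s).im / (2 * Real.pi) : ℝ) * (2 * Real.pi * Complex.I) := by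
    intro s
    obtain ⟨t, ht⟩ := hcb s
    have h1 : ‖Complex.exp (L s)‖ = 1 := by
      rw [he, Function.comp, ← ht, hwb, norm_circ]
    rw [Complex.norm_exp, Real.exp_eq_one_iff] at h1
    have h2 : L s = (L s).im * Complex.I := by
      apply Complex.ext <;> simp [h1]
    have h3 : (Real.pi : ℂ) ≠ 0 := by exact_mod_cast Real.pi_ne_zero
    rw [h2]
    push_cast
    simp only [Complex.mul_im, Complex.ofReal_re, Complex.I_im, Complex.ofReal_im, Complex.I_re]
    field_simp
    simp
  have hφ : ∀ s, b ((L s).im / (2 * Real.pi)) = c s := by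
    intro s
    obtain ⟨t, ht⟩ := hcb s
    have h1 : circ ((L s).im / (2 * Real.pi)) = circ t := by
      rw [← hwb t, ht, circ, ← hre, he]
      rfl
    obtain ⟨k, hk⟩ := circ_eq_iff.1 h1
    rw [hk, hb.apply_add_int, ht]
  refine ⟨d, fun U n hn => ?_⟩
  obtain ⟨M, hM, hMe, hMp⟩ := hn
  have hMk : ∀ (k : ℤ) (s : ℝ), M (s + k) = M s + k * (n * (2 * Real.pi * Complex.I)) := by
    intro k s
    induction k using Int.induction_on with
    | zero => simp
    | succ k ih =>
      have := hMp (s + k)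
      push_cast at ih ⊢
      rw [← add_assoc, this, ih]
      ring
    | pred k ih =>
      have := hMp (s + (-k - 1))
      push_cast at ih ⊢
      rw [show s + (-(k : ℝ) - 1) + 1 = s + -k by ring, ih] at this
      linear_combination -this
  refine ⟨fun s => M ((L s).im / (2 * Real.pi)), by fun_prop, fun s => ?_, fun s => ?_⟩
  · rw [hMe, Function.comp, hφ, Function.comp]
  · have : (L (s + 1)).im / (2 * Real.pi) = (L s).im / (2 * Real.pi) + d := by
      rw [hp]
      simp
      field_simp
    simp only
    rw [this, hMk]
    push_cast
    ring

/-- Two parametrizations of the same circle give the same degrees modulo `2`: the degrees of the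
two changes of parameter are inverse to each other. -/
theorem deg_modTwo_eq [T2Space X] (hb : IsSimpleLoop b) (hc : IsSimpleLoop c)
    (h : range b = range c) {U : X → ℂ} {m n : ℤ} (hm : HasDeg (U ∘ b) m) (hn : HasDeg (U ∘ c) n) :
    (m : ZMod 2) = n := by
  obtain ⟨d, hd⟩ := hb.exists_deg_mul hc h.symm.le
  obtain ⟨d', hd'⟩ := hc.exists_deg_mul hb h.le
  obtain ⟨w, -, hwb⟩ := hb.exists_factor continuous_circ circ_periodic
  have h1 : HasDeg (w ∘ b) 1 := hasDeg_circ.congr hwb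
  have h2 : d' * (d * 1) = 1 := (hd' _ _ (hd _ _ h1)).unique h1
  have h3 : Odd d := by
    have : Odd (d' * (d * 1)) := by rw [h2]; exact odd_one
    rw [Int.odd_mul, mul_one] at this
    exact this.2
  rw [hn.unique (hd _ _ hm)]
  push_cast
  rw [show (d : ZMod 2) = 1 from (ZMod.intCast_eq_one_iff_odd).2 h3, one_mul]

end IsSimpleLoop

theorem exists_polar {w : ℂ} (hw : w ∈ closedBall (0 : ℂ) 1) :
    ∃ r ∈ Icc (0 : ℝ) 1, ∃ s ∈ Icc (0 : ℝ) 1, (r : ℂ) * circ s = w := by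
  rw [mem_closedBall_zero_iff] at hw
  by_cases h : w = 0
  · exact ⟨0, by simp, 0, by simp, by simp [h]⟩
  · have h' : (‖w‖ : ℂ) ≠ 0 := by exact_mod_cast norm_ne_zero_iff.2 h
    obtain ⟨s, hs, hsw⟩ := exists_circ_eq (z := w / ‖w‖)
      (by rw [norm_div, Complex.norm_real, norm_norm, div_self (norm_ne_zero_iff.2 h)])
    exact ⟨‖w‖, ⟨norm_nonneg _, hw⟩, s, hs, by rw [hsw, mul_div_cancel₀ _ h']⟩

theorem norm_ofReal_mul_circ {r : ℝ} (hr : 0 ≤ r) (s : ℝ) : ‖(r : ℂ) * circ s‖ = r := by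
  rw [norm_mul, norm_circ, mul_one, Complex.norm_real, Real.norm_of_nonneg hr]

theorem image_circ_eq_sphere {X : Type*} (D : ℂ → X) : range (D ∘ circ) = D '' sphere 0 1 := by
  rw [range_comp]
  congr 1
  ext z
  constructor
  · rintro ⟨s, rfl⟩
    simp [norm_circ]
  · intro hz
    obtain ⟨s, -, hs⟩ := exists_circ_eq (mem_sphere_zero_iff_norm.1 hz)
    exact ⟨s, hs⟩

theorem isSimpleLoop_disk {X : Type*} [TopologicalSpace X] {D : ℂ → X}
    (hD : ContinuousOn D (closedBall 0 1)) (hi : InjOn D (closedBall 0 1)) :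
    IsSimpleLoop (D ∘ circ) := by
  have hm : ∀ s, circ s ∈ closedBall (0 : ℂ) 1 := fun s => by simp [norm_circ]
  refine ⟨hD.comp_continuous continuous_circ hm, fun s => by simp [circ_periodic s], ?_⟩
  intro s hs t ht h
  obtain ⟨k, hk⟩ := circ_eq_iff.1 (hi (hm s) (hm t) h)
  have h1 : (k : ℝ) < 1 := by linarith [hs.2, ht.1]
  have h2 : (-1 : ℝ) < k := by linarith [hs.1, ht.2]
  have h3 : k < 1 := by exact_mod_cast h1
  have h4 : -1 < k := by exact_mod_cast h2
  have h5 : k = 0 := by omega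
  simpa [h5] using hk

/-- A nonvanishing function, defined off a disk, extends over the disk without zeros if it has
degree zero along the boundary circle. -/
theorem exists_extension_over_disk {X : Type*} [TopologicalSpace X] [T2Space X] {D : ℂ → X}
    (hD : ContinuousOn D (closedBall 0 1)) (hi : InjOn D (closedBall 0 1)) {A : Set X}
    (hA : IsClosed A) (hAD : A ∩ D '' closedBall 0 1 ⊆ D '' sphere 0 1)
    {h : X → ℂ} (hh : ContinuousOn h A) (h0 : ∀ x ∈ A, h x ≠ 0)
    (hdeg : HasDeg (fun s => h (D (circ s))) 0) :
    ∃ g : X → ℂ, ContinuousOn g (A ∪ D '' closedBall 0 1) ∧ (∀ x ∈ A, g x = h x) ∧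
      ∀ x ∈ A ∪ D '' closedBall 0 1, g x ≠ 0 := by
  classical
  obtain ⟨L, hL, he, hp⟩ := hdeg
  have hp1 : Function.Periodic L 1 := fun s => by simpa using hp s
  have hpk : ∀ s t, circ s = circ t → L s = L t := by
    intro s t hst
    obtain ⟨k, rfl⟩ := circ_eq_iff.1 hst
    simpa using hp1.int_mul k t
  set q : ℝ × ℝ → ℂ := fun z => (z.1 : ℂ) * circ z.2 with hq
  have hqc : Continuous q := by fun_prop
  set K : Set (ℝ × ℝ) := Icc 0 1 ×ˢ Icc 0 1 with hKdef
  have hK : IsCompact K := isCompact_Icc.prod isCompact_Icc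
  have hqm : MapsTo q K (closedBall 0 1) := fun z hz => by
    rw [mem_closedBall_zero_iff, hq, norm_ofReal_mul_circ hz.1.1]
    exact hz.1.2
  have hqs : q '' K = closedBall 0 1 := by
    refine subset_antisymm (image_subset_iff.2 hqm) fun w hw => ?_
    obtain ⟨r, hr, s, hs, h⟩ := exists_polar hw
    exact ⟨(r, s), ⟨hr, hs⟩, h⟩
  -- the radial extension of the logarithm
  set e : ℝ × ℝ → ℂ := fun z => Complex.exp (z.1 * L z.2) with hedef
  have hfac : ∀ z ∈ K, ∀ z' ∈ K, D (q z) = D (q z') → e z = e z' := by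
    intro z hz z' hz' hzz
    have h1 := hi (hqm hz) (hqm hz') hzz
    have h2 : z.1 = z'.1 := by
      have := congrArg norm h1
      rwa [hq, norm_ofReal_mul_circ hz.1.1, norm_ofReal_mul_circ hz'.1.1] at this
    by_cases h3 : z.1 = 0
    · simp [hedef, ← h2, h3]
    · have h4 : circ z.2 = circ z'.2 := by
        simp only [hq, ← h2] at h1
        exact mul_left_cancel₀ (by exact_mod_cast h3) h1
      simp only [hedef, h2, hpk _ _ h4]
  have hex : ∀ x ∈ D '' closedBall 0 1, ∃ z ∈ K, D (q z) = x := by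
    rintro _ ⟨w, hw, rfl⟩
    rw [← hqs] at hw
    obtain ⟨z, hz, rfl⟩ := hw
    exact ⟨z, hz, rfl⟩
  choose! inv hinvK hinv using hex
  set f : X → ℂ := fun x => e (inv x) with hf
  have hfD : ∀ z ∈ K, f (D (q z)) = e z := fun z hz => by
    have hm : D (q z) ∈ D '' closedBall 0 1 := mem_image_of_mem _ (hqm hz)
    exact hfac _ (hinvK _ hm) _ hz (hinv _ hm)
  have hfc : ContinuousOn f (D '' closedBall 0 1) := by
    have : D '' closedBall 0 1 = (D ∘ q) '' K := by rw [image_comp, hqs]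
    rw [this]
    refine .of_comp_image hK (hD.comp hqc.continuousOn hqm) ?_
    exact ContinuousOn.congr (f := e) (Continuous.continuousOn (by fun_prop)) hfD
  have hDc : IsClosed (D '' closedBall 0 1) :=
    ((isCompact_closedBall (0 : ℂ) 1).image_of_continuousOn hD).isClosed
  have hagree : ∀ x ∈ A ∩ D '' closedBall 0 1, f x = h x := by
    intro x hx
    obtain ⟨w, hw, rfl⟩ := hAD hx
    obtain ⟨s, hs, rfl⟩ := exists_circ_eq (mem_sphere_zero_iff_norm.1 hw)
    have := hfD (1, s) ⟨by simp, hs⟩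
    simp only [hq, hedef, Complex.ofReal_one, one_mul] at this
    rw [this, he]
  refine ⟨fun x => if x ∈ A then h x else f x, ?_, fun x hx => by simp [hx], ?_⟩
  · refine ContinuousOn.union_of_isClosed ?_ ?_ hA hDc
    · exact hh.congr fun x hx => by simp [hx]
    · refine hfc.congr fun x hx => ?_
      by_cases hxA : x ∈ A
      · simp [hxA, hagree x ⟨hxA, hx⟩]
      · simp [hxA]
  · intro x _
    by_cases hxA : x ∈ A
    · simpa [hxA] using h0 x hxA
    · simp [hxA, hf, hedef]

/-! ### The argument principle modulo `2` -/

/-- The parity of the number of zeros of a function on the unit disk is the degree modulo `2` along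
the boundary circle, if the function has odd degree along all small circles around each of its
zeros. -/
theorem deg_modTwo_eq_card_of_odd_index {f : ℂ → ℂ} (Z : Finset ℂ)
    (hf : ContinuousOn f (closedBall 0 1)) (hZ : ∀ z ∈ Z, z ∈ ball (0 : ℂ) 1)
    (h0 : ∀ z ∈ closedBall (0 : ℂ) 1, z ∉ Z → f z ≠ 0)
    (hodd : ∀ z ∈ Z, ∀ᶠ r : ℝ in 𝓝[>] 0, ∃ d, Odd d ∧ HasDeg (fun s => f (z + r * circ s)) d)
    {n : ℤ} (hn : HasDeg (fun s => f (circ s)) n) : (n : ZMod 2) = Z.card := by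
  classical
  induction Z using Finset.induction_on generalizing f n with
  | empty =>
    have := hasDeg_zero_of_disk zero_le_one hf fun z hz => h0 z hz (by simp)
    rw [hn.unique (this.congr fun s => by simp)]
    simp
  | insert z Z hzZ ih =>
    -- choose a small disk around `z` which contains no other zero
    have hzb := hZ z (by simp)
    have h1 : ∀ᶠ r : ℝ in 𝓝[>] 0, closedBall z r ⊆ ball 0 1 :=
      eventually_nhdsWithin_of_eventually_nhds
        (eventually_closedBall_subset (isOpen_ball.mem_nhds hzb))
    have h2 : ∀ᶠ r : ℝ in 𝓝[>] 0, closedBall z r ⊆ (Z : Set ℂ)ᶜ :=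
      eventually_nhdsWithin_of_eventually_nhds
        (eventually_closedBall_subset (Z.finite_toSet.isClosed.isOpen_compl.mem_nhds (by simpa)))
    obtain ⟨r, hr1, hr2, ⟨d, hd, hdeg⟩, hr⟩ :=
      (h1.and (h2.and ((hodd z (by simp)).and self_mem_nhdsWithin))).exists
    have hr : 0 < r := hr
    have hrc : (r : ℂ) ≠ 0 := by exact_mod_cast hr.ne'
    set D : ℂ → ℂ := fun w => z + r * w with hDdef
    have hDi : Function.Injective D := fun w w' h => mul_left_cancel₀ hrc (add_left_cancel h)
    have hDb : D '' closedBall 0 1 = closedBall z r := by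
      ext w
      constructor
      · rintro ⟨w, hw, rfl⟩
        rw [mem_closedBall_zero_iff] at hw
        simp only [hDdef, mem_closedBall, dist_eq_norm, add_sub_cancel_left, norm_mul,
          Complex.norm_real, Real.norm_of_nonneg hr.le]
        nlinarith
      · intro hw
        refine ⟨(w - z) / r, ?_, by simp only [hDdef]; field_simp; ring⟩
        rw [mem_closedBall, dist_eq_norm] at hw
        rw [mem_closedBall_zero_iff, norm_div, Complex.norm_real, Real.norm_of_nonneg hr.le,
          div_le_one hr]
        exact hw
    set A : Set ℂ := closedBall 0 1 \ ball z r with hAdef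
    have hA : IsClosed A := isClosed_closedBall.sdiff isOpen_ball
    have hAne : ∀ w ∈ A, w - z ≠ 0 := fun w hw h => hw.2 (by
      rw [sub_eq_zero.1 h]; exact mem_ball_self hr)
    set h : ℂ → ℂ := fun w => f w * (w - z) ^ (-d) with hhdef
    have hhc : ContinuousOn h A := (hf.mono sdiff_subset).mul
      (ContinuousOn.zpow₀ (by fun_prop) _ fun w hw => Or.inl (hAne w hw))
    have hDs : ∀ s, D (circ s) ∈ closedBall (0 : ℂ) 1 := fun s => ball_subset_closedBall
      (hr1 (hDb ▸ mem_image_of_mem D (by simp [norm_circ])))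
    have hhdeg : HasDeg (fun s => h (D (circ s))) 0 := by
      have h3 : HasDeg (fun s => (r : ℂ) * circ s) 1 := by
        simpa using (HasDeg.const hrc).mul hasDeg_circ
      have := hdeg.mul (h3.zpow (-d))
      simp only [mul_one, add_neg_cancel] at this
      exact this.congr fun s => by simp [hhdef, hDdef]
    have hz0 : ∀ w ∈ closedBall (0 : ℂ) 1, w ∉ Z → w ≠ z → f w ≠ 0 := fun w hw hwZ hwz =>
      h0 w hw (by simp [hwZ, hwz])
    -- the zeros other than `z` have to be left out of the region where the extension is made
    obtain ⟨g, hgc, hgh, hg0⟩ := exists_extension_over_disk (D := D) (A := sphere z r) (h := h)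
      (Continuous.continuousOn (by fun_prop)) hDi.injOn isClosed_sphere (by
        rintro w ⟨hw, w', hw', rfl⟩
        refine ⟨w', ?_, rfl⟩
        rw [mem_sphere, dist_eq_norm] at hw
        simp only [hDdef, add_sub_cancel_left, norm_mul, Complex.norm_real,
          Real.norm_of_nonneg hr.le] at hw
        rw [mem_sphere_zero_iff_norm]
        exact mul_left_cancel₀ hr.ne' (by linarith))
      (hhc.mono fun w hw => ⟨ball_subset_closedBall (hr1 (sphere_subset_closedBall hw)), by
        rw [mem_ball, mem_sphere.1 hw]; exact lt_irrefl _⟩)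
      (fun w hw => mul_ne_zero (hz0 w (ball_subset_closedBall (hr1 (sphere_subset_closedBall hw)))
        (fun hwZ => hr2 (sphere_subset_closedBall hw) hwZ)
        (by rintro rfl; exact hr.ne (by simpa using hw)))
        (zpow_ne_zero _ (hAne w ⟨ball_subset_closedBall (hr1 (sphere_subset_closedBall hw)), by
          rw [mem_ball, mem_sphere.1 hw]; exact lt_irrefl _⟩))) hhdeg
    rw [hDb, union_eq_self_of_subset_left sphere_subset_closedBall] at hgc hg0
    set F : ℂ → ℂ := fun w => if w ∈ closedBall z r then g w else h w with hFdef
    have hFA : ∀ w ∈ A, F w = h w := by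
      intro w hw
      by_cases hwr : w ∈ closedBall z r
      · have : w ∈ sphere z r := by
          have := hw.2
          rw [mem_ball, not_lt] at this
          exact le_antisymm hwr this
        rw [hFdef]
        simp only [if_pos hwr, hgh w this]
      · simp only [hFdef, if_neg hwr]
    have hFc : ContinuousOn F (closedBall 0 1) := by
      refine ContinuousOn.mono (s := closedBall z r ∪ A) ?_ fun w hw => ?_
      · exact (hgc.congr fun w hw => if_pos hw).union_of_isClosed
          (hhc.congr hFA) isClosed_closedBall hA
      · by_cases hwr : w ∈ closedBall z r
        · exact Or.inl hwr
        · exact Or.inr ⟨hw, fun h => hwr (ball_subset_closedBall h)⟩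
    have hcircA : ∀ s, circ s ∈ A := fun s => ⟨by simp [norm_circ], fun hb => by
      have := hr1 (ball_subset_closedBall hb)
      simp [norm_circ] at this⟩
    -- the degree of `w ↦ w - z` along the unit circle is one
    have hw1 : HasDeg (fun s => circ s - z) 1 := by
      refine HasDeg.near (v := circ) (by fun_prop) (fun s => by simp [circ_periodic s])
        (by fun_prop) circ_periodic (fun s => ?_) hasDeg_circ
      simpa [norm_circ] using hzb
    have hFn : HasDeg (fun s => F (circ s)) (n + -d) := by
      have := hn.mul (hw1.zpow (-d))
      rw [mul_one] at this
      exact this.congr fun s => by rw [hFA _ (hcircA s)]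
    have key := ih hFc (fun w hw => hZ w (by simp [hw])) (fun w hw hwZ => ?_)
      (fun w hw => ?_) hFn
    · rw [Finset.card_insert_of_notMem hzZ]
      push_cast at key ⊢
      rw [← key, show (d : ZMod 2) = 1 from (ZMod.intCast_eq_one_iff_odd).2 hd]
      ring
    · by_cases hwr : w ∈ closedBall z r
      · simpa only [hFdef, if_pos hwr] using hg0 w hwr
      · have hwA : w ∈ A := ⟨hw, fun h => hwr (ball_subset_closedBall h)⟩
        rw [hFA w hwA]
        refine mul_ne_zero (hz0 w hw hwZ ?_) (zpow_ne_zero _ (hAne w hwA))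
        rintro rfl
        exact hwr (mem_closedBall_self hr.le)
    · -- near the other zeros the function has been multiplied by a function without zeros
      have hwr : w ∉ closedBall z r := fun h => hr2 h hw
      have h3 : ∀ᶠ ρ : ℝ in 𝓝[>] 0, closedBall w ρ ⊆ (closedBall z r)ᶜ ∩ ball 0 1 :=
        eventually_nhdsWithin_of_eventually_nhds (eventually_closedBall_subset
          ((isClosed_closedBall.isOpen_compl.inter isOpen_ball).mem_nhds
            ⟨hwr, hZ w (by simp [hw])⟩))
      filter_upwards [hodd w (by simp [hw]), h3, self_mem_nhdsWithin] with ρ ⟨d', hd', hdeg'⟩ hρ hρ0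
      have hρ0 : 0 < ρ := hρ0
      have hne : ∀ y ∈ closedBall w ρ, y - z ≠ 0 := fun y hy h => (hρ hy).1 (by
        rw [sub_eq_zero.1 h]; exact mem_closedBall_self hr.le)
      have h4 := (hasDeg_zero_of_disk (f := fun y => y - z) hρ0.le (by fun_prop) hne).zpow (-d)
      refine ⟨d', hd', ?_⟩
      have h5 := hdeg'.mul h4
      rw [mul_zero, add_zero] at h5
      refine h5.congr fun s => ?_
      have : w + ρ * circ s ∈ closedBall w ρ := by
        rw [mem_closedBall, dist_eq_norm, add_sub_cancel_left, norm_ofReal_mul_circ hρ0.le]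
      rw [hFA _ ⟨ball_subset_closedBall (hρ this).2,
        fun h => (hρ this).1 (ball_subset_closedBall h)⟩]

/-- The parity of the number of zeros of a function on the unit disk which is locally injective at
its zeros is the degree modulo `2` along the boundary circle. -/
theorem deg_modTwo_eq_card {f : ℂ → ℂ} (Z : Finset ℂ)
    (hf : ContinuousOn f (closedBall 0 1)) (hZ : ∀ z, z ∈ Z ↔ z ∈ closedBall (0 : ℂ) 1 ∧ f z = 0)
    (h0 : ∀ z ∈ sphere (0 : ℂ) 1, f z ≠ 0) (hinj : ∀ z ∈ Z, ∃ V ∈ 𝓝 z, InjOn f V)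
    {n : ℤ} (hn : HasDeg (fun s => f (circ s)) n) : (n : ZMod 2) = Z.card := by
  have hZb : ∀ z ∈ Z, z ∈ ball (0 : ℂ) 1 := by
    intro z hz
    obtain ⟨h1, h2⟩ := (hZ z).1 hz
    exact (eq_or_lt_of_le (mem_closedBall.1 h1)).resolve_left fun h => h0 z h h2
  refine deg_modTwo_eq_card_of_odd_index Z hf hZb (fun z hz hzZ h => hzZ ((hZ z).2 ⟨hz, h⟩))
    (fun z hz => ?_) hn
  obtain ⟨V, hV, hVi⟩ := hinj z hz
  have h1 : ∀ᶠ r : ℝ in 𝓝[>] 0, closedBall z r ⊆ V ∩ ball 0 1 :=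
    eventually_nhdsWithin_of_eventually_nhds (eventually_closedBall_subset
      (inter_mem hV (isOpen_ball.mem_nhds (hZb z hz))))
  filter_upwards [h1, self_mem_nhdsWithin] with r hr hr0
  obtain ⟨d, hd, hdeg⟩ := exists_odd_hasDeg_of_injOn hr0
    (hf.mono fun w hw => ball_subset_closedBall (hr hw).2) (hVi.mono fun w hw => (hr hw).1)
  exact ⟨d, hd, hdeg.congr fun s => by rw [((hZ z).1 hz).2, sub_zero]⟩

/-! ### Sliding a loop across a disk -/

/-- Sliding a loop across a disk `D` changes the degree of a nonvanishing function `U`, defined off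
the interior of the disk, by its degree `m` along the boundary of the disk, modulo `2`.

Embed the annulus in the plane by `e`, and let `c` be the image of the centre of `D`. Then `e - c`
has odd degree `d` along the boundary of `D`, so that `U ^ d * (e - c) ^ (-m)` has degree zero there
and extends to a nonvanishing function on the annulus. Its degrees along the two ends, which are
`d * n₀` and `d * n₁ - m`, agree. -/
theorem deg_annulus_modTwo {F : Type*} [TopologicalSpace F] [T2Space F] {a : ℝ × ℝ → F}
    (ha : ContinuousOn a (Icc 0 1 ×ˢ univ))
    (hap : ∀ t ∈ Icc (0 : ℝ) 1, Function.Periodic (fun s => a (t, s)) 1)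
    (hai : InjOn a (Icc 0 1 ×ˢ Ico 0 1)) {D : ℂ → F} (hD : ContinuousOn D (closedBall 0 1))
    (hDi : InjOn D (closedBall 0 1)) (hDa : D '' closedBall 0 1 ⊆ a '' (Ioo 0 1 ×ˢ univ))
    {A : Set F} (hA : IsClosed A) (hAD : A ∩ D '' closedBall 0 1 = D '' sphere 0 1)
    (haA : a '' (Icc 0 1 ×ˢ univ) ⊆ A ∪ D '' closedBall 0 1) {U : F → ℂ} (hU : ContinuousOn U A)
    (hU0 : ∀ x ∈ A, U x ≠ 0) {m n₀ n₁ : ℤ} (hm : HasDeg (fun s => U (D (circ s))) m)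
    (h₀ : HasDeg (fun s => U (a (0, s))) n₀) (h₁ : HasDeg (fun s => U (a (1, s))) n₁) :
    (n₁ : ZMod 2) = n₀ + m := by
  classical
  set T : Set (ℝ × ℝ) := Icc 0 1 ×ˢ univ with hT
  set K : Set (ℝ × ℝ) := Icc 0 1 ×ˢ Icc 0 1 with hKdef
  have hK : IsCompact K := isCompact_Icc.prod isCompact_Icc
  have hKT : K ⊆ T := prod_mono_right (subset_univ _)
  have hfr : ∀ t ∈ Icc (0 : ℝ) 1, ∀ s, a (t, s) = a (t, Int.fract s) := by
    intro t ht s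
    have := (hap t ht).sub_int_mul_eq (x := s) ⌊s⌋
    rw [mul_one, Int.self_sub_floor] at this
    exact this.symm
  have haK : a '' T = a '' K := by
    refine subset_antisymm ?_ (image_mono hKT)
    rintro _ ⟨⟨t, s⟩, hz, rfl⟩
    exact ⟨(t, Int.fract s), ⟨hz.1, Int.fract_nonneg _, (Int.fract_lt_one _).le⟩,
      (hfr t hz.1 s).symm⟩
  have hinj : ∀ z ∈ T, ∀ z' ∈ T, a z = a z' → z.1 = z'.1 ∧ circ z.2 = circ z'.2 := by
    rintro ⟨t, s⟩ hz ⟨t', s'⟩ hz' h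
    rw [hfr t hz.1, hfr t' hz'.1] at h
    have := hai (x₁ := (t, Int.fract s)) (x₂ := (t', Int.fract s'))
      ⟨hz.1, Int.fract_nonneg _, Int.fract_lt_one _⟩
      ⟨hz'.1, Int.fract_nonneg _, Int.fract_lt_one _⟩ h
    obtain ⟨h1, h2⟩ := Prod.mk.inj this
    refine ⟨h1, circ_eq_iff.2 ⟨⌊s⌋ - ⌊s'⌋, ?_⟩⟩
    have h3 := Int.floor_add_fract s
    have h4 := Int.floor_add_fract s'
    push_cast
    linarith
  -- the annulus is the plane annulus `1 ≤ |z| ≤ 2`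
  set E : ℝ × ℝ → ℂ := fun z => ((1 + z.1 : ℝ) : ℂ) * circ z.2 with hE
  have hEn : ∀ z ∈ T, ‖E z‖ = 1 + z.1 := fun z hz =>
    norm_ofReal_mul_circ (by linarith [hz.1.1]) _
  choose! inv hinvT hinv using fun x (hx : x ∈ a '' T) => hx
  set e : F → ℂ := fun x => E (inv x) with he
  have hea : ∀ z ∈ T, e (a z) = E z := by
    intro z hz
    obtain ⟨h1, h2⟩ := hinj _ (hinvT _ (mem_image_of_mem a hz)) z hz
      (hinv _ (mem_image_of_mem a hz))
    simp only [he, hE, h1, h2]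
  have hec : ContinuousOn e (a '' T) := by
    rw [haK]
    exact .of_comp_image hK (ha.mono hKT) (ContinuousOn.congr (f := E)
      (Continuous.continuousOn (by fun_prop)) fun z hz => hea z (hKT hz))
  have hei : InjOn e (a '' T) := by
    rintro _ ⟨z, hz, rfl⟩ _ ⟨z', hz', rfl⟩ h
    rw [hea z hz, hea z' hz'] at h
    have h1 : z.1 = z'.1 := by
      have := congrArg norm h
      rw [hEn z hz, hEn z' hz'] at this
      linarith
    have h2 : circ z.2 = circ z'.2 := by
      simp only [hE, h1] at h
      refine mul_left_cancel₀ ?_ h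
      have := hz'.1.1
      exact_mod_cast (show (1 + z'.1 : ℝ) ≠ 0 by positivity)
    obtain ⟨k, hk⟩ := circ_eq_iff.1 h2
    have h3 := (hap z'.1 hz'.1).int_mul k z'.2
    rw [mul_one] at h3
    rw [show z = (z'.1, z'.2 + k) from Prod.ext h1 hk]
    exact h3
  have hDT : D '' closedBall 0 1 ⊆ a '' T :=
    hDa.trans (image_mono (prod_mono_left Ioo_subset_Icc_self))
  have h0b : (0 : ℂ) ∈ closedBall 0 1 := by simp
  set c := e (D 0) with hc
  have hcn : 1 < ‖c‖ ∧ ‖c‖ < 2 := by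
    obtain ⟨z, hz, h⟩ := hDa (mem_image_of_mem D h0b)
    have hzT : z ∈ T := ⟨Ioo_subset_Icc_self hz.1, hz.2⟩
    rw [hc, ← h, hea z hzT, hEn z hzT]
    constructor <;> linarith [hz.1.1, hz.1.2]
  obtain ⟨d, hd, hdeg⟩ := exists_odd_hasDeg_of_injOn (g := e ∘ D) zero_lt_one
    (hec.comp hD fun w hw => hDT (mem_image_of_mem D hw))
    (fun w hw w' hw' h => hDi hw hw' (hei (hDT (mem_image_of_mem D hw))
      (hDT (mem_image_of_mem D hw')) h))
  set A' := A ∩ a '' T with hA'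
  have hA'c : IsClosed A' := hA.inter (haK ▸ (hK.image_of_continuousOn (ha.mono hKT)).isClosed)
  have hwne : ∀ x ∈ A', e x - c ≠ 0 := by
    rintro x ⟨hx, hxT⟩ h
    have h1 : x = D 0 := hei hxT (hDT (mem_image_of_mem D h0b)) (sub_eq_zero.1 h)
    obtain ⟨w, hw, hwD⟩ := hAD.le (show D 0 ∈ A ∩ D '' closedBall 0 1 from
      ⟨h1 ▸ hx, mem_image_of_mem D h0b⟩)
    have := hDi (sphere_subset_closedBall hw) h0b hwD
    simp [this] at hw
  set h : F → ℂ := fun x => U x ^ d * (e x - c) ^ (-m) with hh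
  have hhc : ContinuousOn h A' :=
    ((hU.mono inter_subset_left).zpow₀ _ fun x hx => Or.inl (hU0 x hx.1)).mul
      (((hec.mono inter_subset_right).sub continuousOn_const).zpow₀ _
        fun x hx => Or.inl (hwne x hx))
  obtain ⟨g, hgc, hgh, hg0⟩ := exists_extension_over_disk hD hDi hA'c
    (fun x hx => hAD.le ⟨hx.1.1, hx.2⟩) hhc
    (fun x hx => mul_ne_zero (zpow_ne_zero _ (hU0 x hx.1)) (zpow_ne_zero _ (hwne x hx)))
    (by
      have h1 : HasDeg (fun s => e (D (circ s)) - c) d :=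
        hdeg.congr fun s => by simp [hc]
      have := (hm.zpow d).mul (h1.zpow (-m))
      rwa [show d * m + -m * d = 0 by ring] at this)
  have hcover : ∀ z ∈ T, a z ∈ A' ∪ D '' closedBall 0 1 := fun z hz =>
    (haA (mem_image_of_mem a hz)).imp (fun hx => ⟨hx, mem_image_of_mem a hz⟩) id
  -- the boundary curves of the annulus do not meet the disk
  have hbd : ∀ t ∈ Icc (0 : ℝ) 1, t ∉ Ioo (0 : ℝ) 1 → ∀ s, a (t, s) ∈ A' := by
    intro t ht ht' s
    refine (hcover (t, s) ⟨ht, mem_univ _⟩).resolve_right fun hx => ?_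
    obtain ⟨z, hz, hza⟩ := hDa hx
    have := (hinj z ⟨Ioo_subset_Icc_self hz.1, hz.2⟩ (t, s) ⟨ht, mem_univ _⟩ hza).1
    exact ht' (by have h1 := hz.1; rwa [this] at h1)
  have hw0 : HasDeg (fun s => e (a (0, s)) - c) 0 := by
    refine HasDeg.congr (u := fun s => circ s - c) ?_ fun s => by
      rw [hea _ ⟨by simp, mem_univ _⟩]; simp [hE]
    refine HasDeg.near (v := fun _ => -c) (by fun_prop) (fun s => by simp [circ_periodic s])
      (by fun_prop) (fun _ => rfl) (fun s => by simpa [norm_circ] using hcn.1) (.const ?_)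
    rw [neg_ne_zero, ← norm_pos_iff]
    linarith
  have hw1 : HasDeg (fun s => e (a (1, s)) - c) 1 := by
    refine HasDeg.congr (u := fun s => 2 * circ s - c) ?_ fun s => by
      rw [hea _ ⟨by simp, mem_univ _⟩]; simp only [hE]; norm_num
    have h2 : HasDeg (fun s => 2 * circ s) 1 := by
      simpa using (HasDeg.const (two_ne_zero (α := ℂ))).mul hasDeg_circ
    exact HasDeg.near (v := fun s => 2 * circ s) (by fun_prop)
      (fun s => by simp [circ_periodic s]) (by fun_prop)
      (fun s => by simp [circ_periodic s]) (fun s => by simpa [norm_circ] using hcn.2) h2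
  have hg0' : HasDeg (fun s => g (a (0, s))) (d * n₀ + -m * 0) :=
    ((h₀.zpow d).mul (hw0.zpow (-m))).congr fun s => hgh _ (hbd 0 (by simp) (by simp) s)
  have hg1' : HasDeg (fun s => g (a (1, s))) (d * n₁ + -m * 1) :=
    ((h₁.zpow d).mul (hw1.zpow (-m))).congr fun s => hgh _ (hbd 1 (by simp) (by simp) s)
  have hg1 := HasDeg.homotopy (H := g ∘ a) (hgc.comp ha hcover)
    (fun t ht s => congrArg g (hap t ht s)) (fun t ht s => hg0 _ (hcover _ ⟨ht, mem_univ _⟩)) hg0'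
  have hkey := congrArg (Int.cast : ℤ → ZMod 2) (hg1'.unique hg1)
  push_cast at hkey
  rw [show (d : ZMod 2) = 1 from (ZMod.intCast_eq_one_iff_odd).2 hd] at hkey
  linear_combination hkey

/-! ### Functions with regular zeros on closed surfaces -/

/-- The complex plane as the Euclidean plane. -/
noncomputable def planeIso : ℂ ≃ₗᵢ[ℝ] E2 := Complex.orthonormalBasisOneI.repr

section Surface

variable {F : Type*} [TopologicalSpace F] [ChartedSpace E2 F]

/-- The preferred chart of a surface at `x`, with values in `ℂ`. -/
noncomputable def chartMap (x z : F) : ℂ := planeIso.symm (extChartAt (𝓡 2) x z)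

/-- The inverse of the preferred chart of a surface at `x`, as a function on `ℂ`. -/
noncomputable def chartInv (x : F) (w : ℂ) : F := (extChartAt (𝓡 2) x).symm (planeIso w)

/-- The domain in `ℂ` of the inverse of the preferred chart at `x`. -/
def chartDom (x : F) : Set ℂ := planeIso ⁻¹' (extChartAt (𝓡 2) x).target

theorem isOpen_chartDom (x : F) : IsOpen (chartDom x) :=
  (isOpen_extChartAt_target x).preimage planeIso.continuous

theorem chartInv_chartMap {x z : F} (hz : z ∈ (chartAt E2 x).source) :
    chartInv x (chartMap x z) = z := by
  rw [chartInv, chartMap, LinearIsometryEquiv.apply_symm_apply]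
  exact (extChartAt (𝓡 2) x).left_inv (by rwa [extChartAt_source])

theorem chartMap_chartInv {x : F} {w : ℂ} (hw : w ∈ chartDom x) :
    chartMap x (chartInv x w) = w := by
  rw [chartInv, chartMap, (extChartAt (𝓡 2) x).right_inv hw, LinearIsometryEquiv.symm_apply_apply]

theorem chartMap_mem {x z : F} (hz : z ∈ (chartAt E2 x).source) : chartMap x z ∈ chartDom x := by
  rw [chartDom, mem_preimage, chartMap, LinearIsometryEquiv.apply_symm_apply]
  exact (extChartAt (𝓡 2) x).map_source (by rwa [extChartAt_source])

theorem continuousOn_chartInv (x : F) : ContinuousOn (chartInv x) (chartDom x) :=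
  (continuousOn_extChartAt_symm x).comp planeIso.continuous.continuousOn fun _ hw => hw

theorem continuousOn_chartMap (x : F) : ContinuousOn (chartMap x) (chartAt E2 x).source := by
  rw [← extChartAt_source (𝓡 2)]
  exact planeIso.symm.continuous.comp_continuousOn (continuousOn_extChartAt x)

theorem injOn_chartInv (x : F) : InjOn (chartInv x) (chartDom x) := fun w hw w' hw' h => by
  rw [← chartMap_chartInv hw, h, chartMap_chartInv hw']

theorem contMDiff_sub_mul {f : F → ℂ} (hf : ContMDiff (𝓡 2) 𝓘(ℝ, ℂ) ∞ f) {ρ : F → ℝ}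
    (hρ : ContMDiff (𝓡 2) 𝓘(ℝ, ℝ) ∞ ρ) (c : ℂ) :
    ContMDiff (𝓡 2) 𝓘(ℝ, ℂ) ∞ (fun y => f y - ρ y * c) := by
  have h1 : ContMDiff (𝓡 2) 𝓘(ℝ, ℂ) ∞ (fun y => ρ y • c) := hρ.smul contMDiff_const
  exact (hf.sub h1).congr fun y => by simp

variable [IsManifold (𝓡 2) ∞ F]

theorem contDiffOn_comp_chartInv {V : Type*} [NormedAddCommGroup V] [NormedSpace ℝ V]
    {f : F → V} (hf : ContMDiff (𝓡 2) 𝓘(ℝ, V) ∞ f) (x : F) :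
    ContDiffOn ℝ ∞ (f ∘ chartInv x) (chartDom x) := by
  have h1 : ContMDiffOn 𝓘(ℝ, E2) 𝓘(ℝ, V) ∞ (f ∘ (extChartAt (𝓡 2) x).symm)
      (extChartAt (𝓡 2) x).target := hf.comp_contMDiffOn (contMDiffOn_extChartAt_symm x)
  exact h1.contDiffOn.comp planeIso.contDiff.contDiffOn fun _ hw => hw

theorem ContinuousLinearMap.injective_iff_det_ne_zero (A : ℂ →L[ℝ] ℂ) :
    Function.Injective A ↔ A.det ≠ 0 := by
  rw [ContinuousLinearMap.det, ← isUnit_iff_ne_zero, ← LinearMap.isUnit_iff_isUnit_det,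
    LinearMap.isUnit_iff_ker_eq_bot, LinearMap.ker_eq_bot]
  rfl

theorem injective_mfderiv_iff {f : F → ℂ} (hf : ContMDiff (𝓡 2) 𝓘(ℝ, ℂ) ∞ f) {x z : F}
    (hz : z ∈ (chartAt E2 x).source) : Function.Injective (mfderiv (𝓡 2) 𝓘(ℝ, ℂ) f z) ↔
      (fderiv ℝ (f ∘ chartInv x) (chartMap x z)).det ≠ 0 := by
  have hd : DifferentiableAt ℝ (f ∘ chartInv x) (chartMap x z) :=
    ((contDiffOn_comp_chartInv hf x).contDiffAt
      ((isOpen_chartDom x).mem_nhds (chartMap_mem hz))).differentiableAt (by simp)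
  have he : f =ᶠ[𝓝 z] (f ∘ chartInv x) ∘ chartMap x := by
    filter_upwards [(chartAt E2 x).open_source.mem_nhds hz] with y hy
    simp only [Function.comp, chartInv_chartMap hy]
  have hext : MDifferentiableAt (𝓡 2) 𝓘(ℝ, E2) (extChartAt (𝓡 2) x) z :=
    mdifferentiableAt_extChartAt hz
  have hiso : MDifferentiableAt 𝓘(ℝ, E2) 𝓘(ℝ, ℂ) planeIso.symm (extChartAt (𝓡 2) x z) :=
    planeIso.symm.toContinuousLinearEquiv.differentiableAt.mdifferentiableAt
  have hmap : mfderiv (𝓡 2) 𝓘(ℝ, ℂ) (chartMap x) z =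
      (mfderiv 𝓘(ℝ, E2) 𝓘(ℝ, ℂ) planeIso.symm (extChartAt (𝓡 2) x z)).comp
        (mfderiv (𝓡 2) 𝓘(ℝ, E2) (extChartAt (𝓡 2) x) z) :=
    mfderiv_comp (I' := 𝓘(ℝ, E2)) z hiso hext
  have hbij : Function.Bijective (mfderiv (𝓡 2) 𝓘(ℝ, ℂ) (chartMap x) z) := by
    rw [hmap, mfderiv_eq_fderiv]
    have h2 : fderiv ℝ planeIso.symm (extChartAt (𝓡 2) x z)
        = (planeIso.symm.toContinuousLinearEquiv : E2 →L[ℝ] ℂ) :=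
      planeIso.symm.toContinuousLinearEquiv.fderiv
    rw [h2]
    obtain ⟨e, he⟩ := isInvertible_mfderiv_extChartAt (I := 𝓡 2) (x := x) (y := z)
      (by rwa [extChartAt_source])
    rw [← he]
    exact planeIso.symm.bijective.comp e.bijective
  have hcomp : mfderiv (𝓡 2) 𝓘(ℝ, ℂ) f z =
      (mfderiv 𝓘(ℝ, ℂ) 𝓘(ℝ, ℂ) (f ∘ chartInv x) (chartMap x z)).comp
        (mfderiv (𝓡 2) 𝓘(ℝ, ℂ) (chartMap x) z) := by
    rw [he.mfderiv_eq]
    exact mfderiv_comp (I' := 𝓘(ℝ, ℂ)) z hd.mdifferentiableAt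
      (hiso.comp z hext)
  rw [← ContinuousLinearMap.injective_iff_det_ne_zero, hcomp, mfderiv_eq_fderiv]
  exact Function.Injective.of_comp_iff' (fderiv ℝ (f ∘ chartInv x) (chartMap x z)) hbij

/-- All zeros of the function `f` on the surface are regular. -/
def HasRegularZeros (f : F → ℂ) : Prop :=
  ∀ z, f z = 0 → Function.Injective (mfderiv (𝓡 2) 𝓘(ℝ, ℂ) f z)

theorem HasRegularZeros.exists_injOn {f : F → ℂ} (hf : ContMDiff (𝓡 2) 𝓘(ℝ, ℂ) ∞ f)
    (hr : HasRegularZeros f) {z : F} (hz : f z = 0) : ∃ V ∈ 𝓝 z, InjOn f V := by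
  have hzs := mem_chart_source E2 z
  have hdet := (injective_mfderiv_iff hf hzs).1 (hr z hz)
  have hc := (contDiffOn_comp_chartInv hf z).contDiffAt
    ((isOpen_chartDom z).mem_nhds (chartMap_mem hzs))
  set A := fderiv ℝ (f ∘ chartInv z) (chartMap z z) with hA
  have hs : HasStrictFDerivAt (f ∘ chartInv z)
      (A.toContinuousLinearEquivOfDetNeZero hdet : ℂ →L[ℝ] ℂ) (chartMap z z) :=
    hc.hasStrictFDerivAt (by simp)
  set e := hs.toOpenPartialHomeomorph _ with he
  refine ⟨(chartAt E2 z).source ∩ chartMap z ⁻¹' e.source, ?_, ?_⟩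
  · have hzn := (chartAt E2 z).open_source.mem_nhds hzs
    exact inter_mem hzn (((continuousOn_chartMap z).continuousAt hzn).preimage_mem_nhds
      (e.open_source.mem_nhds hs.mem_toOpenPartialHomeomorph_source))
  · intro y hy y' hy' h
    have h1 : chartMap z y = chartMap z y' := e.injOn hy.2 hy'.2 (by
      simpa [he, Function.comp, chartInv_chartMap hy.1, chartInv_chartMap hy'.1] using h)
    rw [← chartInv_chartMap hy.1, h1, chartInv_chartMap hy'.1]

theorem HasRegularZeros.finite [CompactSpace F] {f : F → ℂ}
    (hf : ContMDiff (𝓡 2) 𝓘(ℝ, ℂ) ∞ f) (hr : HasRegularZeros f) : {z | f z = 0}.Finite := by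
  have hK : IsCompact {z | f z = 0} := (isClosed_singleton.preimage hf.continuous).isCompact
  refine hK.finite (isDiscrete_iff_nhdsNE.2 fun z hz => ?_)
  obtain ⟨V, hV, hVi⟩ := hr.exists_injOn hf hz
  rw [← disjoint_iff]
  rw [Filter.disjoint_principal_right]
  refine mem_nhdsWithin_iff_exists_mem_nhds_inter.2 ⟨V, hV, fun y hy hy0 => hy.2 ?_⟩
  exact hVi hy.1 (mem_of_mem_nhds hV) (hy0.trans (Eq.symm hz))

/-- Sard's theorem for the quotient `f / ρ`. -/
theorem ae_injective_mfderiv_sub [CompactSpace F] {f : F → ℂ}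
    (hf : ContMDiff (𝓡 2) 𝓘(ℝ, ℂ) ∞ f) {ρ : F → ℝ} (hρ : ContMDiff (𝓡 2) 𝓘(ℝ, ℝ) ∞ ρ) :
    ∀ᵐ c : ℂ, ∀ z, 0 < ρ z → f z - ρ z * c = 0 →
      Function.Injective (mfderiv (𝓡 2) 𝓘(ℝ, ℂ) (fun y => f y - ρ y * c) z) := by
  obtain ⟨t, -, ht⟩ := isCompact_univ.elim_nhds_subcover (fun x : F => (chartAt E2 x).source)
    (fun x _ => (chartAt E2 x).open_source.mem_nhds (mem_chart_source E2 x))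
  have key : ∀ x : F, ∀ᵐ c : ℂ, ∀ z ∈ (chartAt E2 x).source, 0 < ρ z → f z - ρ z * c = 0 →
      Function.Injective (mfderiv (𝓡 2) 𝓘(ℝ, ℂ) (fun y => f y - ρ y * c) z) := by
    intro x
    have hfx := contDiffOn_comp_chartInv hf x
    have hρx := contDiffOn_comp_chartInv hρ x
    set f' := f ∘ chartInv x with hf'
    set ρ' := ρ ∘ chartInv x with hρ'
    set q : ℂ → ℂ := fun w => (ρ' w)⁻¹ • f' w with hq
    set B : Set ℂ := {w | w ∈ chartDom x ∧ 0 < ρ' w ∧ (fderiv ℝ q w).det = 0} with hB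
    have hfd : ∀ w ∈ chartDom x, DifferentiableAt ℝ f' w := fun w hw =>
      (hfx.contDiffAt ((isOpen_chartDom x).mem_nhds hw)).differentiableAt (by simp)
    have hρd : ∀ w ∈ chartDom x, DifferentiableAt ℝ ρ' w := fun w hw =>
      (hρx.contDiffAt ((isOpen_chartDom x).mem_nhds hw)).differentiableAt (by simp)
    have hqd : ∀ w ∈ chartDom x, 0 < ρ' w → DifferentiableAt ℝ q w := fun w hw hw0 =>
      ((hρd w hw).inv hw0.ne').smul (hfd w hw)
    have hnull : MeasureTheory.volume (q '' B) = 0 :=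
      MeasureTheory.addHaar_image_eq_zero_of_det_fderivWithin_eq_zero _
        (fun w hw => (hqd w hw.1 hw.2.1).hasFDerivAt.hasFDerivWithinAt) fun w hw => hw.2.2
    filter_upwards [MeasureTheory.measure_eq_zero_iff_ae_notMem.1 hnull] with c hc z hz hz0 hfz
    rw [injective_mfderiv_iff (contMDiff_sub_mul hf hρ c) hz]
    set w := chartMap x z with hw
    have hwd : w ∈ chartDom x := chartMap_mem hz
    have hwz : chartInv x w = z := chartInv_chartMap hz
    have hw0 : 0 < ρ' w := by rwa [hρ', Function.comp, hwz]
    have hqw : q w = c := by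
      simp only [hq, hf', hρ', Function.comp, hwz, Complex.real_smul]
      push_cast
      rw [sub_eq_zero.1 hfz, inv_mul_cancel_left₀]
      exact_mod_cast hz0.ne'
    have hderiv : HasFDerivAt ((fun y => f y - ρ y * c) ∘ chartInv x) (ρ' w • fderiv ℝ q w) w := by
      have h1 := (hρd w hwd).hasFDerivAt.smul ((hqd w hwd hw0).hasFDerivAt.sub_const c)
      rw [hqw, sub_self] at h1
      have h2 : (fderiv ℝ ρ' w).smulRight (0 : ℂ) = 0 := by ext; simp
      rw [h2, add_zero] at h1
      refine h1.congr_of_eventuallyEq ?_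
      have h3 : ∀ᶠ y in 𝓝 w, ρ' y ≠ 0 := (hρd w hwd).continuousAt.eventually_ne hw0.ne'
      filter_upwards [h3] with y hy
      have hy' : ((ρ' y : ℝ) : ℂ) ≠ 0 := by exact_mod_cast hy
      simp only [hq, Function.comp, Pi.smul_apply', Complex.real_smul]
      push_cast
      rw [mul_sub, mul_inv_cancel_left₀ hy']
      rfl
    rw [hderiv.fderiv, ← ContinuousLinearMap.injective_iff_det_ne_zero]
    have hdq : (fderiv ℝ q w).det ≠ 0 := fun h => hc ⟨w, ⟨hwd, hw0, h⟩, hqw⟩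
    rw [← ContinuousLinearMap.injective_iff_det_ne_zero] at hdq
    intro v v' h
    exact hdq (smul_right_injective ℂ hw0.ne' h)
  have : ∀ᵐ c : ℂ, ∀ x ∈ t, ∀ z ∈ (chartAt E2 x).source, 0 < ρ z → f z - ρ z * c = 0 →
      Function.Injective (mfderiv (𝓡 2) 𝓘(ℝ, ℂ) (fun y => f y - ρ y * c) z) :=
    (MeasureTheory.ae_ball_iff t.countable_toSet).2 fun x _ => key x
  filter_upwards [this] with c hc z hz hfz
  obtain ⟨x, hx, hzx⟩ := mem_iUnion₂.1 (ht (mem_univ z))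
  exact hc x hx z hzx hz hfz

/-- If `f` has regular zeros, then so has `f - ρ c` for almost every constant `c`. -/
theorem HasRegularZeros.ae_sub_mul [CompactSpace F] {f : F → ℂ}
    (hf : ContMDiff (𝓡 2) 𝓘(ℝ, ℂ) ∞ f) (hr : HasRegularZeros f) {ρ : F → ℝ}
    (hρ : ContMDiff (𝓡 2) 𝓘(ℝ, ℝ) ∞ ρ) (hρ0 : ∀ x, 0 ≤ ρ x) :
    ∀ᵐ c : ℂ, HasRegularZeros fun y => f y - ρ y * c := by
  filter_upwards [ae_injective_mfderiv_sub hf hρ] with c hc z hz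
  rcases (hρ0 z).eq_or_lt with h0 | h0
  · -- here `ρ` has a minimum, so that its derivative vanishes
    have hzs := mem_chart_source E2 z
    have hfz : f z = 0 := by simpa [← h0] using hz
    have h1 := (injective_mfderiv_iff hf hzs).1 (hr z hfz)
    rw [injective_mfderiv_iff (contMDiff_sub_mul hf hρ c) hzs]
    have hw : chartMap z z ∈ chartDom z := chartMap_mem hzs
    have hfd := ((contDiffOn_comp_chartInv hf z).contDiffAt
      ((isOpen_chartDom z).mem_nhds hw)).differentiableAt (by simp)
    have hρd := ((contDiffOn_comp_chartInv hρ z).contDiffAt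
      ((isOpen_chartDom z).mem_nhds hw)).differentiableAt (by simp)
    have hmin : fderiv ℝ (ρ ∘ chartInv z) (chartMap z z) = 0 := by
      refine IsLocalMin.fderiv_eq_zero (Eventually.of_forall fun y => ?_)
      simp only [Function.comp, chartInv_chartMap hzs, ← h0]
      exact hρ0 _
    have h2 := hfd.hasFDerivAt.sub (hρd.hasFDerivAt.smul_const c)
    rw [hmin] at h2
    have h3 : HasFDerivAt ((fun y => f y - ρ y * c) ∘ chartInv z)
        (fderiv ℝ (f ∘ chartInv z) (chartMap z z)) (chartMap z z) := by
      have h4 : (0 : ℂ →L[ℝ] ℝ).smulRight c = 0 := by ext; simp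
      rw [h4, sub_zero] at h2
      refine h2.congr_of_eventuallyEq (Eventually.of_forall fun y => ?_)
      simp [Function.comp]
    rwa [h3.fderiv]
  · exact hc z h0 hz

end Surface

/-! ### Parity of the number of zeros -/

section Parity

variable {F : Type*} [TopologicalSpace F] [ChartedSpace E2 F]
  [IsManifold (𝓡 2) ∞ F] [CompactSpace F]

/-- The parity of the number of zeros in an embedded disk is the degree modulo `2` along its
boundary. -/
theorem deg_modTwo_eq_ncard_zeros {f : F → ℂ} (hf : ContMDiff (𝓡 2) 𝓘(ℝ, ℂ) ∞ f)
    (hr : HasRegularZeros f) {D : ℂ → F} (hD : ContinuousOn D (closedBall 0 1))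
    (hDi : InjOn D (closedBall 0 1)) (h0 : ∀ w ∈ sphere (0 : ℂ) 1, f (D w) ≠ 0) {n : ℤ}
    (hn : HasDeg (fun s => f (D (circ s))) n) :
    (n : ZMod 2) = ({z | f z = 0} ∩ D '' closedBall 0 1).ncard := by
  have hfin : (closedBall (0 : ℂ) 1 ∩ D ⁻¹' {z | f z = 0}).Finite :=
    Finite.of_finite_image (f := D) ((hr.finite hf).subset (by
      rintro _ ⟨w, hw, rfl⟩; exact hw.2)) (hDi.mono inter_subset_left)
  have h1 := deg_modTwo_eq_card (f := f ∘ D) hfin.toFinset (hf.continuous.comp_continuousOn hD)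
    (fun z => by simp) h0 (fun w hw => ?_) hn
  · rw [h1, ← ncard_eq_toFinset_card _ hfin, ← (hDi.mono inter_subset_left).ncard_image,
      image_inter_preimage, inter_comm]
  · obtain ⟨hwb, hw0⟩ : w ∈ closedBall (0 : ℂ) 1 ∧ f (D w) = 0 := by simpa using hw
    have hwb' : w ∈ ball (0 : ℂ) 1 := (eq_or_lt_of_le (mem_closedBall.1 hwb)).resolve_left
      fun h => h0 w h hw0
    obtain ⟨V, hV, hVi⟩ := hr.exists_injOn hf hw0
    have hcb : closedBall (0 : ℂ) 1 ∈ 𝓝 w :=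
      mem_of_superset (isOpen_ball.mem_nhds hwb') ball_subset_closedBall
    refine ⟨closedBall 0 1 ∩ D ⁻¹' V, inter_mem hcb
      ((hD.continuousAt hcb).preimage_mem_nhds hV), fun y hy y' hy' h => ?_⟩
    exact hDi hy.1 hy'.1 (hVi hy.2 hy'.2 h)

variable [T2Space F]

/-- Around each point there is a bump function such that perturbations by its multiples do not
change the parity of the number of zeros: the perturbation takes place inside a disk. -/
theorem exists_bump_ncard_zeros (x : F) : ∃ ρ : F → ℝ, ContMDiff (𝓡 2) 𝓘(ℝ, ℝ) ∞ ρ ∧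
    (∀ y, 0 ≤ ρ y) ∧ (∀ᶠ y in 𝓝 x, ρ y = 1) ∧
    ∀ (f : F → ℂ) (c : ℂ), ContMDiff (𝓡 2) 𝓘(ℝ, ℂ) ∞ f → HasRegularZeros f →
      HasRegularZeros (fun y => f y - ρ y * c) →
      ({z | f z = 0}.ncard : ZMod 2) = {z | f z - ρ z * c = 0}.ncard := by
  obtain ⟨η, hη, hηb⟩ := Metric.isOpen_iff.1 (isOpen_chartDom x) (chartMap x x)
    (chartMap_mem (mem_chart_source E2 x))
  set z₀ := chartMap x x with hz₀
  set δ := η / 4 with hδ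
  have hδ0 : 0 < δ := by positivity
  have hz₀' : extChartAt (𝓡 2) x x = planeIso z₀ := by
    rw [hz₀, chartMap, LinearIsometryEquiv.apply_symm_apply]
  have hdist : ∀ y, dist (extChartAt (𝓡 2) x y) (extChartAt (𝓡 2) x x) = dist (chartMap x y) z₀ :=
    fun y => by rw [hz₀, chartMap, chartMap, planeIso.symm.dist_map]
  let b : SmoothBumpFunction (𝓡 2) x :=
    { rIn := δ
      rOut := 2 * δ
      rIn_pos := hδ0
      rIn_lt_rOut := by linarith
      closedBall_subset := by
        rintro y ⟨hy, -⟩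
        have h1 : planeIso.symm y ∈ chartDom x := hηb (by
          rw [mem_closedBall, hz₀', ← planeIso.symm.dist_map, planeIso.symm_apply_apply] at hy
          rw [mem_ball]
          linarith)
        rwa [chartDom, mem_preimage, planeIso.apply_symm_apply] at h1 }
  have hb0 : ∀ y, b y ≠ 0 → y ∈ (chartAt E2 x).source ∧ dist (chartMap x y) z₀ < 2 * δ := by
    intro y hy
    have h1 : y ∈ Function.support b := hy
    rw [b.support_eq_inter_preimage] at h1
    refine ⟨h1.1, ?_⟩
    rw [← hdist]
    exact h1.2
  refine ⟨b, b.contMDiff, fun y => b.nonneg, b.eventuallyEq_one, fun f c hf hr hrg => ?_⟩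
  -- a disk, slightly larger than the support of the bump function, without zeros on its boundary
  obtain ⟨r, hr23, hrz⟩ : (Ioo (2 * δ) (3 * δ) \
      ((fun y => dist (chartMap x y) z₀) '' {z | f z = 0})).Nonempty :=
    ((Ioo_infinite (by linarith)).sdiff ((hr.finite hf).image _)).nonempty
  have hr0 : 0 < r := by linarith [hr23.1]
  have hrc : (r : ℂ) ≠ 0 := by exact_mod_cast hr0.ne'
  set T : ℂ → ℂ := fun w => z₀ + r * w with hT
  have hTd : ∀ w, dist (T w) z₀ = r * ‖w‖ := fun w => by
    rw [hT, dist_eq_norm, add_sub_cancel_left, norm_mul, Complex.norm_real,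
      Real.norm_of_nonneg hr0.le]
  have hTm : ∀ w ∈ closedBall (0 : ℂ) 1, T w ∈ chartDom x := fun w hw => hηb (by
    rw [mem_closedBall_zero_iff] at hw
    rw [mem_ball, hTd]
    nlinarith [hr23.2])
  set D : ℂ → F := fun w => chartInv x (T w) with hD
  have hDc : ContinuousOn D (closedBall 0 1) :=
    (continuousOn_chartInv x).comp (Continuous.continuousOn (by fun_prop)) hTm
  have hDi : InjOn D (closedBall 0 1) := fun w hw w' hw' h =>
    mul_left_cancel₀ hrc (add_left_cancel (injOn_chartInv x (hTm w hw) (hTm w' hw') h))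
  have hDd : ∀ w ∈ closedBall (0 : ℂ) 1, dist (chartMap x (D w)) z₀ = r * ‖w‖ := fun w hw => by
    rw [hD, chartMap_chartInv (hTm w hw), hTd]
  have hbs : ∀ w ∈ sphere (0 : ℂ) 1, b (D w) = 0 := by
    intro w hw
    by_contra h
    have h1 := (hb0 _ h).2
    rw [hDd w (sphere_subset_closedBall hw), mem_sphere_zero_iff_norm.1 hw] at h1
    linarith [hr23.1]
  have hbD : ∀ y, y ∉ D '' closedBall 0 1 → b y = 0 := by
    intro y hy
    by_contra h
    obtain ⟨h1, h2⟩ := hb0 _ h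
    refine hy ⟨(chartMap x y - z₀) / r, ?_, ?_⟩
    · rw [mem_closedBall_zero_iff, norm_div, ← dist_eq_norm, Complex.norm_real,
        Real.norm_of_nonneg hr0.le, div_le_one hr0]
      linarith [hr23.1]
    · have : T ((chartMap x y - z₀) / r) = chartMap x y := by
        simp only [hT]
        field_simp
        ring
      simp only [hD, this, chartInv_chartMap h1]
  set g : F → ℂ := fun y => f y - b y * c with hg
  have hgs := contMDiff_sub_mul hf b.contMDiff c
  have hf0 : ∀ w ∈ sphere (0 : ℂ) 1, f (D w) ≠ 0 := fun w hw h => hrz ⟨D w, h, by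
    simp only [hDd w (sphere_subset_closedBall hw), mem_sphere_zero_iff_norm.1 hw, mul_one]⟩
  have hgf : ∀ w ∈ sphere (0 : ℂ) 1, g (D w) = f (D w) := fun w hw => by
    simp [hg, hbs w hw]
  have hcs : ∀ s, circ s ∈ sphere (0 : ℂ) 1 := fun s => by simp [norm_circ]
  obtain ⟨n, hn⟩ := HasDeg.of_continuous (u := fun s => f (D (circ s)))
    (hf.continuous.comp (hDc.comp_continuous continuous_circ
      fun s => sphere_subset_closedBall (hcs s)))
    (fun s => by simp [circ_periodic s]) (fun s => hf0 _ (hcs s))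
  have h1 := deg_modTwo_eq_ncard_zeros hf hr hDc hDi hf0 hn
  have h2 := deg_modTwo_eq_ncard_zeros (f := g) hgs hrg hDc hDi
    (fun w hw => by rw [hgf w hw]; exact hf0 w hw) (hn.congr fun s => hgf _ (hcs s))
  have h3 : {z | f z = 0} \ D '' closedBall 0 1 = {z | g z = 0} \ D '' closedBall 0 1 := by
    ext z
    simp only [Set.mem_sdiff, mem_ofPred_eq, and_congr_left_iff]
    intro hz
    simp [hg, hbD z hz]
  rw [← ncard_inter_add_ncard_sdiff_eq_ncard {z | f z = 0} (D '' closedBall 0 1) (hr.finite hf),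
    ← ncard_inter_add_ncard_sdiff_eq_ncard {z | g z = 0} (D '' closedBall 0 1) (hrg.finite hgs), h3]
  push_cast
  rw [← h1, ← h2]

/-- A function on a closed surface with regular zeros has an even number of zeros: generic
perturbations inside disks move all values to a half-plane. -/
theorem even_ncard_zeros {f : F → ℂ} (hf : ContMDiff (𝓡 2) 𝓘(ℝ, ℂ) ∞ f)
    (hr : HasRegularZeros f) : ({z | f z = 0}.ncard : ZMod 2) = 0 := by
  classical
  choose ρ hρ hρ0 hρ1 hpar using exists_bump_ncard_zeros (F := F)
  obtain ⟨R, hR⟩ := isCompact_univ.exists_bound_of_continuousOn hf.continuous.continuousOn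
  obtain ⟨t, -, ht⟩ := isCompact_univ.elim_nhds_subcover (fun x : F => {y | ρ x y = 1})
    (fun x _ => hρ1 x)
  have key : ∀ t : Finset F, ∃ g : F → ℂ, ContMDiff (𝓡 2) 𝓘(ℝ, ℂ) ∞ g ∧ HasRegularZeros g ∧
      ({z | f z = 0}.ncard : ZMod 2) = {z | g z = 0}.ncard ∧
      (∀ y, (f y).re ≤ (g y).re) ∧ ∀ x ∈ t, ∀ y, ρ x y = 1 → (f y).re + (R + 1) ≤ (g y).re := by
    intro t
    induction t using Finset.induction_on with
    | empty => exact ⟨f, hf, hr, rfl, fun y => le_rfl, by simp⟩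
    | insert x t hx ih =>
      obtain ⟨g, hg, hgr, hcard, hle, hge⟩ := ih
      have hae := hgr.ae_sub_mul hg (hρ x) (hρ0 x)
      have hopen : IsOpen {c : ℂ | c.re < -(|R| + 1)} :=
        isOpen_lt Complex.continuous_re continuous_const
      obtain ⟨c, hc, hcr⟩ := (MeasureTheory.Measure.dense_of_ae hae).inter_open_nonempty _ hopen
        ⟨((-(|R| + 2) : ℝ) : ℂ), by simp only [mem_ofPred_eq, Complex.ofReal_re]; linarith⟩
      have hc : c.re < -(|R| + 1) := hc
      have hre : ∀ y, (g y - ρ x y * c).re = (g y).re - ρ x y * c.re := fun y => by simp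
      have hmul : ∀ y, 0 ≤ -(ρ x y * c.re) := fun y => by
        have := hρ0 x y
        have h3 : c.re ≤ 0 := by linarith [abs_nonneg R]
        nlinarith
      refine ⟨fun y => g y - ρ x y * c, contMDiff_sub_mul hg (hρ x) c, hcr,
        hcard.trans (hpar x g c hg hgr hcr), fun y => ?_, fun x' hx' y hy => ?_⟩
      · rw [hre]
        linarith [hle y, hmul y]
      · rw [hre]
        rcases Finset.mem_insert.1 hx' with rfl | hx'
        · rw [hy]
          linarith [hle y, le_abs_self R]
        · linarith [hge x' hx' y hy, hmul y]
  obtain ⟨g, -, -, hcard, -, hge⟩ := key t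
  rw [hcard]
  have : {z | g z = 0} = ∅ := by
    refine eq_empty_of_forall_notMem fun z hz => ?_
    obtain ⟨x, hx, hxz⟩ := mem_iUnion₂.1 (ht (mem_univ z))
    have h1 := hge x hx z hxz
    have h2 := hR z (mem_univ z)
    have h3 := (Complex.abs_re_le_norm (f z)).trans h2
    have hz : g z = 0 := hz
    rw [hz, Complex.zero_re] at h1
    linarith [neg_abs_le (f z).re]
  simp [this]

/-- A nonvanishing function on the complement of the interiors of disjoint disks in a closed surface
has even total degree along the boundaries of the disks. -/
theorem sum_deg_disks_modTwo {n : ℕ} {D : Fin n → ℂ → F}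
    (hD : ∀ k, ContinuousOn (D k) (closedBall 0 1)) (hDi : ∀ k, InjOn (D k) (closedBall 0 1))
    (hDdisj : ∀ j k, j ≠ k → Disjoint (D j '' closedBall 0 1) (D k '' closedBall 0 1))
    {A : Set F} (hA : IsClosed A) (hAD : ∀ k, D k '' sphere 0 1 ⊆ A)
    (hcover : A ∪ ⋃ k, D k '' closedBall 0 1 = univ) {U : F → ℂ} (hU : ContinuousOn U A)
    (hU0 : ∀ x ∈ A, U x ≠ 0) {m : Fin n → ℤ}
    (hm : ∀ k, HasDeg (fun s => U (D k (circ s))) (m k)) : (∑ k, (m k : ZMod 2)) = 0 := by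
  classical
  -- extend `U` to the surface, and approximate the extension by a function with regular zeros
  obtain ⟨V, hV⟩ := ContinuousMap.exists_restrict_eq (Y := ℂ) hA ⟨A.domRestrict U, hU.domRestrict⟩
  have hVU : ∀ x ∈ A, V x = U x := fun x hx =>
    congrFun (congrArg DFunLike.coe hV) ⟨x, hx⟩
  obtain ⟨δ, hδ, hδU⟩ : ∃ δ > 0, ∀ x ∈ A, δ ≤ ‖U x‖ := by
    rcases A.eq_empty_or_nonempty with rfl | hne
    · exact ⟨1, one_pos, by simp⟩
    · obtain ⟨x, hx, hmin⟩ := hA.isCompact.exists_isMinOn hne hU.norm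
      exact ⟨‖U x‖, norm_pos_iff.2 (hU0 x hx), fun y hy => hmin hy⟩
  obtain ⟨f, hfV, -⟩ := V.continuous.exists_contMDiff_approx (𝓡 2) (⊤ : ℕ∞)
    (ε := fun _ => δ / 2) continuous_const (fun _ => by positivity)
  have hf : ContMDiff (𝓡 2) 𝓘(ℝ, ℂ) ∞ f := f.contMDiff
  have hae := ae_injective_mfderiv_sub hf (ρ := fun _ : F => (1 : ℝ)) contMDiff_const
  obtain ⟨c, hc, hcr⟩ := (MeasureTheory.Measure.dense_of_ae hae).inter_open_nonempty
    (ball 0 (δ / 2)) isOpen_ball ⟨0, by simpa using hδ⟩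
  set g : F → ℂ := fun y => f y - ((1 : ℝ) : ℂ) * c with hg
  have hgs : ContMDiff (𝓡 2) 𝓘(ℝ, ℂ) ∞ g := contMDiff_sub_mul hf (ρ := fun _ : F => (1 : ℝ))
    contMDiff_const c
  have hgr : HasRegularZeros g := fun z hz => hcr z one_pos hz
  have hgU : ∀ x ∈ A, ‖g x - U x‖ < ‖U x‖ := by
    intro x hx
    have h1 := hfV x
    rw [hVU x hx, dist_eq_norm] at h1
    have h2 : ‖c‖ < δ / 2 := by simpa using hc
    calc ‖g x - U x‖ = ‖(f x - U x) - c‖ := by simp only [hg]; congr 1; push_cast; ring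
      _ ≤ ‖f x - U x‖ + ‖c‖ := norm_sub_le _ _
      _ < δ := by linarith
      _ ≤ _ := hδU x hx
  have hgA : ∀ x ∈ A, g x ≠ 0 := fun x hx h => by
    have := hgU x hx
    simp [h] at this
  have hcs : ∀ s, circ s ∈ sphere (0 : ℂ) 1 := fun s => by simp [norm_circ]
  have hDc : ∀ k, Continuous fun s => D k (circ s) := fun k =>
    (hD k).comp_continuous continuous_circ fun s => sphere_subset_closedBall (hcs s)
  have hDA : ∀ k s, D k (circ s) ∈ A := fun k s => hAD k (mem_image_of_mem _ (hcs s))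
  have hgm : ∀ k, HasDeg (fun s => g (D k (circ s))) (m k) := fun k =>
    (hm k).near (hgs.continuous.comp (hDc k)) (fun s => by simp [circ_periodic s])
      (hU.comp_continuous (hDc k) (hDA k)) (fun s => by simp [circ_periodic s])
      fun s => hgU _ (hDA k s)
  have hcard : ∀ k, (m k : ZMod 2) = ({z | g z = 0} ∩ D k '' closedBall 0 1).ncard := fun k =>
    deg_modTwo_eq_ncard_zeros hgs hgr (hD k) (hDi k)
      (fun w hw => hgA _ (hAD k (mem_image_of_mem _ hw))) (hgm k)
  have hfin := hgr.finite hgs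
  have hunion : {z | g z = 0} = ⋃ k, {z | g z = 0} ∩ D k '' closedBall 0 1 := by
    rw [← inter_iUnion, eq_comm, inter_eq_left]
    intro z hz
    rcases hcover.ge (mem_univ z) with h | h
    · exact absurd hz (hgA z h)
    · exact h
  have hsum : {z | g z = 0}.ncard = ∑ k, ({z | g z = 0} ∩ D k '' closedBall 0 1).ncard := by
    have h1 := ncard_iUnion_of_finite (s := fun k => {z | g z = 0} ∩ D k '' closedBall 0 1)
      (fun k => hfin.subset inter_subset_left)
      (fun j k hjk => (hDdisj j k hjk).mono inter_subset_right inter_subset_right)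
    rw [← hunion] at h1
    rw [h1, finsum_eq_sum_of_fintype]
  have := even_ncard_zeros hgs hgr
  rw [hsum] at this
  push_cast at this
  rw [← this]
  exact Finset.sum_congr rfl fun k _ => hcard k

end Parity

/-! ### The Dirac potential -/

theorem det4_eq (a b c d : E4) : det4 a b c d =
    a 0 * (b 1 * (c 2 * d 3 - c 3 * d 2) - b 2 * (c 1 * d 3 - c 3 * d 1)
      + b 3 * (c 1 * d 2 - c 2 * d 1))
    - a 1 * (b 0 * (c 2 * d 3 - c 3 * d 2) - b 2 * (c 0 * d 3 - c 3 * d 0)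
      + b 3 * (c 0 * d 2 - c 2 * d 0))
    + a 2 * (b 0 * (c 1 * d 3 - c 3 * d 1) - b 1 * (c 0 * d 3 - c 3 * d 0)
      + b 3 * (c 0 * d 1 - c 1 * d 0))
    - a 3 * (b 0 * (c 1 * d 2 - c 2 * d 1) - b 1 * (c 0 * d 2 - c 2 * d 0)
      + b 2 * (c 0 * d 1 - c 1 * d 0)) := by
  simp [det4, Matrix.det_succ_row_zero, Fin.sum_univ_succ, Fin.succAbove]
  ring

theorem inner_E4 (a b : E4) :
    inner ℝ a b = a 0 * b 0 + a 1 * b 1 + a 2 * b 2 + a 3 * b 3 := by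
  simp [PiLp.inner_apply, Fin.sum_univ_four, mul_comm]

/-- Cramer's rule for vectors of the hyperplane `p^⊥`. -/
theorem det4_cramer {p z : E4} (hz : inner ℝ p z = 0) (v w r d : E4) :
    det4 (-p) v w r * inner ℝ d z - det4 (-p) v w d * inner ℝ r z
      + det4 (-p) v r d * inner ℝ w z - det4 (-p) w r d * inner ℝ v z = 0 := by
  have h : det4 v w r d * inner ℝ p z = 0 := by rw [hz, mul_zero]
  simp only [inner_E4, det4_eq, PiLp.neg_apply] at h ⊢
  linear_combination h

theorem det4_swap (p a b c : E4) : det4 p a c b = -det4 p a b c := by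
  simp only [det4_eq]; ring

/-- Gram's determinant for vectors of the hyperplane `p^⊥`. -/
theorem det4_sq {p v w r : E4} (hp : ‖p‖ = 1) (hv : inner ℝ p v = 0) (hw : inner ℝ p w = 0)
    (hr : inner ℝ p r = 0) : det4 (-p) v w r ^ 2 =
      inner ℝ v v * (inner ℝ w w * inner ℝ r r - inner ℝ w r ^ 2)
      - inner ℝ v w * (inner ℝ v w * inner ℝ r r - inner ℝ w r * inner ℝ v r)
      + inner ℝ v r * (inner ℝ v w * inner ℝ w r - inner ℝ w w * inner ℝ v r) := by
  have hpp : inner ℝ p p = (1 : ℝ) := by rw [real_inner_self_eq_norm_sq, hp, one_pow]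
  set A : Matrix (Fin 4) (Fin 4) ℝ := Matrix.of ![fun k => (-p) k, fun k => v k, fun k => w k,
    fun k => r k] with hA
  have h1 : det4 (-p) v w r ^ 2 = (A * A.transpose).det := by
    rw [Matrix.det_mul, Matrix.det_transpose, sq, hA, det4]
  have h2 : A * A.transpose = Matrix.of ![![1, 0, 0, 0],
      ![0, inner ℝ v v, inner ℝ v w, inner ℝ v r], ![0, inner ℝ v w, inner ℝ w w, inner ℝ w r],
      ![0, inner ℝ v r, inner ℝ w r, inner ℝ r r]] := by
    simp only [inner_E4] at hpp hv hw hr ⊢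
    ext i j
    fin_cases i <;> fin_cases j <;>
      simp [hA, Matrix.mul_apply, Fin.sum_univ_four] <;> linarith
  rw [h1, h2]
  simp [Matrix.det_succ_row_zero, Fin.sum_univ_succ, Fin.succAbove]
  ring

/-- The vector potential of the magnetic monopole with a Dirac string in the direction `-v`, at the
point `r` and in the direction `w`. Its curl is `r / |r|³`. -/
noncomputable def dirac (p v w r : E4) : ℝ :=
  det4 (-p) v r w / (‖r‖ * (‖r‖ + inner ℝ v r))

/-- The derivative of the Dirac potential in the direction `r'`. -/
noncomputable def dirac' (p v w r r' : E4) : ℝ :=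
  (det4 (-p) v r' w * (‖r‖ * (‖r‖ + inner ℝ v r)) - det4 (-p) v r w *
    (inner ℝ r r' / ‖r‖ * (‖r‖ + inner ℝ v r) + ‖r‖ * (inner ℝ r r' / ‖r‖ + inner ℝ v r')))
    / (‖r‖ * (‖r‖ + inner ℝ v r)) ^ 2

/-- `det4 p v · w` as a linear map. -/
noncomputable def det4Lin (p v w : E4) : E4 →L[ℝ] ℝ :=
  LinearMap.toContinuousLinearMap
    { toFun := fun r => det4 p v r w
      map_add' := fun a b => by simp only [det4_eq, PiLp.add_apply]; ring
      map_smul' := fun a b => by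
        simp only [det4_eq, PiLp.smul_apply, smul_eq_mul, RingHom.id_apply]; ring }

theorem hasDerivAt_norm_E4 {r : ℝ → E4} {r' : E4} {t : ℝ} (h : HasDerivAt r r' t) (h0 : r t ≠ 0) :
    HasDerivAt (fun t => ‖r t‖) (inner ℝ (r t) r' / ‖r t‖) t := by
  have h1 := (h.norm_sq).sqrt (by simpa using h0)
  have h2 : (fun t => ‖r t‖) = fun t => Real.sqrt (‖r t‖ ^ 2) := by
    funext t; rw [Real.sqrt_sq (norm_nonneg _)]
  rw [h2]
  convert h1 using 1
  rw [Real.sqrt_sq (norm_nonneg _), mul_div_mul_left _ _ two_ne_zero]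

theorem hasDerivAt_dirac {p v w : E4} {r : ℝ → E4} {r' : E4} {t : ℝ} (h : HasDerivAt r r' t)
    (h0 : r t ≠ 0) (hv : 0 < ‖r t‖ + inner ℝ v (r t)) :
    HasDerivAt (fun t => dirac p v w (r t)) (dirac' p v w (r t) r') t := by
  have h1 : HasDerivAt (fun t => det4 (-p) v (r t) w) (det4 (-p) v r' w) t :=
    (det4Lin (-p) v w).hasFDerivAt.comp_hasDerivAt t h
  have h2 := hasDerivAt_norm_E4 h h0
  have h3 : HasDerivAt (fun t => (inner ℝ v (r t) : ℝ)) (inner ℝ v r') t :=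
    (innerSL ℝ v).hasFDerivAt.comp_hasDerivAt t h
  exact h1.div (h2.mul (h2.add h3)) (mul_pos (norm_pos_iff.2 h0) hv).ne'

/-- The curl of the Dirac potential. -/
theorem dirac'_sub_dirac' {p v r a b : E4} (hv : ‖v‖ = 1) (hpv : inner ℝ p v = 0)
    (hpr : inner ℝ p r = 0) (h0 : r ≠ 0) (hvr : 0 < ‖r‖ + inner ℝ v r) :
    dirac' p v b r a - dirac' p v a r b = det4 (-p) r a b / ‖r‖ ^ 3 := by
  have hN : 0 < ‖r‖ := norm_pos_iff.2 h0
  have e1 := det4_cramer hpr v r a b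
  have e2 := det4_cramer hpv v r a b
  have s1 : det4 (-p) v b a = -det4 (-p) v a b := det4_swap _ _ _ _
  rw [real_inner_self_eq_norm_sq] at e1
  rw [real_inner_self_eq_norm_sq v, hv, real_inner_comm v r] at e2
  rw [real_inner_comm r b, real_inner_comm r a] at e1
  rw [real_inner_comm v b, real_inner_comm v a] at e2
  rw [dirac', dirac', s1, ← sub_div]
  generalize ‖r‖ = N at *
  generalize (inner ℝ v r : ℝ) = x at *
  have key : det4 (-p) v a b * (N * (N + x)) - det4 (-p) v r b *
      (inner ℝ r a / N * (N + x) + N * (inner ℝ r a / N + inner ℝ v a))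
      - (-det4 (-p) v a b * (N * (N + x)) - det4 (-p) v r a *
      (inner ℝ r b / N * (N + x) + N * (inner ℝ r b / N + inner ℝ v b)))
      = det4 (-p) r a b * (N + x) ^ 2 / N := by
    field_simp
    linear_combination (2 * N + x) * e1 + N ^ 2 * e2
  rw [key]
  field_simp

/-- Two Dirac potentials differ by a gauge transformation: their difference is twice the logarithmic
derivative of the argument of the function
`(1 + ⟨v, w⟩) |r| + ⟨v + w, r⟩ + i det (-p, v, w, r)`. -/
theorem dirac_sub_dirac {p v w r d : E4} (hp : ‖p‖ = 1) (hv : ‖v‖ = 1) (hw : ‖w‖ = 1)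
    (hpv : inner ℝ p v = 0) (hpw : inner ℝ p w = 0) (hpr : inner ℝ p r = 0) (h0 : r ≠ 0)
    (hvr : 0 < ‖r‖ + inner ℝ v r) (hwr : 0 < ‖r‖ + inner ℝ w r) (hvw : 0 < 1 + (inner ℝ v w : ℝ)) :
    0 < ((1 + inner ℝ v w) * ‖r‖ + inner ℝ (v + w) r) ^ 2 + det4 (-p) v w r ^ 2 ∧
    dirac p v d r - dirac p w d r =
      2 * (((1 + inner ℝ v w) * ‖r‖ + inner ℝ (v + w) r) * det4 (-p) v w d
        - det4 (-p) v w r * ((1 + inner ℝ v w) * (inner ℝ r d / ‖r‖) + inner ℝ (v + w) d))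
      / (((1 + inner ℝ v w) * ‖r‖ + inner ℝ (v + w) r) ^ 2 + det4 (-p) v w r ^ 2) := by
  have hN : 0 < ‖r‖ := norm_pos_iff.2 h0
  have hs := det4_sq hp hpv hpw hpr
  have e1 := det4_cramer hpr v w r d
  have e2 := det4_cramer hpv v w r d
  have e3 := det4_cramer hpw v w r d
  simp only [real_inner_self_eq_norm_sq, hv, hw] at hs e1 e2 e3
  rw [real_inner_comm v r, real_inner_comm v w] at e2
  rw [real_inner_comm w r] at e3
  rw [real_inner_comm r d] at e1
  rw [real_inner_comm v d] at e2
  rw [real_inner_comm w d] at e3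
  rw [dirac, dirac, inner_add_left, inner_add_left]
  generalize ‖r‖ = N at *
  generalize (inner ℝ v r : ℝ) = x at *
  generalize (inner ℝ w r : ℝ) = y at *
  generalize (inner ℝ v w : ℝ) = c at *
  have hsum : ((1 + c) * N + (x + y)) ^ 2 + det4 (-p) v w r ^ 2
      = 2 * (1 + c) * (N + x) * (N + y) := by
    rw [hs]
    ring
  rw [hsum]
  refine ⟨by positivity, ?_⟩
  rw [div_sub_div _ _ (by positivity) (by positivity),
    div_eq_div_iff (by positivity) (by positivity)]
  have key : (1 + c) * (det4 (-p) v r d * (N + y) - det4 (-p) w r d * (N + x))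
      = N * (((1 + c) * N + (x + y)) * det4 (-p) v w d
        - det4 (-p) v w r * ((1 + c) * (inner ℝ r d / N) + (inner ℝ v d + inner ℝ w d))) := by
    field_simp
    linear_combination (1 + c) * e1 + N * e2 + N * e3
  linear_combination (2 * N * (N + x) * (N + y)) * key

/-! ### The solid angle of a closed curve -/

theorem continuousOn_intervalIntegral {X : Type*} [TopologicalSpace X] [FirstCountableTopology X]
    {V : Set X} {f : X → ℝ → ℝ}
    (hf : ContinuousOn (fun q : X × ℝ => f q.1 q.2) (V ×ˢ Icc 0 1)) :
    ContinuousOn (fun x => ∫ t in (0 : ℝ)..1, f x t) V := by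
  rw [continuousOn_iff_continuous_domRestrict]
  have h1 : Continuous (Function.uncurry fun (x : V) (t : ℝ) =>
      f x (projIcc (0 : ℝ) 1 zero_le_one t)) :=
    hf.comp_continuous (f := fun q : V × ℝ => ((q.1 : X), (projIcc (0 : ℝ) 1 zero_le_one q.2 : ℝ)))
      (by fun_prop) fun q => ⟨q.1.2, (projIcc (0 : ℝ) 1 zero_le_one q.2).2⟩
  have h2 := intervalIntegral.continuous_parametric_intervalIntegral_of_continuous'
    (μ := MeasureTheory.volume) h1 0 1
  refine h2.congr fun x => intervalIntegral.integral_congr fun t ht => ?_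
  rw [uIcc_of_le zero_le_one] at ht
  simp only [projIcc_of_mem _ ht]

/-- Differentiation under the integral sign. -/
theorem hasDerivAt_intervalIntegral {V : Set (ℝ × ℝ)} (hV : IsOpen V) {f f' : ℝ → ℝ → ℝ}
    (hf : ContinuousOn (fun q : ℝ × ℝ => f q.1 q.2) V)
    (hf' : ContinuousOn (fun q : ℝ × ℝ => f' q.1 q.2) V)
    (hd : ∀ q ∈ V, HasDerivAt (fun s => f s q.2) (f' q.1 q.2) q.1) {s₀ : ℝ}
    (hs : ∀ t ∈ Icc (0 : ℝ) 1, (s₀, t) ∈ V) :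
    HasDerivAt (fun s => ∫ t in (0 : ℝ)..1, f s t) (∫ t in (0 : ℝ)..1, f' s₀ t) s₀ := by
  obtain ⟨u, w, hu, -, hsu, hw, huw⟩ := generalized_tube_lemma (isCompact_singleton (x := s₀))
    (isCompact_Icc (a := (0 : ℝ)) (b := 1)) hV (by rintro ⟨s, t⟩ ⟨rfl, ht⟩; exact hs t ht)
  obtain ⟨δ, hδ, hδu⟩ := Metric.isOpen_iff.1 hu s₀ (hsu rfl)
  set B := closedBall s₀ (δ / 2) with hB
  have hBu : B ⊆ u := (closedBall_subset_ball (by linarith)).trans hδu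
  have hBV : B ×ˢ Icc (0 : ℝ) 1 ⊆ V := (prod_mono hBu hw).trans huw
  obtain ⟨C, hC⟩ := ((isCompact_closedBall s₀ (δ / 2)).prod
    (isCompact_Icc (a := (0 : ℝ)) (b := 1))).exists_bound_of_continuousOn (hf'.mono hBV)
  have hcont : ∀ g : ℝ → ℝ → ℝ, ContinuousOn (fun q : ℝ × ℝ => g q.1 q.2) V → ∀ s ∈ B,
      ContinuousOn (g s) (Icc 0 1) := fun g hg s hs =>
    hg.comp (f := fun t => (s, t)) (by fun_prop) fun t ht => hBV ⟨hs, ht⟩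
  have hs₀ : s₀ ∈ B := mem_closedBall_self (by linarith)
  have huI : uIoc (0 : ℝ) 1 ⊆ Icc 0 1 := by
    rw [uIoc_of_le zero_le_one]; exact Ioc_subset_Icc_self
  have hBn : B ∈ 𝓝 s₀ := closedBall_mem_nhds _ (by linarith)
  refine (intervalIntegral.hasDerivAt_integral_of_dominated_loc_of_deriv_le
    (F := f) (F' := f') (bound := fun _ => C) hBn ?_ ?_ ?_ ?_ ?_ ?_).2
  · filter_upwards [hBn] with s hs
    exact ((hcont f hf s hs).mono huI).aestronglyMeasurable measurableSet_uIoc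
  · exact ContinuousOn.intervalIntegrable (by
      rw [uIcc_of_le zero_le_one]; exact hcont f hf s₀ hs₀)
  · exact ((hcont f' hf' s₀ hs₀).mono huI).aestronglyMeasurable measurableSet_uIoc
  · exact Eventually.of_forall fun t ht s hs => hC (s, t) ⟨hs, huI ht⟩
  · exact intervalIntegrable_const
  · exact Eventually.of_forall fun t ht s hs => hd (s, t) (hBV ⟨hs, huI ht⟩)

/-- A nonvanishing closed curve in the plane winds an integral number of times around `0`. -/
theorem exists_int_integral_im_div {f f' : ℝ → ℂ} (hf : ∀ t, HasDerivAt f (f' t) t)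
    (hf' : Continuous f') (h0 : ∀ t, f t ≠ 0) (hp : f 1 = f 0) :
    ∃ k : ℤ, ∫ t in (0 : ℝ)..1, (f' t / f t).im = 2 * Real.pi * k := by
  have hfc : Continuous f := continuous_iff_continuousAt.2 fun t => (hf t).continuousAt
  have hq : Continuous fun t => f' t / f t := hf'.div hfc h0
  set L : ℝ → ℂ := fun t => ∫ u in (0 : ℝ)..t, f' u / f u with hL
  have hLd : ∀ t, HasDerivAt L (f' t / f t) t := fun t =>
    intervalIntegral.integral_hasDerivAt_right (hq.intervalIntegrable _ _)
      hq.stronglyMeasurable.stronglyMeasurableAtFilter hq.continuousAt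
  have hg : ∀ t, HasDerivAt (fun t => f t * Complex.exp (-L t)) 0 t := fun t => by
    have h1 := h0 t
    have e : f' t * Complex.exp (-L t) + f t * (Complex.exp (-L t) * -(f' t / f t)) = 0 := by
      field_simp
      ring
    exact ((hf t).mul ((hLd t).neg.cexp)).congr_deriv e
  have hconst := is_const_of_deriv_eq_zero (fun t => (hg t).differentiableAt)
    (fun t => (hg t).deriv) 1 0
  have hL0 : L 0 = 0 := intervalIntegral.integral_same
  simp only [hp, hL0, neg_zero, Complex.exp_zero] at hconst
  have h1 : Complex.exp (-L 1) = 1 := mul_left_cancel₀ (h0 0) hconst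
  obtain ⟨k, hk⟩ := Complex.exp_eq_one_iff.1 h1
  refine ⟨-k, ?_⟩
  have h2 : ∫ t in (0 : ℝ)..1, (f' t / f t).im = (L 1).im :=
    Complex.imCLM.intervalIntegral_comp_comm (hq.intervalIntegrable _ _)
  have h3 : L 1 = -(k * (2 * Real.pi * Complex.I)) := by rw [← hk, neg_neg]
  rw [h2, h3]
  simp
  ring

theorem ContinuousOn.det4 {X : Type*} [TopologicalSpace X] {V : Set X} {a b c d : X → E4}
    (ha : ContinuousOn a V) (hb : ContinuousOn b V) (hc : ContinuousOn c V)
    (hd : ContinuousOn d V) :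
    ContinuousOn (fun x => _root_.det4 (a x) (b x) (c x) (d x)) V := by
  rw [continuousOn_iff_continuous_domRestrict] at *
  refine Continuous.matrix_det (continuous_matrix fun i j => ?_)
  have hj : Continuous fun z : E4 => z j := by fun_prop
  fin_cases i
  exacts [hj.comp ha, hj.comp hb, hj.comp hc, hj.comp hd]

@[fun_prop]
theorem Continuous.det4 {X : Type*} [TopologicalSpace X] {a b c d : X → E4} (ha : Continuous a)
    (hb : Continuous b) (hc : Continuous c) (hd : Continuous d) :
    Continuous fun x => _root_.det4 (a x) (b x) (c x) (d x) :=
  continuousOn_univ.1 (ha.continuousOn.det4 hb.continuousOn hc.continuousOn hd.continuousOn)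

/-- Closed curves of class `C¹` and period `1`. -/
structure IsC1Loop (y : ℝ → E4) : Prop where
  contDiff : ContDiff ℝ 1 y
  periodic : Function.Periodic y 1

namespace IsC1Loop

variable {y : ℝ → E4}

theorem continuous (hy : IsC1Loop y) : Continuous y := hy.contDiff.continuous

theorem continuous_deriv (hy : IsC1Loop y) : Continuous (deriv y) :=
  hy.contDiff.continuous_deriv le_rfl

theorem hasDerivAt (hy : IsC1Loop y) (t : ℝ) : HasDerivAt y (deriv y t) t :=
  ((hy.contDiff.differentiable (by simp)) t).hasDerivAt

end IsC1Loop

/-- The flux of the Dirac potential along the curve `y`, seen from `ξ`: the solid angle of a surface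
bounded by `y`. -/
noncomputable def dphase (p : E4) (y : ℝ → E4) (v ξ : E4) : ℝ :=
  ∫ t in (0 : ℝ)..1, dirac p v (deriv y t) (ξ - y t)

/-- The vector `v` is a unit vector of `p^⊥`, and the ray from the point `ξ` in the direction `v`
does not meet the curve `y`: the Dirac strings which start at the points of the curve in the
direction `-v` miss `ξ`. -/
structure IsStringFree (p : E4) (y : ℝ → E4) (v ξ : E4) : Prop where
  norm_eq : ‖v‖ = 1
  inner_eq : inner ℝ p v = 0
  pos : ∀ t, 0 < ‖ξ - y t‖ + inner ℝ v (ξ - y t)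

section Potential

variable {p : E4} {y : ℝ → E4}

theorem ne_zero_of_norm_add_inner_pos {v r : E4} (h : 0 < ‖r‖ + inner ℝ v r) : r ≠ 0 := by
  rintro rfl
  simp at h

theorem norm_add_inner_pos {v r : E4} (hv : ‖v‖ = 1) (h : r ≠ -(‖r‖ • v)) :
    0 < ‖r‖ + inner ℝ v r := by
  have h1 : ‖‖r‖ • v + r‖ ^ 2 = 2 * ‖r‖ * (‖r‖ + inner ℝ v r) := by
    rw [norm_add_sq_real, norm_smul, hv, inner_smul_left]
    simp
    ring
  have h2 : 0 < ‖‖r‖ • v + r‖ := norm_pos_iff.2 fun h0 => h (eq_neg_of_add_eq_zero_right h0)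
  have h3 := norm_nonneg r
  by_contra h4
  nlinarith [sq_pos_of_pos h2]

/-- Strings in generic directions do not meet a given curve, for dimension reasons. -/
theorem exists_isStringFree (hp : ‖p‖ = 1) (hy : IsC1Loop y) (ξ v₀ : E4) (hξ : ∀ t, ξ ≠ y t) :
    ∃ v, IsStringFree p y v ξ ∧ v ≠ v₀ ∧ v ≠ -v₀ := by
  classical
  set g : ℝ × ℝ × ℝ → E4 := fun q => q.1 • (ξ - y q.2.2) + q.2.1 • p with hg
  have hgc : ContDiff ℝ 1 g := by
    have := hy.contDiff
    fun_prop
  have hdense := hgc.dense_compl_range_of_finrank_lt_finrank (by simp)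
  set W : Submodule ℝ E4 := Submodule.span ℝ (({p, v₀} : Finset E4) : Set E4) with hW
  have hWne : ((W : Set E4)ᶜ).Nonempty := by
    rw [nonempty_compl]
    intro h
    have h1 : W = ⊤ := by ext; simp [← SetLike.mem_coe, h]
    have h2 : Module.finrank ℝ W ≤ 2 := (finrank_span_finset_le_card _).trans
      Finset.card_le_two
    rw [h1, finrank_top] at h2
    simp at h2
  obtain ⟨u, huW, hug⟩ := hdense.inter_open_nonempty _
    (Submodule.closed_of_finiteDimensional W).isOpen_compl hWne
  have hpp : inner ℝ p p = (1 : ℝ) := by rw [real_inner_self_eq_norm_sq, hp, one_pow]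
  set u' := u - (inner ℝ p u : ℝ) • p with hu'
  have hu0 : u' ≠ 0 := fun h => huW (by
    rw [sub_eq_zero.1 h]
    exact W.smul_mem _ (Submodule.subset_span (by simp)))
  have hn := norm_pos_iff.2 hu0
  set v := ‖u'‖⁻¹ • u' with hv
  have huv : u = ‖u'‖ • v + (inner ℝ p u : ℝ) • p := by
    rw [hv, smul_inv_smul₀ hn.ne', hu', sub_add_cancel]
  have hvn : ‖v‖ = 1 := by rw [hv, norm_smul, norm_inv, norm_norm, inv_mul_cancel₀ hn.ne']
  refine ⟨v, ⟨hvn, ?_, fun t => norm_add_inner_pos hvn fun h => hug ?_⟩, ?_, ?_⟩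
  · rw [hv, hu', inner_smul_right, inner_sub_right, inner_smul_right, hpp]
    ring
  · have hr : 0 < ‖ξ - y t‖ := norm_pos_iff.2 (sub_ne_zero.2 (hξ t))
    refine ⟨(-(‖u'‖ / ‖ξ - y t‖), inner ℝ p u, t), ?_⟩
    simp only [hg]
    rw [h, smul_neg, smul_smul, norm_neg, norm_smul, norm_norm, hvn, mul_one]
    conv_rhs => rw [huv]
    congr 1
    rw [neg_mul, neg_smul, neg_neg, div_mul_cancel₀ _ hr.ne']
  · rintro rfl
    refine huW ?_
    rw [huv]
    exact W.add_mem (W.smul_mem _ (Submodule.subset_span (by simp)))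
      (W.smul_mem _ (Submodule.subset_span (by simp)))
  · intro h
    refine huW ?_
    rw [huv, h]
    exact W.add_mem (W.smul_mem _ (W.neg_mem (Submodule.subset_span (by simp))))
      (W.smul_mem _ (Submodule.subset_span (by simp)))

theorem continuousOn_dirac {X : Type*} [TopologicalSpace X] {V : Set X} {v : E4} {w r : X → E4}
    (hw : ContinuousOn w V) (hr : ContinuousOn r V) (h : ∀ x ∈ V, 0 < ‖r x‖ + inner ℝ v (r x)) :
    ContinuousOn (fun x => dirac p v (w x) (r x)) V :=
  (continuousOn_const.det4 continuousOn_const hr hw).div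
    (hr.norm.mul (hr.norm.add (continuousOn_const.inner hr)))
    fun x hx => (mul_pos (norm_pos_iff.2 (ne_zero_of_norm_add_inner_pos (h x hx))) (h x hx)).ne'

theorem continuousOn_dirac' {X : Type*} [TopologicalSpace X] {V : Set X} {v : E4}
    {w r r' : X → E4} (hw : ContinuousOn w V) (hr : ContinuousOn r V) (hr' : ContinuousOn r' V)
    (h : ∀ x ∈ V, 0 < ‖r x‖ + inner ℝ v (r x)) :
    ContinuousOn (fun x => dirac' p v (w x) (r x) (r' x)) V := by
  have h0 : ∀ x ∈ V, ‖r x‖ ≠ 0 := fun x hx =>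
    (norm_pos_iff.2 (ne_zero_of_norm_add_inner_pos (h x hx))).ne'
  have h1 := (hr.inner hr').div hr.norm h0
  have h2 := hr.norm.add ((continuousOn_const (c := v)).inner hr)
  refine ContinuousOn.div (((continuousOn_const.det4 continuousOn_const hr' hw).mul
    (hr.norm.mul h2)).sub ((continuousOn_const.det4 continuousOn_const hr hw).mul
    ((h1.mul h2).add (hr.norm.mul (h1.add (continuousOn_const.inner hr'))))))
    ((hr.norm.mul h2).pow 2) fun x hx => ?_
  have := norm_nonneg (r x)
  exact pow_ne_zero 2 (mul_ne_zero (h0 x hx) (h x hx).ne')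

/-- The phases defined by two strings which are not opposite to each other agree up to a full turn:
their difference is twice the winding number of the curve in the plane given by
`dirac_sub_dirac`. -/
theorem dphase_sub_aux (hp : ‖p‖ = 1) (hy : IsC1Loop y) (hpy : ∀ t, inner ℝ p (y t) = 0) {ξ : E4}
    (hξ : inner ℝ p ξ = 0) {v w : E4} (hv : IsStringFree p y v ξ) (hw : IsStringFree p y w ξ)
    (hvw : v ≠ -w) : ∃ k : ℤ, dphase p y v ξ - dphase p y w ξ = 4 * Real.pi * k := by
  have hc : 0 < 1 + (inner ℝ v w : ℝ) := by
    have h1 := norm_add_sq_real v w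
    rw [hv.norm_eq, hw.norm_eq] at h1
    have h2 : 0 < ‖v + w‖ := norm_pos_iff.2 fun h => hvw (eq_neg_of_add_eq_zero_left h)
    nlinarith [sq_pos_of_pos h2]
  set r : ℝ → E4 := fun t => ξ - y t with hr
  have hrp : ∀ t, inner ℝ p (r t) = 0 := fun t => by rw [hr, inner_sub_right, hξ, hpy, sub_zero]
  have hrd : ∀ t, HasDerivAt r (-deriv y t) t := fun t => (hy.hasDerivAt t).const_sub ξ
  have hrc : Continuous r := continuous_const.sub hy.continuous
  have hr0 : ∀ t, r t ≠ 0 := fun t => ne_zero_of_norm_add_inner_pos (hv.pos t)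
  have hyc := hy.continuous_deriv
  set R : ℝ → ℝ := fun t => (1 + inner ℝ v w) * ‖r t‖ + inner ℝ (v + w) (r t) with hR
  set τ : ℝ → ℝ := fun t => det4 (-p) v w (r t) with hτ
  set R' : ℝ → ℝ := fun t => (1 + inner ℝ v w) * (inner ℝ (r t) (-deriv y t) / ‖r t‖)
    + inner ℝ (v + w) (-deriv y t) with hR'
  set τ' : ℝ → ℝ := fun t => det4 (-p) v w (-deriv y t) with hτ'
  have hgauge := fun t => dirac_sub_dirac (d := -deriv y t) hp hv.norm_eq hw.norm_eq hv.inner_eq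
    hw.inner_eq (hrp t) (hr0 t) (hv.pos t) (hw.pos t) hc
  have hneg : ∀ a t, dirac p a (-deriv y t) (r t) = -dirac p a (deriv y t) (r t) := fun a t => by
    rw [dirac, dirac, ← neg_div]
    congr 1
    simp only [det4_eq, PiLp.neg_apply]
    ring
  have hRd : ∀ t, HasDerivAt R (R' t) t := fun t => by
    have h1 : HasDerivAt (fun t => (inner ℝ (v + w) (r t) : ℝ)) (inner ℝ (v + w) (-deriv y t)) t :=
      (innerSL ℝ (v + w)).hasFDerivAt.comp_hasDerivAt t (hrd t)
    exact ((hasDerivAt_norm_E4 (hrd t) (hr0 t)).const_mul _).add h1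
  have hτd : ∀ t, HasDerivAt τ (τ' t) t := fun t => by
    have h1 : HasDerivAt (fun t => det4 (-p) w (r t) v) (det4 (-p) w (-deriv y t) v) t :=
      (det4Lin (-p) w v).hasFDerivAt.comp_hasDerivAt t (hrd t)
    have h2 : ∀ z, det4 (-p) w z v = det4 (-p) v w z := fun z => by simp only [det4_eq]; ring
    simpa only [h2] using h1
  have hf : ∀ t, HasDerivAt (fun t => (R t : ℂ) + τ t * Complex.I) (R' t + τ' t * Complex.I) t :=
    fun t => (hRd t).ofReal_comp.add ((hτd t).ofReal_comp.mul_const _)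
  have hnsq : ∀ t, Complex.normSq ((R t : ℂ) + τ t * Complex.I) = R t ^ 2 + τ t ^ 2 := fun t =>
    Complex.normSq_add_mul_I _ _
  have hf' : Continuous fun t => (R' t : ℂ) + τ' t * Complex.I := by
    have h1 : Continuous R' := by
      have : ∀ t, ‖r t‖ ≠ 0 := fun t => norm_ne_zero_iff.2 (hr0 t)
      fun_prop (disch := assumption)
    have h2 : Continuous τ' := by fun_prop
    fun_prop
  obtain ⟨k, hk⟩ := exists_int_integral_im_div hf hf' (fun t h => by
    have h1 := (hgauge t).1
    have h2 := hnsq t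
    rw [h, map_zero] at h2
    exact h1.ne h2) (by
      have : r 1 = r 0 := by
        have := hy.periodic 0
        rw [zero_add] at this
        simp only [hr, this]
      simp only [hR, hτ, this])
  have him : ∀ t, dirac p v (deriv y t) (r t) - dirac p w (deriv y t) (r t) =
      -2 * ((R' t + τ' t * Complex.I) / ((R t : ℂ) + τ t * Complex.I)).im := fun t => by
    have h1 := (hgauge t).2
    rw [hneg, hneg] at h1
    rw [Complex.div_im, hnsq]
    simp only [Complex.add_re, Complex.add_im, Complex.ofReal_re, Complex.ofReal_im,
      Complex.mul_re, Complex.mul_im, Complex.I_re, Complex.I_im]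
    have h2 : dirac p v (deriv y t) (r t) - dirac p w (deriv y t) (r t)
      = -(2 * (R t * τ' t - τ t * R' t) / (R t ^ 2 + τ t ^ 2)) := by rw [← h1]; ring
    rw [h2]
    ring
  have hint : ∀ a, IsStringFree p y a ξ →
      IntervalIntegrable (fun t => dirac p a (deriv y t) (r t)) MeasureTheory.volume 0 1 :=
    fun a ha => (continuousOn_dirac (V := univ) hyc.continuousOn hrc.continuousOn
      fun t _ => ha.pos t).mono (subset_univ _) |>.intervalIntegrable
  refine ⟨-k, ?_⟩
  rw [dphase, dphase, ← intervalIntegral.integral_sub (hint v hv) (hint w hw)]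
  rw [intervalIntegral.integral_congr (g := fun t => -2 *
    ((R' t + τ' t * Complex.I) / ((R t : ℂ) + τ t * Complex.I)).im) fun t _ => him t,
    intervalIntegral.integral_const_mul, hk]
  push_cast
  ring

/-- The phases defined by two strings agree up to a full turn. -/
theorem dphase_sub (hp : ‖p‖ = 1) (hy : IsC1Loop y) (hpy : ∀ t, inner ℝ p (y t) = 0) {ξ : E4}
    (hξ : inner ℝ p ξ = 0) {v w : E4} (hv : IsStringFree p y v ξ) (hw : IsStringFree p y w ξ) :
    ∃ k : ℤ, dphase p y v ξ - dphase p y w ξ = 4 * Real.pi * k := by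
  by_cases hvw : v = -w
  · -- the gauge transformation is singular for opposite strings: use a third string
    obtain ⟨u, hu, hu1, hu2⟩ := exists_isStringFree hp hy ξ w
      (fun t h => ne_zero_of_norm_add_inner_pos (hv.pos t) (sub_eq_zero.2 h))
    obtain ⟨k, hk⟩ := dphase_sub_aux hp hy hpy hξ hv hu (by
      rw [hvw]
      exact fun h => hu1 (neg_injective h).symm)
    obtain ⟨l, hl⟩ := dphase_sub_aux hp hy hpy hξ hu hw hu2
    refine ⟨k + l, ?_⟩
    push_cast
    linear_combination hk + hl
  · exact dphase_sub_aux hp hy hpy hξ hv hw hvw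

end Potential

/-! ### The magnetic potential of a closed curve -/

open Classical in
/-- The circle-valued magnetic potential of the closed curve `y` in `p^⊥`: the exponential of
`i / 2` times the solid angle of the curve. The choice of a string is immaterial by `dphase_sub`;
the value `1` on the curve is arbitrary. -/
noncomputable def monopole (p : E4) (y : ℝ → E4) (ξ : E4) : ℂ :=
  if h : ∃ v, IsStringFree p y v ξ then
    Complex.exp (Complex.I / 2 * dphase p y h.choose ξ)
  else 1

/-- The integrand of the outer integral of the Gauss linking integral. -/
noncomputable def gaussInner (p : E4) (x y : ℝ → E4) (s : ℝ) : ℝ :=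
  ∫ t in (0 : ℝ)..1, det4 (-p) (x s - y t) (deriv x s) (deriv y t) / ‖x s - y t‖ ^ 3

section Monopole

variable {p : E4} {y : ℝ → E4}

theorem monopole_ne_zero (ξ : E4) : monopole p y ξ ≠ 0 := by
  rw [monopole]
  split_ifs
  · exact Complex.exp_ne_zero _
  · exact one_ne_zero

theorem monopole_eq (hp : ‖p‖ = 1) (hy : IsC1Loop y) (hpy : ∀ t, inner ℝ p (y t) = 0) {ξ : E4}
    (hξ : inner ℝ p ξ = 0) {v : E4} (hv : IsStringFree p y v ξ) :
    monopole p y ξ = Complex.exp (Complex.I / 2 * dphase p y v ξ) := by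
  have h : ∃ v, IsStringFree p y v ξ := ⟨v, hv⟩
  obtain ⟨k, hk⟩ := dphase_sub hp hy hpy hξ h.choose_spec hv
  rw [monopole, dif_pos h, Complex.exp_eq_exp_iff_exists_int]
  refine ⟨k, ?_⟩
  have : (dphase p y h.choose ξ : ℂ) = dphase p y v ξ + 4 * Real.pi * k := by
    exact_mod_cast (show dphase p y h.choose ξ = dphase p y v ξ + 4 * Real.pi * k by linarith)
  rw [this]
  ring

theorem IsStringFree.eventually (hy : IsC1Loop y) {v ξ : E4} (hv : IsStringFree p y v ξ) :
    ∀ᶠ ξ' in 𝓝 ξ, IsStringFree p y v ξ' := by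
  have hc : Continuous fun q : E4 × ℝ => ‖q.1 - y q.2‖ + inner ℝ v (q.1 - y q.2) := by
    have := hy.continuous
    fun_prop
  have hV : IsOpen {q : E4 × ℝ | 0 < ‖q.1 - y q.2‖ + inner ℝ v (q.1 - y q.2)} :=
    isOpen_lt continuous_const hc
  obtain ⟨u, w, hu, -, hξu, hw, huw⟩ := generalized_tube_lemma (isCompact_singleton (x := ξ))
    (isCompact_Icc (a := (0 : ℝ)) (b := 1)) hV (by
      rintro ⟨s, t⟩ ⟨hs, -⟩
      obtain rfl : s = ξ := hs
      exact hv.pos t)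
  filter_upwards [hu.mem_nhds (singleton_subset_iff.1 hξu)] with ξ' hξ'
  refine ⟨hv.norm_eq, hv.inner_eq, fun t => ?_⟩
  have h1 : y t = y (Int.fract t) := by
    have := hy.periodic.sub_int_mul_eq (x := t) ⌊t⌋
    rw [mul_one, Int.self_sub_floor] at this
    exact this.symm
  have h2 : (ξ', Int.fract t) ∈ u ×ˢ w :=
    ⟨hξ', hw ⟨Int.fract_nonneg _, (Int.fract_lt_one _).le⟩⟩
  have h3 := huw h2
  rw [mem_ofPred_eq] at h3
  rw [h1]
  exact h3

theorem continuousOn_monopole (hp : ‖p‖ = 1) (hy : IsC1Loop y)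
    (hpy : ∀ t, inner ℝ p (y t) = 0) :
    ContinuousOn (monopole p y) {ξ | inner ℝ p ξ = 0 ∧ ∀ t, ξ ≠ y t} := by
  intro ξ hξ
  obtain ⟨v, hv, -⟩ := exists_isStringFree hp hy ξ 0 hξ.2
  have hev := hv.eventually hy
  have hc : ContinuousOn (fun ξ => dphase p y v ξ) {ξ | IsStringFree p y v ξ} :=
    continuousOn_intervalIntegral (continuousOn_dirac
      (hy.continuous_deriv.comp continuous_snd).continuousOn
      (continuous_fst.sub (hy.continuous.comp continuous_snd)).continuousOn
      fun q hq => hq.1.pos q.2)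
  have h1 : ContinuousAt (fun ξ => Complex.exp (Complex.I / 2 * dphase p y v ξ)) ξ :=
    ((Complex.continuous_ofReal.continuousAt.comp (hc.continuousAt hev)).const_mul _).cexp
  refine h1.continuousWithinAt.congr_of_eventuallyEq ?_ (monopole_eq hp hy hpy hξ.1 hv)
  filter_upwards [nhdsWithin_le_nhds hev, self_mem_nhdsWithin] with ξ' h2 h3
  exact monopole_eq hp hy hpy h3.1 h2

theorem dirac'_neg (p v w r r' : E4) : dirac' p v w r (-r') = -dirac' p v w r r' := by
  rw [dirac', dirac', inner_neg_right, inner_neg_right, ← neg_div]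
  congr 1
  have : det4 (-p) v (-r') w = -det4 (-p) v r' w := by
    simp only [det4_eq, PiLp.neg_apply]; ring
  rw [this]
  ring

/-- The phase varies along a curve as prescribed by the law of Biot and Savart. -/
theorem hasDerivAt_dphase (hy : IsC1Loop y) (hpy : ∀ t, inner ℝ p (y t) = 0)
    {x : ℝ → E4} (hx : IsC1Loop x) (hpx : ∀ t, inner ℝ p (x t) = 0) {v : E4} {s : ℝ}
    (hv : IsStringFree p y v (x s)) :
    HasDerivAt (fun s => dphase p y v (x s)) (gaussInner p x y s) s := by
  have hxc := hx.continuous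
  have hyc := hy.continuous
  have hxd := hx.continuous_deriv
  have hyd := hy.continuous_deriv
  have hc : Continuous fun q : ℝ × ℝ => ‖x q.1 - y q.2‖ + inner ℝ v (x q.1 - y q.2) := by
    fun_prop
  have h1 := hasDerivAt_intervalIntegral (isOpen_lt continuous_const hc)
    (f := fun s t => dirac p v (deriv y t) (x s - y t))
    (f' := fun s t => dirac' p v (deriv y t) (x s - y t) (deriv x s))
    (continuousOn_dirac (by fun_prop) (by fun_prop) fun q hq => hq)
    (continuousOn_dirac' (by fun_prop) (by fun_prop) (by fun_prop) fun q hq => hq)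
    (fun q hq => hasDerivAt_dirac ((hx.hasDerivAt q.1).sub_const _)
      (ne_zero_of_norm_add_inner_pos hq) hq) (fun t _ => hv.pos t)
  refine h1.congr_deriv ?_
  -- the other half of the curl is the integral of a derivative along the closed curve
  have h2 : ∀ t, HasDerivAt (fun t => dirac p v (deriv x s) (x s - y t))
      (-dirac' p v (deriv x s) (x s - y t) (deriv y t)) t := fun t => by
    rw [← dirac'_neg]
    exact hasDerivAt_dirac (r := fun t => x s - y t) ((hy.hasDerivAt t).const_sub (x s))
      (ne_zero_of_norm_add_inner_pos (hv.pos t)) (hv.pos t)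
  have h3 : Continuous fun t => dirac' p v (deriv x s) (x s - y t) (deriv y t) :=
    continuousOn_univ.1 (continuousOn_dirac' (by fun_prop) (by fun_prop) (by fun_prop)
      fun t _ => hv.pos t)
  have h3i := h3.intervalIntegrable (μ := MeasureTheory.volume) 0 1
  have h4 := intervalIntegral.integral_eq_sub_of_hasDerivAt (a := 0) (b := 1) (fun t _ => h2 t)
    h3i.neg
  have h5 : y 1 = y 0 := by simpa using hy.periodic 0
  rw [h5, sub_self, intervalIntegral.integral_neg, neg_eq_zero] at h4
  have h6 : Continuous fun t => dirac' p v (deriv y t) (x s - y t) (deriv x s) :=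
    continuousOn_univ.1 (continuousOn_dirac' (by fun_prop) (by fun_prop) (by fun_prop)
      fun t _ => hv.pos t)
  have h7 := intervalIntegral.integral_sub (a := 0) (b := 1)
    (h6.intervalIntegrable (μ := MeasureTheory.volume) _ _) h3i
  rw [h4, sub_zero] at h7
  rw [← h7, gaussInner]
  refine intervalIntegral.integral_congr fun t _ => ?_
  exact dirac'_sub_dirac' hv.norm_eq hv.inner_eq (by rw [inner_sub_right, hpx, hpy, sub_zero])
    (ne_zero_of_norm_add_inner_pos (hv.pos t)) (hv.pos t)

theorem continuous_gaussInner (p : E4) {x y : ℝ → E4} (hx : IsC1Loop x) (hy : IsC1Loop y)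
    (hxy : ∀ s t, x s ≠ y t) : Continuous (gaussInner p x y) := by
  have hxc := hx.continuous
  have hyc := hy.continuous
  have hxd := hx.continuous_deriv
  have hyd := hy.continuous_deriv
  rw [← continuousOn_univ]
  refine continuousOn_intervalIntegral (Continuous.continuousOn ?_)
  refine Continuous.div (Continuous.det4 (by fun_prop) (by fun_prop) (by fun_prop) (by fun_prop))
    (by fun_prop) fun q => pow_ne_zero 3 (norm_ne_zero_iff.2 (sub_ne_zero.2 (hxy _ _)))

theorem IsC1Loop.periodic_deriv (hy : IsC1Loop y) : Function.Periodic (deriv y) 1 := fun t => by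
  have : (fun t => y (t + 1)) = y := funext hy.periodic
  rw [← deriv_comp_add_const, this]

/-- The Gauss linking integral is the degree of the magnetic potential of one of the curves along
the other one. -/
theorem exists_hasDeg_monopole (hp : ‖p‖ = 1) (hy : IsC1Loop y) (hpy : ∀ t, inner ℝ p (y t) = 0)
    {x : ℝ → E4} (hx : IsC1Loop x) (hpx : ∀ t, inner ℝ p (x t) = 0) (hxy : ∀ s t, x s ≠ y t) :
    ∃ n : ℤ, HasDeg (fun s => monopole p y (x s)) n ∧
      (n : ℝ) = (4 * Real.pi)⁻¹ * ∫ s in (0 : ℝ)..1, gaussInner p x y s := by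
  set G := gaussInner p x y with hG
  have hGc : Continuous G := continuous_gaussInner p hx hy hxy
  have hGp : Function.Periodic G 1 := fun s => by
    simp only [hG, gaussInner, hx.periodic s, hx.periodic_deriv s]
  have hd : ∀ s, HasDerivAt (fun s => monopole p y (x s))
      (monopole p y (x s) * (Complex.I / 2 * G s)) s := by
    intro s
    obtain ⟨v, hv, -⟩ := exists_isStringFree hp hy (x s) 0 (hxy s)
    have h1 := (((hasDerivAt_dphase hy hpy hx hpx hv).ofReal_comp).const_mul
      (Complex.I / 2)).cexp
    rw [monopole_eq hp hy hpy (hpx s) hv]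
    refine h1.congr_of_eventuallyEq ?_
    filter_upwards [hx.continuous.continuousAt.eventually (hv.eventually hy)] with s' hs'
    exact monopole_eq hp hy hpy (hpx s') hs'
  set L : ℝ → ℂ := fun s => Complex.log (monopole p y (x 0)) +
    Complex.I / 2 * ((∫ u in (0 : ℝ)..s, G u : ℝ) : ℂ) with hL
  have hLd : ∀ s, HasDerivAt L (Complex.I / 2 * G s) s := fun s =>
    ((intervalIntegral.integral_hasDerivAt_right (hGc.intervalIntegrable _ _)
      hGc.stronglyMeasurable.stronglyMeasurableAtFilter
      hGc.continuousAt).ofReal_comp.const_mul _).const_add _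
  have hg : ∀ s, HasDerivAt (fun s => monopole p y (x s) * Complex.exp (-L s)) 0 s := fun s =>
    ((hd s).mul ((hLd s).neg.cexp)).congr_deriv (by simp only [Pi.neg_apply]; ring)
  have hLe : ∀ s, Complex.exp (L s) = monopole p y (x s) := by
    intro s
    have h1 := is_const_of_deriv_eq_zero (fun t => (hg t).differentiableAt)
      (fun t => (hg t).deriv) s 0
    have h2 : Complex.exp (L 0) = monopole p y (x 0) := by
      simp only [hL, intervalIntegral.integral_same, Complex.ofReal_zero, mul_zero, add_zero]
      exact Complex.exp_log (monopole_ne_zero _)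
    rw [Complex.exp_neg, Complex.exp_neg, h2, mul_inv_cancel₀ (monopole_ne_zero _),
      mul_inv_eq_one₀ (Complex.exp_ne_zero _)] at h1
    exact h1.symm
  have hLc : Continuous L := continuous_iff_continuousAt.2 fun s => (hLd s).continuousAt
  have hstep : ∀ s, L (s + 1) = L s + Complex.I / 2 * ((∫ u in (0 : ℝ)..1, G u : ℝ) : ℂ) := by
    intro s
    have h1 := hGp.intervalIntegral_add_eq s 0
    rw [zero_add] at h1
    have h2 := intervalIntegral.integral_add_adjacent_intervals
      (hGc.intervalIntegrable (μ := MeasureTheory.volume) 0 s) (hGc.intervalIntegrable s (s + 1))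
    simp only [hL]
    rw [← h2, h1]
    push_cast
    ring
  have h1 : Complex.exp (L (0 + 1)) = Complex.exp (L 0) := by
    rw [hLe, hLe, hx.periodic]
  obtain ⟨n, hn⟩ := Complex.exp_eq_exp_iff_exists_int.1 h1
  rw [hstep] at hn
  have h2 := add_left_cancel hn
  refine ⟨n, ⟨L, hLc, hLe, fun s => by rw [hstep, h2]⟩, ?_⟩
  have h3 : ((∫ u in (0 : ℝ)..1, G u : ℝ) : ℂ) = 4 * Real.pi * n := by
    have h4 : Complex.I * (((∫ u in (0 : ℝ)..1, G u : ℝ) : ℂ) - 4 * Real.pi * n) = 0 := by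
      linear_combination 2 * h2
    exact sub_eq_zero.1 ((mul_eq_zero.1 h4).resolve_left Complex.I_ne_zero)
  have h4 : ∫ u in (0 : ℝ)..1, G u = 4 * Real.pi * n := by exact_mod_cast h3
  rw [h4]
  have := Real.pi_pos
  field_simp

end Monopole

/-! ### The linking number -/

/-- Closed curves of class `C¹` and period `1` in `S³`. -/
structure IsSphereLoop (α : ℝ → E4) : Prop extends IsC1Loop α where
  norm_eq : ∀ s, ‖α s‖ = 1

section Stereographic

variable {p : E4}

theorem inner_stereoFrom (hp : ‖p‖ = 1) (x : E4) : inner ℝ p (stereoFrom p x) = 0 := by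
  rw [stereoFrom, inner_smul_right, inner_sub_right, inner_smul_right, real_inner_self_eq_norm_sq,
    hp]
  ring

theorem one_sub_inner_ne_zero {x : E4} (hp : ‖p‖ = 1) (hx : ‖x‖ = 1) (h : x ≠ p) :
    (1 : ℝ) - inner ℝ p x ≠ 0 := fun h0 =>
  h ((inner_eq_one_iff_of_norm_eq_one hp hx).1 (sub_eq_zero.1 h0).symm).symm

theorem stereoFrom_injOn (hp : ‖p‖ = 1) : InjOn (stereoFrom p) {x | ‖x‖ = 1 ∧ x ≠ p} := by
  have key : ∀ x : E4, ‖x‖ = 1 → x ≠ p →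
      x = (inner ℝ p x : ℝ) • p + (1 - inner ℝ p x : ℝ) • stereoFrom p x ∧
      (1 - inner ℝ p x) * ‖stereoFrom p x‖ ^ 2 = 1 + inner ℝ p x := fun x hx hxp => by
    have h0 := one_sub_inner_ne_zero hp hx hxp
    refine ⟨by rw [stereoFrom, smul_inv_smul₀ h0, add_sub_cancel], ?_⟩
    have h1 : ‖x - (inner ℝ p x : ℝ) • p‖ ^ 2 = 1 - (inner ℝ p x) ^ 2 := by
      rw [norm_sub_sq_real, norm_smul, hp, hx, inner_smul_right, real_inner_comm p x,
        Real.norm_eq_abs, mul_one, sq_abs]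
      ring
    rw [stereoFrom, norm_smul, mul_pow, h1, Real.norm_eq_abs, sq_abs]
    field_simp
    ring
  intro x hx y hy hxy
  obtain ⟨h1, h2⟩ := key x hx.1 hx.2
  obtain ⟨h3, h4⟩ := key y hy.1 hy.2
  rw [← hxy] at h3 h4
  have h5 : (inner ℝ p x - inner ℝ p y) * (1 + ‖stereoFrom p x‖ ^ 2) = 0 := by
    linear_combination h4 - h2
  have h6 : (inner ℝ p x : ℝ) = inner ℝ p y :=
    sub_eq_zero.1 ((mul_eq_zero.1 h5).resolve_right (by positivity))
  rw [h1, h3, ← h6]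

theorem continuousOn_stereoFrom :
    ContinuousOn (fun z : E4 × E4 => stereoFrom z.1 z.2) {z | (1 : ℝ) - inner ℝ z.1 z.2 ≠ 0} := by
  unfold stereoFrom
  exact ContinuousOn.smul (ContinuousOn.inv₀ (by fun_prop) fun z hz => hz) (by fun_prop)

variable {α β : ℝ → E4}

theorem IsSphereLoop.stereoFrom (hα : IsSphereLoop α) (hp : ‖p‖ = 1) (h : ∀ s, α s ≠ p) :
    IsC1Loop fun s => stereoFrom p (α s) where
  contDiff := by
    have h1 := hα.contDiff
    have h2 : ContDiff ℝ 1 fun s => (inner ℝ p (α s) : ℝ) := contDiff_const.inner ℝ h1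
    unfold _root_.stereoFrom
    exact (ContDiff.inv (by fun_prop) fun s =>
      one_sub_inner_ne_zero hp (hα.norm_eq s) (h s)).smul (by fun_prop)
  periodic s := by simp only [hα.periodic s]

theorem IsSphereLoop.hasDerivAt_stereoFrom (hα : IsSphereLoop α) (hp : ‖p‖ = 1)
    (h : ∀ s, α s ≠ p) (s : ℝ) : HasDerivAt (fun s => _root_.stereoFrom p (α s))
      ((1 - inner ℝ p (α s) : ℝ)⁻¹ • (deriv α s - (inner ℝ p (deriv α s) : ℝ) • p)
        + (inner ℝ p (deriv α s) / (1 - inner ℝ p (α s)) ^ 2 : ℝ) •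
          (α s - (inner ℝ p (α s) : ℝ) • p)) s := by
  have h1 : HasDerivAt (fun t => (inner ℝ p (α t) : ℝ)) (inner ℝ p (deriv α s)) s :=
    (innerSL ℝ p).hasFDerivAt.comp_hasDerivAt s (hα.hasDerivAt s)
  have h2 := (h1.const_sub 1).inv (one_sub_inner_ne_zero hp (hα.norm_eq s) (h s))
  refine (h2.smul ((hα.hasDerivAt s).sub (h1.smul_const p))).congr_deriv ?_
  rw [neg_neg]
  rfl

theorem gaussIntegral_eq (p : E4) (α β : ℝ → E4) :
    gaussIntegral p α β = (4 * Real.pi)⁻¹ * ∫ s in (0 : ℝ)..1,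
      gaussInner p (fun s => stereoFrom p (α s)) (fun t => stereoFrom p (β t)) s := rfl

theorem stereoFrom_ne (hp : ‖p‖ = 1) (hα : IsSphereLoop α) (hβ : IsSphereLoop β)
    (hpα : ∀ s, α s ≠ p) (hpβ : ∀ t, β t ≠ p) (hαβ : ∀ s t, α s ≠ β t) (s t : ℝ) :
    stereoFrom p (α s) ≠ stereoFrom p (β t) := fun h =>
  hαβ s t (stereoFrom_injOn hp ⟨hα.norm_eq s, hpα s⟩ ⟨hβ.norm_eq t, hpβ t⟩ h)

theorem exists_hasDeg_gaussIntegral (hp : ‖p‖ = 1) (hα : IsSphereLoop α) (hβ : IsSphereLoop β)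
    (hpα : ∀ s, α s ≠ p) (hpβ : ∀ t, β t ≠ p) (hαβ : ∀ s t, α s ≠ β t) :
    ∃ n : ℤ, HasDeg (fun s => monopole p (fun t => stereoFrom p (β t)) (stereoFrom p (α s))) n ∧
      (n : ℝ) = gaussIntegral p α β :=
  exists_hasDeg_monopole hp (hβ.stereoFrom hp hpβ) (fun _ => inner_stereoFrom hp _)
    (hα.stereoFrom hp hpα) (fun _ => inner_stereoFrom hp _) (stereoFrom_ne hp hα hβ hpα hpβ hαβ)

theorem gaussIntegral_comm (hp : ‖p‖ = 1) (hα : IsSphereLoop α) (hβ : IsSphereLoop β)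
    (hpα : ∀ s, α s ≠ p) (hpβ : ∀ t, β t ≠ p) (hαβ : ∀ s t, α s ≠ β t) :
    gaussIntegral p α β = gaussIntegral p β α := by
  have hx := hα.stereoFrom hp hpα
  have hy := hβ.stereoFrom hp hpβ
  have hxy := stereoFrom_ne hp hα hβ hpα hpβ hαβ
  rw [gaussIntegral_eq, gaussIntegral_eq]
  set x := fun s => stereoFrom p (α s)
  set y := fun t => stereoFrom p (β t)
  have hxc := hx.continuous
  have hyc := hy.continuous
  have hxd := hx.continuous_deriv
  have hyd := hy.continuous_deriv
  congr 1
  simp only [gaussInner]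
  rw [MeasureTheory.intervalIntegral_intervalIntegral_swap]
  · refine intervalIntegral.integral_congr fun t _ => intervalIntegral.integral_congr fun s _ => ?_
    simp only [norm_sub_rev (y t)]
    congr 1
    simp only [det4_eq, PiLp.sub_apply]
    ring
  · have hc : Continuous fun q : ℝ × ℝ =>
        det4 (-p) (x q.1 - y q.2) (deriv x q.1) (deriv y q.2) / ‖x q.1 - y q.2‖ ^ 3 :=
      Continuous.div (Continuous.det4 (by fun_prop) (by fun_prop) (by fun_prop) (by fun_prop))
        (by fun_prop) fun q => pow_ne_zero 3 (norm_ne_zero_iff.2 (sub_ne_zero.2 (hxy _ _)))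
    refine MeasureTheory.IntegrableOn.mono_set
      (t := Icc (0 : ℝ) 1 ×ˢ Icc (0 : ℝ) 1) (hc.continuousOn.integrableOn_compact
        (isCompact_Icc.prod isCompact_Icc)) ?_
    rw [uIoc_of_le zero_le_one]
    exact prod_mono Ioc_subset_Icc_self Ioc_subset_Icc_self

theorem continuousOn_gaussIntegral (hα : IsSphereLoop α) (hβ : IsSphereLoop β)
    (hαβ : ∀ s t, α s ≠ β t) : ContinuousOn (fun p => gaussIntegral p α β)
      {p | ‖p‖ = 1 ∧ (∀ s, α s ≠ p) ∧ ∀ t, β t ≠ p} := by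
  set V : Set E4 := {p | ‖p‖ = 1 ∧ (∀ s, α s ≠ p) ∧ ∀ t, β t ≠ p} with hV
  have hst : ∀ {γ : ℝ → E4}, IsSphereLoop γ → (∀ p ∈ V, ∀ s, γ s ≠ p) →
      ContinuousOn (fun q : E4 × ℝ => stereoFrom q.1 (γ q.2)) (V ×ˢ univ) ∧
      ContinuousOn (fun q : E4 × ℝ => deriv (fun u => stereoFrom q.1 (γ u)) q.2) (V ×ˢ univ) := by
    intro γ hγ h
    have hγc := hγ.continuous
    have hγd := hγ.continuous_deriv
    have h0 : ∀ q ∈ V ×ˢ (univ : Set ℝ), (1 : ℝ) - inner ℝ q.1 (γ q.2) ≠ 0 := fun q hq =>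
      one_sub_inner_ne_zero hq.1.1 (hγ.norm_eq _) (h _ hq.1 _)
    refine ⟨continuousOn_stereoFrom.comp (f := fun q : E4 × ℝ => (q.1, γ q.2)) (by fun_prop) h0,
      ContinuousOn.congr ?_ fun q hq =>
        (hγ.hasDerivAt_stereoFrom hq.1.1 (h _ hq.1) q.2).deriv⟩
    exact ((ContinuousOn.inv₀ (by fun_prop) h0).smul (by fun_prop)).add
      ((ContinuousOn.div (by fun_prop) (by fun_prop) fun q hq => pow_ne_zero 2 (h0 q hq)).smul
        (by fun_prop))
  obtain ⟨ha, ha'⟩ := hst hα fun p hp => hp.2.1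
  obtain ⟨hb, hb'⟩ := hst hβ fun p hp => hp.2.2
  have hm1 : MapsTo (fun z : (E4 × ℝ) × ℝ => (z.1.1, z.1.2)) ((V ×ˢ Icc 0 1) ×ˢ Icc 0 1)
    (V ×ˢ univ) := fun z hz => ⟨hz.1.1, mem_univ _⟩
  have hm2 : MapsTo (fun z : (E4 × ℝ) × ℝ => (z.1.1, z.2)) ((V ×ˢ Icc 0 1) ×ˢ Icc 0 1)
    (V ×ˢ univ) := fun z hz => ⟨hz.1.1, mem_univ _⟩
  have hsub := (ha.comp (by fun_prop) hm1).sub (hb.comp (by fun_prop) hm2)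
  refine continuousOn_const.mul (continuousOn_intervalIntegral
    (continuousOn_intervalIntegral ?_))
  refine ContinuousOn.div (ContinuousOn.det4 (by fun_prop) hsub (ha'.comp (by fun_prop) hm1)
    (hb'.comp (by fun_prop) hm2)) (hsub.norm.pow 3) fun z hz => ?_
  have hp := hz.1.1
  exact pow_ne_zero 3 (norm_ne_zero_iff.2 (sub_ne_zero.2
    (stereoFrom_ne hp.1 hα hβ hp.2.1 hp.2.2 hαβ _ _)))

/-- For two curves in `S³` and two points `p` and `q` there is a vector `r` which lies in none of
the planes spanned by `p` or `q` and a point of one of the curves, for dimension reasons. -/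
theorem exists_generic (hα : IsSphereLoop α) (hβ : IsSphereLoop β) (p q : E4) :
    ∃ r : E4, ∀ x, x = p ∨ x = q → ∀ a b s : ℝ, r ≠ a • x + b • α s ∧ r ≠ a • x + b • β s := by
  have h1 : ∀ (x : E4) {γ : ℝ → E4}, IsSphereLoop γ →
      dimH (range fun z : ℝ × ℝ × ℝ => z.1 • x + z.2.1 • γ z.2.2) < Module.finrank ℝ E4 := by
    intro x γ hγ
    have hγc := hγ.contDiff
    refine (ContDiff.dimH_range_le (by fun_prop)).trans_lt (Nat.cast_lt.2 ?_)
    simp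
  have h2 := dense_compl_of_dimH_lt_finrank (E := E4)
    (s := ((range fun z : ℝ × ℝ × ℝ => z.1 • p + z.2.1 • α z.2.2) ∪
      (range fun z : ℝ × ℝ × ℝ => z.1 • p + z.2.1 • β z.2.2)) ∪
      ((range fun z : ℝ × ℝ × ℝ => z.1 • q + z.2.1 • α z.2.2) ∪
      (range fun z : ℝ × ℝ × ℝ => z.1 • q + z.2.1 • β z.2.2))) (by
    simp only [dimH_union]
    exact max_lt (max_lt (h1 p hα) (h1 p hβ)) (max_lt (h1 q hα) (h1 q hβ)))
  obtain ⟨r, hr⟩ := h2.nonempty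
  simp only [mem_compl_iff, mem_union, not_or] at hr
  refine ⟨r, ?_⟩
  rintro x (rfl | rfl) a b s
  · exact ⟨fun h => hr.1.1 ⟨(a, b, s), h.symm⟩, fun h => hr.1.2 ⟨(a, b, s), h.symm⟩⟩
  · exact ⟨fun h => hr.2.1 ⟨(a, b, s), h.symm⟩, fun h => hr.2.2 ⟨(a, b, s), h.symm⟩⟩

/-- The Gauss linking integral does not depend on the center of the stereographic projection: it is
integral and varies continuously. -/
theorem gaussIntegral_eq_gaussIntegral {q : E4} (hα : IsSphereLoop α) (hβ : IsSphereLoop β)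
    (hαβ : ∀ s t, α s ≠ β t) (hp : ‖p‖ = 1) (hpα : ∀ s, α s ≠ p) (hpβ : ∀ t, β t ≠ p)
    (hq : ‖q‖ = 1) (hqα : ∀ s, α s ≠ q) (hqβ : ∀ t, β t ≠ q) :
    gaussIntegral p α β = gaussIntegral q α β := by
  obtain ⟨r, hr⟩ := exists_generic hα hβ p q
  suffices h : ∀ x, x = p ∨ x = q → ‖x‖ = 1 → (∀ s, α s ≠ x) → (∀ t, β t ≠ x) →
      gaussIntegral x α β = gaussIntegral (‖r‖⁻¹ • r) α β from
    (h p (Or.inl rfl) hp hpα hpβ).trans (h q (Or.inr rfl) hq hqα hqβ).symm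
  intro x hx hxn hxα hxβ
  have hr' := hr x hx
  set f : ℝ → E4 := fun t => (1 - t) • x + t • r with hf
  have hf0 : ∀ t ∈ Icc (0 : ℝ) 1, ∀ {γ : ℝ → E4}, IsSphereLoop γ → (∀ s, γ s ≠ x) →
      (∀ a b s : ℝ, r ≠ a • x + b • γ s) → ∀ c s : ℝ, 0 ≤ c → f t ≠ c • γ s := by
    intro t ht γ hγ hxγ hrγ c s hc h
    rcases eq_or_ne t 0 with rfl | ht0
    · have h1 : x = c • γ s := by simpa [hf] using h
      have h2 : c = 1 := by
        have := congrArg norm h1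
        rwa [hxn, norm_smul, hγ.norm_eq, mul_one, Real.norm_eq_abs, abs_of_nonneg hc,
          eq_comm] at this
      exact hxγ s (by rw [h1, h2, one_smul])
    · refine hrγ (-(t⁻¹ * (1 - t))) (t⁻¹ * c) s ?_
      rw [mul_smul t⁻¹ c, ← h, hf, smul_add, inv_smul_smul₀ ht0, smul_smul, neg_smul,
        neg_add_cancel_left]
  have hfn : ∀ t ∈ Icc (0 : ℝ) 1, ‖f t‖ ≠ 0 := fun t ht h =>
    hf0 t ht hα hxα (fun a b s => (hr' a b s).1) 0 0 le_rfl (by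
      rw [zero_smul]
      exact norm_eq_zero.1 h)
  set g : ℝ → E4 := fun t => ‖f t‖⁻¹ • f t with hg
  have hfc : Continuous f := by fun_prop
  have hgc : ContinuousOn g (Icc 0 1) :=
    (hfc.norm.continuousOn.inv₀ hfn).smul hfc.continuousOn
  have hgm : MapsTo g (Icc 0 1) {p | ‖p‖ = 1 ∧ (∀ s, α s ≠ p) ∧ ∀ t, β t ≠ p} := by
    intro t ht
    have h1 : ∀ z, z = g t → f t = ‖f t‖ • z := fun z hz => by
      rw [hz, hg, smul_inv_smul₀ (hfn t ht)]
    refine ⟨?_, fun s h => hf0 t ht hα hxα (fun a b s => (hr' a b s).1) _ s (norm_nonneg _)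
      (h1 _ h), fun s h => hf0 t ht hβ hxβ (fun a b s => (hr' a b s).2) _ s (norm_nonneg _)
      (h1 _ h)⟩
    simp only [hg, norm_smul, norm_inv, norm_norm]
    exact inv_mul_cancel₀ (hfn t ht)
  have hdisc : IsDiscrete (range ((↑) : ℤ → ℝ)) :=
    isDiscrete_iff_discreteTopology.2
      Int.isClosedEmbedding_coe_real.isEmbedding.toHomeomorph.symm.isEmbedding.discreteTopology
  have h1 := isPreconnected_Icc.constant_of_mapsTo hdisc
    ((continuousOn_gaussIntegral hα hβ hαβ).comp hgc hgm) (fun t ht => by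
      obtain ⟨h2, h3, h4⟩ := hgm ht
      obtain ⟨n, -, hn⟩ := exists_hasDeg_gaussIntegral h2 hα hβ h3 h4 hαβ
      exact ⟨n, hn⟩) (left_mem_Icc.2 zero_le_one) (right_mem_Icc.2 zero_le_one)
  have h2 : g 0 = x := by simp [hg, hf, hxn]
  have h3 : g 1 = ‖r‖⁻¹ • r := by simp [hg, hf]
  simpa only [Function.comp_apply, h2, h3] using h1

theorem linkingNumber_eq_gaussIntegral (hα : IsSphereLoop α) (hβ : IsSphereLoop β)
    (hαβ : ∀ s t, α s ≠ β t) (hp : ‖p‖ = 1) (hpα : ∀ s, α s ≠ p) (hpβ : ∀ t, β t ≠ p) :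
    (linkingNumber α β : ℝ) = gaussIntegral p α β := by
  have h : ∃ p : E4, ‖p‖ = 1 ∧ p ∉ range α ∧ p ∉ range β :=
    ⟨p, hp, by rintro ⟨s, hs⟩; exact hpα s hs, by rintro ⟨s, hs⟩; exact hpβ s hs⟩
  obtain ⟨h1, h2, h3⟩ := h.choose_spec
  rw [linkingNumber, dif_pos h, gaussIntegral_eq_gaussIntegral hα hβ hαβ h1
    (fun s hs => h2 ⟨s, hs⟩) (fun s hs => h3 ⟨s, hs⟩) hp hpα hpβ]
  obtain ⟨n, -, hn⟩ := exists_hasDeg_gaussIntegral hp hα hβ hpα hpβ hαβ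
  rw [← hn, round_intCast]

theorem linkingNumber_comm (hα : IsSphereLoop α) (hβ : IsSphereLoop β)
    (hαβ : ∀ s t, α s ≠ β t) (hp : ‖p‖ = 1) (hpα : ∀ s, α s ≠ p) (hpβ : ∀ t, β t ≠ p) :
    linkingNumber α β = linkingNumber β α := by
  have h := gaussIntegral_comm hp hα hβ hpα hpβ hαβ
  rw [← linkingNumber_eq_gaussIntegral hα hβ hαβ hp hpα hpβ,
    ← linkingNumber_eq_gaussIntegral hβ hα (fun s t h => hαβ t s h.symm) hp hpβ hpα] at h
  exact_mod_cast h

/-- The linking number with a fixed curve is the degree of a nonvanishing function on the complement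
of this curve in `S³ ∖ {p}`. -/
theorem exists_hasDeg_linkingNumber (hp : ‖p‖ = 1) (hβ : IsSphereLoop β) (hpβ : ∀ t, β t ≠ p) :
    ∃ U : E4 → ℂ, ContinuousOn U {x | ‖x‖ = 1 ∧ x ≠ p ∧ ∀ t, x ≠ β t} ∧ (∀ x, U x ≠ 0) ∧
      ∀ α, IsSphereLoop α → (∀ s, α s ≠ p) → (∀ s t, α s ≠ β t) →
        HasDeg (fun s => U (α s)) (linkingNumber α β) := by
  refine ⟨fun x => monopole p (fun t => stereoFrom p (β t)) (stereoFrom p x), ?_,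
    fun x => monopole_ne_zero _, fun α hα hpα hαβ => ?_⟩
  · refine (continuousOn_monopole hp (hβ.stereoFrom hp hpβ)
      fun _ => inner_stereoFrom hp _).comp ?_ ?_
    · exact continuousOn_stereoFrom.comp (f := fun x => (p, x)) (by fun_prop)
        fun x hx => one_sub_inner_ne_zero hp hx.1 hx.2.1
    · exact fun x hx => ⟨inner_stereoFrom hp _, fun t h => hx.2.2 t
        (stereoFrom_injOn hp ⟨hx.1, hx.2.1⟩ ⟨hβ.norm_eq t, hpβ t⟩ h)⟩
  · obtain ⟨n, h1, h2⟩ := exists_hasDeg_gaussIntegral hp hα hβ hpα hpβ hαβ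
    rw [← linkingNumber_eq_gaussIntegral hα hβ hαβ hp hpα hpβ] at h2
    rwa [← Int.cast_injective h2]

end Stereographic

/-! ### The normal field of a Seifert surface -/

section Cross

variable {a b c d z : E4}

theorem det4_ne_zero (h : ∀ s t u v : ℝ, s • a + t • b + u • c + v • d = 0 →
    s = 0 ∧ t = 0 ∧ u = 0 ∧ v = 0) : det4 a b c d ≠ 0 := by
  intro h0
  obtain ⟨x, hx0, hx⟩ := Matrix.exists_vecMul_eq_zero_iff.2 h0
  refine hx0 ?_
  obtain ⟨h1, h2, h3, h4⟩ := h (x 0) (x 1) (x 2) (x 3) (by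
    ext i
    have := congrFun hx i
    simpa [Matrix.vecMul, dotProduct, Fin.sum_univ_four, add_assoc] using this)
  funext i
  fin_cases i <;> assumption

theorem eq_zero_of_det4_ne_zero (h : det4 a b c d ≠ 0) (ha : inner ℝ a z = 0)
    (hb : inner ℝ b z = 0) (hc : inner ℝ c z = 0) (hd : inner ℝ d z = 0) : z = 0 := by
  have h1 := Matrix.eq_zero_of_mulVec_eq_zero (v := fun i => z i) h (by
    simp only [inner_E4] at ha hb hc hd
    funext i
    fin_cases i <;> simpa [Matrix.mulVec, dotProduct, Fin.sum_univ_four])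
  ext i
  exact congrFun h1 i

/-- The triple cross product of `ℝ⁴`. -/
noncomputable def cross (a b c : E4) : E4 :=
  WithLp.toLp 2 fun i => det4 a b c (EuclideanSpace.single i 1)

theorem inner_cross (a b c z : E4) : inner ℝ (cross a b c) z = det4 a b c z := by
  simp [cross, inner_E4, det4_eq]
  ring

theorem ContDiffOn.cross {s : Set ℝ} {a b c : ℝ → E4} (ha : ContDiffOn ℝ 1 a s)
    (hb : ContDiffOn ℝ 1 b s) (hc : ContDiffOn ℝ 1 c s) :
    ContDiffOn ℝ 1 (fun x => _root_.cross (a x) (b x) (c x)) s := by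
  refine contDiffOn_euclidean.2 fun i => ?_
  have ha' := contDiffOn_euclidean.1 ha
  have hb' := contDiffOn_euclidean.1 hb
  have hc' := contDiffOn_euclidean.1 hc
  simp only [_root_.cross, det4_eq]
  fun_prop

/-- A unit vector orthogonal to `a`, `b`, `c` is their normalized cross product, if it completes
them to a positive basis. -/
theorem eq_inv_norm_smul_cross (h : 0 < det4 a b c d) (had : inner ℝ a d = 0)
    (hbd : inner ℝ b d = 0) (hcd : inner ℝ c d = 0) (hd : ‖d‖ = 1) :
    d = ‖cross a b c‖⁻¹ • cross a b c := by
  set w := cross a b c with hw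
  have hself : ∀ z, det4 a b c z = inner ℝ w z := fun z => (inner_cross a b c z).symm
  have hwz : ∀ z, inner ℝ z w = det4 a b c z := fun z => by rw [hself, real_inner_comm]
  have hw0 : 0 < ‖w‖ := norm_pos_iff.2 fun h0 => by
    rw [hself, h0, inner_zero_left] at h
    exact h.false
  have hww : det4 a b c w = ‖w‖ ^ 2 := by rw [hself, real_inner_self_eq_norm_sq]
  set k := det4 a b c d / ‖w‖ ^ 2 with hk
  have hk0 : 0 < k := by positivity
  have hd' : d = k • w := by
    refine sub_eq_zero.1 (eq_zero_of_det4_ne_zero (a := a) (b := b) (c := c) (d := w)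
      (hww ▸ (pow_pos hw0 2).ne') ?_ ?_ ?_ ?_)
    · rw [inner_sub_right, inner_smul_right, had, hwz,
        show det4 a b c a = 0 by rw [det4_eq]; ring]
      simp
    · rw [inner_sub_right, inner_smul_right, hbd, hwz,
        show det4 a b c b = 0 by rw [det4_eq]; ring]
      simp
    · rw [inner_sub_right, inner_smul_right, hcd, hwz,
        show det4 a b c c = 0 by rw [det4_eq]; ring]
      simp
    · rw [inner_sub_right, inner_smul_right, ← hself, ← hself, hww, hk,
        div_mul_cancel₀ _ (pow_pos hw0 2).ne', sub_self]
  have h1 : k = ‖w‖⁻¹ := by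
    have h2 := congrArg norm hd'
    rw [hd, norm_smul, Real.norm_eq_abs, abs_of_pos hk0] at h2
    exact eq_inv_of_mul_eq_one_left h2.symm
  rw [← h1]
  exact hd'

end Cross

namespace SeifertSurface

variable {S : Type*} [TopologicalSpace S] [CompactSpace S] [T2Space S]
  [ChartedSpace (EuclideanHalfSpace 2) S] [IsManifold (𝓡∂ 2) ∞ S] {n : ℕ}
  (Q : SeifertSurface S n)

/-- The local parametrization of the surface given by the chart at `x`. -/
noncomputable def param (x : S) : E2 → E4 := Q.emb ∘ (extChartAt (𝓡∂ 2) x).symm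

/-- The derivative of the local parametrization. -/
noncomputable def dparam (x : S) : E2 → E2 →L[ℝ] E4 :=
  fderivWithin ℝ (Q.param x) (extChartAt (𝓡∂ 2) x).target

theorem contMDiff_emb : ContMDiff (𝓡∂ 2) 𝓘(ℝ, E4) ∞ Q.emb :=
  contMDiffOn_univ.1 Q.emb_embedding.smooth

theorem contDiffOn_param (x : S) :
    ContDiffOn ℝ ∞ (Q.param x) (extChartAt (𝓡∂ 2) x).target :=
  contMDiffOn_iff_contDiffOn.1
    (Q.contMDiff_emb.comp_contMDiffOn (contMDiffOn_extChartAt_symm x))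

theorem contDiffOn_dparam (x : S) :
    ContDiffOn ℝ 1 (Q.dparam x) (extChartAt (𝓡∂ 2) x).target :=
  (Q.contDiffOn_param x).fderivWithin (uniqueDiffOn_extChartAt_target x)
    (WithTop.coe_le_coe.2 le_top)

theorem hasFDerivWithinAt_param {x : S} {u : E2} (hu : u ∈ (extChartAt (𝓡∂ 2) x).target) :
    HasFDerivWithinAt (Q.param x) (Q.dparam x u) (extChartAt (𝓡∂ 2) x).target u :=
  ((Q.contDiffOn_param x).differentiableOn (by simp) u hu).hasFDerivWithinAt

theorem dparam_eq {x : S} {u : E2} (hu : u ∈ (extChartAt (𝓡∂ 2) x).target) :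
    Q.dparam x u = (mfderiv (𝓡∂ 2) 𝓘(ℝ, E4) Q.emb ((extChartAt (𝓡∂ 2) x).symm u)).comp
      (mfderivWithin 𝓘(ℝ, E2) (𝓡∂ 2) (extChartAt (𝓡∂ 2) x).symm (range (𝓡∂ 2)) u) := by
  have h1 := (mdifferentiableWithinAt_extChartAt_symm hu).hasMFDerivWithinAt
  have h2 := ((Q.contMDiff_emb ((extChartAt (𝓡∂ 2) x).symm u)).mdifferentiableAt
    (by simp)).hasMFDerivAt
  have h3 : HasFDerivWithinAt (Q.param x)
      ((mfderiv (𝓡∂ 2) 𝓘(ℝ, E4) Q.emb ((extChartAt (𝓡∂ 2) x).symm u)).comp (mfderivWithin 𝓘(ℝ, E2)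
        (𝓡∂ 2) (extChartAt (𝓡∂ 2) x).symm (range (𝓡∂ 2)) u) : E2 →L[ℝ] E4) (range (𝓡∂ 2)) u :=
    (h2.comp_hasMFDerivWithinAt u h1).hasFDerivWithinAt
  exact (uniqueDiffOn_extChartAt_target x u hu).eq (Q.hasFDerivWithinAt_param hu)
    (h3.mono (extChartAt_target_subset_range x))

theorem dparam_injective {x : S} {u : E2} (hu : u ∈ (extChartAt (𝓡∂ 2) x).target) :
    Function.Injective (Q.dparam x u) := by
  rw [Q.dparam_eq hu]
  have h1 := Q.emb_embedding.immersion ((extChartAt (𝓡∂ 2) x).symm u) (mem_univ _)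
  rw [mfderivWithin_univ] at h1
  refine h1.comp (Function.LeftInverse.injective (g := mfderiv (𝓡∂ 2) 𝓘(ℝ, E2)
    (extChartAt (𝓡∂ 2) x) ((extChartAt (𝓡∂ 2) x).symm u)) fun v => ?_)
  exact DFunLike.congr_fun (mfderiv_extChartAt_comp_mfderivWithin_extChartAt_symm hu) v

theorem inner_normal_dparam {x : S} {u : E2} (hu : u ∈ (extChartAt (𝓡∂ 2) x).target) (v : E2) :
    inner ℝ (Q.normal ((extChartAt (𝓡∂ 2) x).symm u)) (Q.dparam x u v) = 0 := by
  rw [Q.dparam_eq hu]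
  exact Q.normal_surface _ _

theorem inner_param_dparam {x : S} {u : E2} (hu : u ∈ (extChartAt (𝓡∂ 2) x).target) (v : E2) :
    inner ℝ (Q.param x u) (Q.dparam x u v) = 0 := by
  have h1 := (Q.hasFDerivWithinAt_param hu).inner ℝ (Q.hasFDerivWithinAt_param hu)
  have h2 : HasFDerivWithinAt (fun t => (inner ℝ (Q.param x t) (Q.param x t) : ℝ))
      (0 : E2 →L[ℝ] ℝ) (extChartAt (𝓡∂ 2) x).target u := by
    refine (hasFDerivWithinAt_const (1 : ℝ) u _).congr (fun t _ => ?_) ?_ <;>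
    rw [real_inner_self_eq_norm_sq, param, Function.comp_apply, Q.norm_emb, one_pow]
  have h3 := DFunLike.congr_fun ((uniqueDiffOn_extChartAt_target x u hu).eq h1 h2) v
  simp only [ContinuousLinearMap.comp_apply, ContinuousLinearMap.prod_apply, fderivInnerCLM_apply,
    zero_apply] at h3
  rw [real_inner_comm (Q.param x u)] at h3
  linarith

/-- The vectors `e`, `∂₁e`, `∂₂e` and the normal vector are linearly independent. -/
theorem det4_dparam_ne_zero {x : S} {u : E2} (hu : u ∈ (extChartAt (𝓡∂ 2) x).target) :
    det4 (Q.param x u) (Q.dparam x u (EuclideanSpace.single 0 1))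
      (Q.dparam x u (EuclideanSpace.single 1 1))
      (Q.normal ((extChartAt (𝓡∂ 2) x).symm u)) ≠ 0 := by
  set y := (extChartAt (𝓡∂ 2) x).symm u
  have hne : inner ℝ (Q.normal y) (Q.param x u) = (0 : ℝ) := Q.normal_sphere _
  have hee : inner ℝ (Q.param x u) (Q.param x u) = (1 : ℝ) := by
    rw [real_inner_self_eq_norm_sq, param, Function.comp_apply, Q.norm_emb, one_pow]
  have hnn : inner ℝ (Q.normal y) (Q.normal y) = (1 : ℝ) := by
    rw [real_inner_self_eq_norm_sq, Q.norm_normal, one_pow]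
  have hnd : ∀ v, inner ℝ (Q.normal y) (Q.dparam x u v) = (0 : ℝ) := Q.inner_normal_dparam hu
  refine det4_ne_zero fun r s t v h => ?_
  have h1 := congrArg (inner ℝ (Q.param x u)) h
  have h2 := congrArg (inner ℝ (Q.normal y)) h
  simp only [inner_add_right, inner_smul_right, inner_zero_right, hee, hnn, hne,
    Q.inner_param_dparam hu, hnd,
    real_inner_comm (Q.normal y) (Q.param x u)] at h1 h2
  have hr : r = 0 := by linarith
  have hv : v = 0 := by linarith
  have h3 : Q.dparam x u (s • EuclideanSpace.single 0 1 + t • EuclideanSpace.single 1 1) = 0 := by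
    rw [map_add, map_smul, map_smul]
    simpa [hr, hv] using h
  have h4 := (map_eq_zero_iff _ (Q.dparam_injective hu)).1 h3
  have h5 := congrArg (fun z : E2 => z 0) h4
  have h6 := congrArg (fun z : E2 => z 1) h4
  exact ⟨hr, by simpa using h5, by simpa using h6, hv⟩

/-- The unit normal field is of class `C¹` along smooth curves: it is the normalized cross product
of `e`, `∂₁e`, `∂₂e`, up to a locally constant sign. -/
theorem contDiff_normal_comp {γ : ℝ → S} (hγ : ContMDiff 𝓘(ℝ, ℝ) (𝓡∂ 2) ∞ γ) :
    ContDiff ℝ 1 fun s => Q.normal (γ s) := by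
  refine contDiff_iff_contDiffAt.2 fun s₀ => ?_
  set φ := extChartAt (𝓡∂ 2) (γ s₀) with hφ
  set O := γ ⁻¹' φ.source with hO
  have hOo : IsOpen O := (isOpen_extChartAt_source _).preimage hγ.continuous
  have hs₀ : s₀ ∈ O := mem_extChartAt_source _
  have hφγ : ContDiffOn ℝ 1 (fun s => φ (γ s)) O :=
    (contMDiffOn_iff_contDiffOn.1 (contMDiffOn_extChartAt.comp hγ.contMDiffOn
      (by rw [← extChartAt_source (𝓡∂ 2)]))).of_le (by simp)
  have hm : MapsTo (fun s => φ (γ s)) O φ.target := fun s hs => φ.map_source hs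
  have hleft : ∀ s ∈ O, φ.symm (φ (γ s)) = γ s := fun s hs => φ.left_inv hs
  set a : ℝ → E4 := fun s => Q.param (γ s₀) (φ (γ s))
  set b : E2 → ℝ → E4 := fun v s => Q.dparam (γ s₀) (φ (γ s)) v
  have ha : ContDiffOn ℝ 1 a O := ((Q.contDiffOn_param _).of_le (by simp)).comp hφγ hm
  have hb : ∀ v, ContDiffOn ℝ 1 (b v) O := fun v =>
    ((Q.contDiffOn_dparam _).comp hφγ hm).clm_apply contDiffOn_const
  set w : ℝ → E4 := fun s =>
    cross (a s) (b (EuclideanSpace.single 0 1) s) (b (EuclideanSpace.single 1 1) s)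
  have hw : ContDiffOn ℝ 1 w O := ha.cross (hb _) (hb _)
  set δ : ℝ → ℝ := fun s => inner ℝ (w s) (Q.normal (γ s)) with hδ
  have hδc : ContinuousOn δ O :=
    hw.continuousOn.inner (Q.normal_continuous.comp hγ.continuous).continuousOn
  have hδ0 : ∀ s ∈ O, δ s ≠ 0 := fun s hs => by
    have h1 := Q.det4_dparam_ne_zero (hm hs)
    rw [hleft s hs] at h1
    simpa only [hδ, w, inner_cross] using h1
  have hon : ∀ s ∈ O, inner ℝ (a s) (Q.normal (γ s)) = (0 : ℝ) ∧
      ∀ v, inner ℝ (b v s) (Q.normal (γ s)) = (0 : ℝ) := fun s hs => by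
    refine ⟨?_, fun v => ?_⟩
    · have h1 := Q.normal_sphere (γ s)
      rw [real_inner_comm] at h1
      rwa [show a s = Q.emb (γ s) from congrArg Q.emb (hleft s hs)]
    · have h1 := Q.inner_normal_dparam (hm hs) v
      rw [hleft s hs, real_inner_comm] at h1
      exact h1
  have hw0 : ∀ s ∈ O, w s ≠ 0 := fun s hs h => hδ0 s hs (by simp only [hδ, h, inner_zero_left])
  have hunit : ContDiffAt ℝ 1 (fun s => ‖w s‖⁻¹ • w s) s₀ := by
    have h1 := hw.contDiffAt (hOo.mem_nhds hs₀)
    exact ((h1.norm ℝ (hw0 _ hs₀)).inv (norm_ne_zero_iff.2 (hw0 _ hs₀))).smul h1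
  have hδa := hδc.continuousAt (hOo.mem_nhds hs₀)
  rcases (hδ0 s₀ hs₀).lt_or_gt with h | h
  · refine hunit.neg.congr_of_eventuallyEq ?_
    filter_upwards [hOo.mem_nhds hs₀, hδa.eventually_lt_const h] with s hs hs'
    have h1 := eq_inv_norm_smul_cross (d := -Q.normal (γ s))
      (a := a s) (b := b (EuclideanSpace.single 0 1) s) (c := b (EuclideanSpace.single 1 1) s)
      (by rw [← inner_cross, inner_neg_right]; exact neg_pos.2 hs')
      (by rw [inner_neg_right, (hon s hs).1, neg_zero])
      (by rw [inner_neg_right, (hon s hs).2, neg_zero])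
      (by rw [inner_neg_right, (hon s hs).2, neg_zero]) (by rw [norm_neg, Q.norm_normal])
    exact neg_eq_iff_eq_neg.1 h1
  · refine hunit.congr_of_eventuallyEq ?_
    filter_upwards [hOo.mem_nhds hs₀, hδa.eventually_const_lt h] with s hs hs'
    exact eq_inv_norm_smul_cross (by rw [← inner_cross]; exact hs') (hon s hs).1 ((hon s hs).2 _)
      ((hon s hs).2 _) (Q.norm_normal _)

end SeifertSurface

/-! ### Push-offs of a Seifert surface -/

namespace SeifertSurface

variable {S : Type*} [TopologicalSpace S] [CompactSpace S] [T2Space S]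
  [ChartedSpace (EuclideanHalfSpace 2) S] [IsManifold (𝓡∂ 2) ∞ S] {n : ℕ}
  (Q : SeifertSurface S n)

theorem emb_injective : Function.Injective Q.emb :=
  injOn_univ.1 Q.emb_embedding.injOn

/-- Short chords of the surface are nearly tangent to it. -/
theorem eventually_abs_inner_normal_le {ζ : ℝ} (hζ : 0 < ζ) (hζ1 : ζ ≤ 1) (x₀ : S) :
    ∀ᶠ z : S × S in 𝓝 (x₀, x₀),
      |inner ℝ (Q.normal z.2) (Q.emb z.1 - Q.emb z.2)| ≤ ζ * ‖Q.emb z.1 - Q.emb z.2‖ := by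
  set φ := extChartAt (𝓡∂ 2) x₀ with hφ
  set f := Q.param x₀ with hf
  have hu₀ : φ x₀ ∈ φ.target := mem_extChartAt_target x₀
  obtain ⟨K, hK, hKa⟩ := LinearMap.exists_antilipschitzWith (Q.dparam x₀ (φ x₀)).toLinearMap
    (LinearMap.ker_eq_bot.2 (Q.dparam_injective hu₀))
  have hK' : (0 : ℝ) < K := hK
  set η : ℝ := ζ / (4 * K) with hη
  have hη0 : 0 < η := by positivity
  -- a convex neighbourhood on which the derivative varies by at most `η`
  obtain ⟨r, hr, hrt⟩ : ∃ r > 0, ball (φ x₀) r ∩ range (𝓡∂ 2) ⊆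
      {u | u ∈ φ.target ∧ ‖Q.dparam x₀ u - Q.dparam x₀ (φ x₀)‖ ≤ η} := by
    rw [← Metric.mem_nhdsWithin_iff]
    have h1 : ∀ᶠ u in 𝓝[φ.target] φ x₀, ‖Q.dparam x₀ u - Q.dparam x₀ (φ x₀)‖ < η := by
      have h2 := ((Q.contDiffOn_dparam x₀).continuousOn _ hu₀).sub_const (Q.dparam x₀ (φ x₀))
      have h3 : Tendsto _ _ _ := h2.norm
      rw [sub_self, norm_zero] at h3
      exact h3.eventually (gt_mem_nhds hη0)
    rw [nhdsWithin_extChartAt_target_eq] at h1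
    filter_upwards [h1, extChartAt_target_mem_nhdsWithin x₀] with u h2 h3
    exact ⟨h3, h2.le⟩
  set W := ball (φ x₀) r ∩ range (𝓡∂ 2) with hW
  have hWt : W ⊆ φ.target := fun u hu => (hrt hu).1
  have hWc : Convex ℝ W := (convex_ball _ _).inter (𝓡∂ 2).convex_range
  have hlin : ∀ u ∈ W, ∀ v ∈ W,
      ‖f u - f v - Q.dparam x₀ (φ x₀) (u - v)‖ ≤ η * ‖u - v‖ := fun u hu v hv =>
    hWc.norm_image_sub_le_of_norm_hasFDerivWithin_le'
      (fun w hw => (Q.hasFDerivWithinAt_param (hWt hw)).mono hWt) (fun w hw => (hrt hw).2) hv hu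
  have hφc : ContinuousAt φ x₀ := continuousAt_extChartAt x₀
  have hN : φ.source ∩ φ ⁻¹' W ∈ 𝓝 x₀ := by
    filter_upwards [extChartAt_source_mem_nhds (I := 𝓡∂ 2) x₀,
      hφc.preimage_mem_nhds (ball_mem_nhds _ hr)] with x hx hxr
    exact ⟨hx, hxr, extChartAt_target_subset_range x₀ (φ.map_source hx)⟩
  filter_upwards [prod_mem_nhds hN hN]
  rintro ⟨x, y⟩ ⟨⟨hxs, hxW⟩, hys, hyW⟩
  change φ x ∈ W at hxW
  change φ y ∈ W at hyW
  have hfx : f (φ x) = Q.emb x := congrArg Q.emb (φ.left_inv hxs)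
  have hfy : f (φ y) = Q.emb y := congrArg Q.emb (φ.left_inv hys)
  set d := φ x - φ y with hd
  have h1 := hlin _ hxW _ hyW
  rw [hfx, hfy] at h1
  set e := Q.emb x - Q.emb y with he
  have h2 : ‖d‖ ≤ K * ‖Q.dparam x₀ (φ x₀) d‖ := by
    have := hKa.le_mul_dist d 0
    simpa using this
  have h3 : ‖Q.dparam x₀ (φ x₀) d‖ ≤ ‖e‖ + η * ‖d‖ := by
    have := norm_sub_norm_le (Q.dparam x₀ (φ x₀) d) e
    rw [norm_sub_rev _ e] at this
    linarith
  have hKη : K * η = ζ / 4 := by rw [hη]; field_simp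
  have h4 : ‖d‖ ≤ 2 * K * ‖e‖ := by
    have h5 := h2.trans (mul_le_mul_of_nonneg_left h3 hK'.le)
    have h6 : (K : ℝ) * (η * ‖d‖) ≤ 1 / 4 * ‖d‖ := by
      rw [← mul_assoc, hKη]
      exact mul_le_mul_of_nonneg_right (by linarith) (norm_nonneg _)
    nlinarith [norm_nonneg d, mul_nonneg hK'.le (norm_nonneg e)]
  have h5 : ‖e - Q.dparam x₀ (φ y) d‖ ≤ 2 * η * ‖d‖ := by
    have h6 : e - Q.dparam x₀ (φ y) d = (e - Q.dparam x₀ (φ x₀) d)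
      - (Q.dparam x₀ (φ y) - Q.dparam x₀ (φ x₀)) d := by
      rw [sub_apply]; abel
    have h7 := (Q.dparam x₀ (φ y) - Q.dparam x₀ (φ x₀)).le_of_opNorm_le (hrt hyW).2 d
    rw [h6]
    exact (norm_sub_le _ _).trans (by linarith)
  have h6 : inner ℝ (Q.normal y) e = inner ℝ (Q.normal y) (e - Q.dparam x₀ (φ y) d) := by
    have h7 := Q.inner_normal_dparam (hWt hyW) d
    rw [show (extChartAt (𝓡∂ 2) x₀).symm (φ y) = y from φ.left_inv hys] at h7
    exact ((inner_sub_right (Q.normal y) e _).trans (by rw [h7, sub_zero])).symm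
  simp only
  rw [h6]
  calc |inner ℝ (Q.normal y) (e - Q.dparam x₀ (φ y) d)|
      ≤ ‖Q.normal y‖ * ‖e - Q.dparam x₀ (φ y) d‖ := abs_real_inner_le_norm _ _
    _ ≤ 2 * η * (2 * K * ‖e‖) := by
        rw [Q.norm_normal, one_mul]
        exact h5.trans (mul_le_mul_of_nonneg_left h4 (by positivity))
    _ = ζ * ‖e‖ := by linear_combination 4 * ‖e‖ * hKη

/-- The surface pushed off in the normal direction, along geodesics of `S³` of length `ε`. -/
noncomputable def push (ε : ℝ) (x : S) : E4 := Real.cos ε • Q.emb x + Real.sin ε • Q.normal x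

theorem push_zero (x : S) : Q.push 0 x = Q.emb x := by simp [push]

theorem norm_push (ε : ℝ) (x : S) : ‖Q.push ε x‖ = 1 := by
  have h1 : ‖Q.push ε x‖ ^ 2 = 1 := by
    rw [push, norm_add_sq_real, norm_smul, norm_smul, inner_smul_left, inner_smul_right,
      real_inner_comm, Q.normal_sphere, Q.norm_emb, Q.norm_normal, Real.norm_eq_abs,
      Real.norm_eq_abs, mul_one, mul_one, sq_abs, sq_abs]
    simp
  exact (sq_eq_sq₀ (norm_nonneg _) zero_le_one).1 (h1.trans (one_pow 2).symm)

theorem continuous_push : Continuous fun z : ℝ × S => Q.push z.1 z.2 := by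
  have h1 := Q.contMDiff_emb.continuous
  have h2 := Q.normal_continuous
  unfold push
  fun_prop

/-- The push-offs of the surface in the two normal directions are disjoint from the surface and from
each other. -/
theorem exists_push_ne : ∃ ε₀ > 0, ∀ ε ∈ Icc 0 ε₀, ∀ ε' ∈ Icc 0 ε₀, 0 < ε + ε' → ∀ x y,
    Q.push ε x ≠ Q.push (-ε') y := by
  have hemb := Q.contMDiff_emb.continuous
  have hnor := Q.normal_continuous
  set N : Set (S × S) := {z | |inner ℝ (Q.normal z.2) (Q.emb z.1 - Q.emb z.2)| ≤
    1 / 8 * ‖Q.emb z.1 - Q.emb z.2‖ ∧ (1 / 2 : ℝ) < inner ℝ (Q.normal z.1) (Q.normal z.2)} with hN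
  have hNd : ∀ x, N ∈ 𝓝 (x, x) := fun x => by
    have h1 : Continuous fun z : S × S => (inner ℝ (Q.normal z.1) (Q.normal z.2) : ℝ) := by
      fun_prop
    have h2 : ∀ᶠ z : S × S in 𝓝 (x, x), (1 / 2 : ℝ) < inner ℝ (Q.normal z.1) (Q.normal z.2) :=
      h1.continuousAt.eventually_const_lt (by
        simp only [real_inner_self_eq_norm_sq, Q.norm_normal]
        norm_num)
    filter_upwards [Q.eventually_abs_inner_normal_le (ζ := 1 / 8) (by norm_num) (by norm_num) x,
      h2] with z h3 h4
    exact ⟨h3, h4⟩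
  obtain ⟨c, hc, hcN⟩ : ∃ c > 0, ∀ z ∉ interior N, c ≤ ‖Q.emb z.1 - Q.emb z.2‖ := by
    have hcomp : IsCompact (interior N)ᶜ := isOpen_interior.isClosed_compl.isCompact
    have hcont : Continuous fun z : S × S => ‖Q.emb z.1 - Q.emb z.2‖ := by fun_prop
    rcases (interior N)ᶜ.eq_empty_or_nonempty with h | h
    · exact ⟨1, one_pos, fun z hz => absurd (show z ∈ (interior N)ᶜ from hz) (h ▸ notMem_empty z)⟩
    · obtain ⟨z₀, hz₀, hmin⟩ := hcomp.exists_isMinOn h hcont.continuousOn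
      refine ⟨_, norm_pos_iff.2 (sub_ne_zero.2 fun h0 => hz₀ ?_), fun z hz => hmin hz⟩
      have h1 := Q.emb_injective h0
      rw [mem_interior_iff_mem_nhds, show z₀ = (z₀.1, z₀.1) from Prod.ext rfl h1.symm]
      exact hNd _
  set ε₀ := min 1 (c / 5) with hε₀
  have hε₀1 : ε₀ ≤ 1 := min_le_left _ _
  have hε₀c : 5 * ε₀ ≤ c := by
    have := min_le_right 1 (c / 5)
    linarith
  have htrig : ∀ ε ∈ Icc 0 ε₀, 0 ≤ Real.sin ε ∧ (0 < ε → 0 < Real.sin ε) ∧ Real.sin ε ≤ ε ∧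
      |1 - Real.cos ε| ≤ Real.sin ε := by
    intro ε hε
    have hpi := Real.pi_gt_three
    have hs := Real.sin_nonneg_of_nonneg_of_le_pi hε.1 (by linarith [hε.2])
    have hcos := Real.cos_nonneg_of_neg_pi_div_two_le_of_le (x := ε) (by linarith [hε.1])
      (by linarith [hε.2])
    refine ⟨hs, fun h => Real.sin_pos_of_pos_of_lt_pi h (by linarith [hε.2]), Real.sin_le hε.1, ?_⟩
    rw [abs_of_nonneg (sub_nonneg.2 (Real.cos_le_one ε))]
    nlinarith [Real.sin_sq_add_cos_sq ε, Real.sin_le_one ε, Real.cos_le_one ε]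
  refine ⟨ε₀, by positivity, fun ε hε ε' hε' hpos x y h => ?_⟩
  obtain ⟨hs, hs0, hsε, hcs⟩ := htrig ε hε
  obtain ⟨hs', hs0', hsε', hcs'⟩ := htrig ε' hε'
  simp only [push, Real.cos_neg, Real.sin_neg] at h
  set d := Q.emb x - Q.emb y with hd
  have hdn : ‖d‖ ≤ 2 * (Real.sin ε + Real.sin ε') := by
    have h1 : d = ((1 - Real.cos ε) • Q.emb x - (1 - Real.cos ε') • Q.emb y)
        - (Real.sin ε • Q.normal x + Real.sin ε' • Q.normal y) := by
      rw [neg_smul] at h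
      rw [hd, ← sub_eq_zero]
      have h2 := sub_eq_zero.2 h
      rw [← h2]
      module
    rw [h1]
    refine (norm_sub_le _ _).trans ((add_le_add (norm_sub_le _ _) (norm_add_le _ _)).trans ?_)
    simp only [norm_smul, Q.norm_emb, Q.norm_normal, mul_one, Real.norm_eq_abs]
    rw [abs_of_nonneg hs, abs_of_nonneg hs']
    linarith
  have hsum : 0 < Real.sin ε + Real.sin ε' := by
    rcases hε.1.eq_or_lt with h1 | h1
    · have := hs0' (by linarith)
      linarith
    · have := hs0 h1
      linarith
  have hN' : (y, x) ∈ N := by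
    by_contra h1
    have h2 := hcN (y, x) fun h3 => h1 (interior_subset h3)
    rw [norm_sub_rev] at h2
    have h3 : ε₀ > 0 := by positivity
    linarith [hε.2, hε'.2]
  obtain ⟨h1, h2⟩ := hN'
  simp only at h1 h2
  have h3 := congrArg (inner ℝ (Q.normal x)) h
  simp only [inner_add_right, inner_smul_right, Q.normal_sphere, real_inner_self_eq_norm_sq,
    Q.norm_normal] at h3
  have h4 : (inner ℝ (Q.normal x) (Q.emb y) : ℝ) = inner ℝ (Q.normal x) (Q.emb y - Q.emb x) := by
    rw [inner_sub_right, Q.normal_sphere, sub_zero]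
  rw [← h4, norm_sub_rev] at h1
  rw [real_inner_comm] at h2
  have h5 : Real.cos ε' * inner ℝ (Q.normal x) (Q.emb y) ≤ 1 / 8 * ‖d‖ := by
    refine (le_abs_self _).trans ?_
    rw [abs_mul]
    exact (mul_le_of_le_one_left (abs_nonneg _) (Real.abs_cos_le_one _)).trans h1
  nlinarith

variable {Q}

theorem isSphereLoop_push {γ : ℝ → S} (hγ : ContMDiff 𝓘(ℝ, ℝ) (𝓡∂ 2) ∞ γ)
    (hp : Function.Periodic γ 1) (ε : ℝ) : IsSphereLoop fun s => Q.push ε (γ s) where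
  contDiff := ((contMDiff_iff_contDiff.1 (Q.contMDiff_emb.comp hγ)).of_le (by simp)
    |>.const_smul (Real.cos ε)).add ((Q.contDiff_normal_comp hγ).const_smul (Real.sin ε))
  periodic s := by simp only [hp s]
  norm_eq s := Q.norm_push ε _

end SeifertSurface

/-! ### The linking form of a Seifert surface -/

/-- Smooth closed curves on the surface, of period `1`. -/
structure IsSmoothLoop {S : Type*} [TopologicalSpace S] [ChartedSpace (EuclideanHalfSpace 2) S]
    (γ : ℝ → S) : Prop where
  smooth : ContMDiff 𝓘(ℝ, ℝ) (𝓡∂ 2) ∞ γ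
  periodic : Function.Periodic γ 1

theorem IsSimpleClosedCurve.isSmoothLoop {S : Type*} [TopologicalSpace S]
    [ChartedSpace (EuclideanHalfSpace 2) S] {γ : ℝ → S} (h : IsSimpleClosedCurve (𝓡∂ 2) γ) :
    IsSmoothLoop γ :=
  ⟨h.smooth, h.periodic⟩

theorem HasDeg.of_isotopicCurves {S : Type*} [TopologicalSpace S]
    [ChartedSpace (EuclideanHalfSpace 2) S] {γ δ : ℝ → S} (h : IsotopicCurves (𝓡∂ 2) γ δ)
    {u : S → ℂ} (hu : Continuous u) (hu0 : ∀ x, u x ≠ 0) {n : ℤ}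
    (hn : HasDeg (fun s => u (γ s)) n) : HasDeg (fun s => u (δ s)) n := by
  obtain ⟨H, hH, hsimple, h0, h1⟩ := h
  have := HasDeg.homotopy (H := fun q => u (H q)) (n := n)
    (hu.comp_continuousOn hH.continuousOn)
    (fun t ht s => congrArg u ((hsimple t ht).periodic s)) (fun _ _ _ => hu0 _)
    (by simpa only [h0] using hn)
  simpa only [h1] using this

theorem IsotopicCurves.isSmoothLoop_right {S : Type*} [TopologicalSpace S]
    [ChartedSpace (EuclideanHalfSpace 2) S] {γ δ : ℝ → S} (h : IsotopicCurves (𝓡∂ 2) γ δ) :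
    IsSmoothLoop δ := by
  obtain ⟨H, -, hsimple, -, h1⟩ := h
  have := (hsimple 1 (right_mem_Icc.2 zero_le_one)).isSmoothLoop
  rwa [funext h1] at this

theorem IsotopicCurves.isSmoothLoop_left {S : Type*} [TopologicalSpace S]
    [ChartedSpace (EuclideanHalfSpace 2) S] {γ δ : ℝ → S} (h : IsotopicCurves (𝓡∂ 2) γ δ) :
    IsSmoothLoop γ := by
  obtain ⟨H, -, hsimple, h0, -⟩ := h
  have := (hsimple 0 (left_mem_Icc.2 zero_le_one)).isSmoothLoop
  rwa [funext h0] at this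

namespace SeifertSurface

variable {S : Type*} [TopologicalSpace S] [CompactSpace S] [T2Space S]
  [ChartedSpace (EuclideanHalfSpace 2) S] [IsManifold (𝓡∂ 2) ∞ S] {n : ℕ}
  (Q : SeifertSurface S n)

/-- The push-offs of the surface of length at most `ε₀` in the two normal directions are disjoint
from the surface and from each other. -/
structure IsTubular (ε₀ : ℝ) : Prop where
  pos : 0 < ε₀
  push_ne : ∀ ε ∈ Icc 0 ε₀, ∀ ε' ∈ Icc 0 ε₀, 0 < ε + ε' → ∀ x y, Q.push ε x ≠ Q.push (-ε') y

/-- The linking form of the surface: the linking number of `α` with the push-off of `β`. -/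
noncomputable def linkingForm (ε : ℝ) (α β : ℝ → S) : ℤ :=
  linkingNumber (fun s => Q.emb (α s)) fun s => Q.push ε (β s)

variable {Q} {α β : ℝ → S} {ε₀ : ℝ}

theorem isSphereLoop_emb (hα : IsSmoothLoop α) : IsSphereLoop fun s => Q.emb (α s) := by
  simpa only [push_zero] using isSphereLoop_push (Q := Q) hα.smooth hα.periodic 0

namespace IsTubular

theorem emb_ne_push (ht : Q.IsTubular ε₀) {ε : ℝ} (h0 : 0 < ε) (h1 : ε ≤ ε₀) (x y : S) :
    Q.emb x ≠ Q.push ε y := by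
  have h2 := ht.push_ne ε ⟨h0.le, h1⟩ 0 ⟨le_rfl, ht.pos.le⟩ (by simpa) y x
  rw [neg_zero, push_zero] at h2
  exact h2.symm

theorem push_ne_base (ht : Q.IsTubular ε₀) {ε : ℝ} (h : ε ∈ Icc 0 ε₀) (x x₀ : S) :
    Q.push ε x ≠ Q.push (-ε₀) x₀ :=
  ht.push_ne ε h ε₀ ⟨ht.pos.le, le_rfl⟩ (add_pos_of_nonneg_of_pos h.1 ht.pos) x x₀

theorem emb_ne_base (ht : Q.IsTubular ε₀) (x x₀ : S) : Q.emb x ≠ Q.push (-ε₀) x₀ := by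
  simpa only [push_zero] using ht.push_ne_base ⟨le_rfl, ht.pos.le⟩ x x₀

/-- The linking form is a degree in the first variable. -/
theorem exists_hasDeg_left (ht : Q.IsTubular ε₀) (hβ : IsSmoothLoop β) :
    ∃ u : S → ℂ, Continuous u ∧ (∀ x, u x ≠ 0) ∧
    ∀ α, IsSmoothLoop α → HasDeg (fun s => u (α s)) (Q.linkingForm ε₀ α β) := by
  have hε : ε₀ ∈ Icc 0 ε₀ := ⟨ht.pos.le, le_rfl⟩
  obtain ⟨U, hU, hU0, hdeg⟩ := exists_hasDeg_linkingNumber (Q.norm_push (-ε₀) (β 0))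
    (isSphereLoop_push hβ.smooth hβ.periodic ε₀) fun t => ht.push_ne_base hε _ _
  refine ⟨fun x => U (Q.emb x), hU.comp_continuous Q.contMDiff_emb.continuous fun x =>
    ⟨Q.norm_emb x, ht.emb_ne_base _ _, fun t => ht.emb_ne_push ht.pos le_rfl _ _⟩,
    fun x => hU0 _, fun α hα => hdeg _ (isSphereLoop_emb hα) (fun s => ht.emb_ne_base _ _)
    fun s t => ht.emb_ne_push ht.pos le_rfl _ _⟩

theorem linkingNumber_push_comm (ht : Q.IsTubular ε₀) {ε : ℝ} (hε : ε ∈ Icc 0 ε₀)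
    (hα : IsSmoothLoop α) (hβ : IsSmoothLoop β) (h : ∀ s t, Q.emb (α s) ≠ Q.push ε (β t)) :
    linkingNumber (fun s => Q.emb (α s)) (fun s => Q.push ε (β s)) =
      linkingNumber (fun s => Q.push ε (β s)) fun s => Q.emb (α s) :=
  linkingNumber_comm (isSphereLoop_emb hα) (isSphereLoop_push hβ.smooth hβ.periodic ε) h
    (Q.norm_push (-ε₀) (α 0)) (fun _ => ht.emb_ne_base _ _) fun _ => ht.push_ne_base hε _ _

/-- The linking number of `α` with curves on the push-offs of the surface is the degree of a
function which is continuous off `α`. -/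
theorem exists_hasDeg_push (ht : Q.IsTubular ε₀) (hα : IsSmoothLoop α) :
    ∃ U : E4 → ℂ, (∀ x, U x ≠ 0) ∧
    (∀ (X : Set (ℝ × S)), (∀ q ∈ X, q.1 ∈ Icc 0 ε₀ ∧ ∀ s, Q.emb (α s) ≠ Q.push q.1 q.2) →
      ContinuousOn (fun q : ℝ × S => U (Q.push q.1 q.2)) X) ∧
    ∀ ε ∈ Icc 0 ε₀, ∀ β, IsSmoothLoop β → (∀ s t, Q.emb (α s) ≠ Q.push ε (β t)) →
      HasDeg (fun s => U (Q.push ε (β s)))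
        (linkingNumber (fun s => Q.emb (α s)) fun s => Q.push ε (β s)) := by
  obtain ⟨U, hU, hU0, hdeg⟩ := exists_hasDeg_linkingNumber (Q.norm_push (-ε₀) (α 0))
    (isSphereLoop_emb hα) fun t => ht.emb_ne_base _ _
  refine ⟨U, hU0, fun X hX => hU.comp Q.continuous_push.continuousOn fun q hq => ?_,
    fun ε hε β hβ h => ?_⟩
  · obtain ⟨h1, h2⟩ := hX q hq
    exact ⟨Q.norm_push _ _, ht.push_ne_base h1 _ _, fun t h => h2 t h.symm⟩
  · rw [ht.linkingNumber_push_comm hε hα hβ h]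
    exact hdeg _ (isSphereLoop_push hβ.smooth hβ.periodic ε) (fun s => ht.push_ne_base hε _ _)
      fun s t h' => h t s h'.symm

/-- The linking form is a degree in the second variable. -/
theorem exists_hasDeg_right (ht : Q.IsTubular ε₀) (hα : IsSmoothLoop α) :
    ∃ u : S → ℂ, Continuous u ∧ (∀ x, u x ≠ 0) ∧
    ∀ β, IsSmoothLoop β → HasDeg (fun s => u (β s)) (Q.linkingForm ε₀ α β) := by
  have hε : ε₀ ∈ Icc 0 ε₀ := ⟨ht.pos.le, le_rfl⟩
  obtain ⟨U, hU0, hU, hdeg⟩ := ht.exists_hasDeg_push hα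
  have hne : ∀ x y, Q.emb x ≠ Q.push ε₀ y := ht.emb_ne_push ht.pos le_rfl
  refine ⟨fun x => U (Q.push ε₀ x), ?_, fun x => hU0 _,
    fun β hβ => hdeg ε₀ hε β hβ fun s t => hne _ _⟩
  have h1 := hU ({ε₀} ×ˢ univ) fun q hq => by
    obtain ⟨ε, x⟩ := q
    obtain rfl : ε = ε₀ := hq.1
    exact ⟨hε, fun s => hne _ _⟩
  exact h1.comp_continuous (f := fun x => (ε₀, x)) (Continuous.prodMk_right ε₀)
    fun x => mk_mem_prod (mem_singleton ε₀) (mem_univ x)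

/-- Linking numbers with the push-offs do not change as long as these do not meet the first
curve. -/
theorem linkingNumber_push_eq (ht : Q.IsTubular ε₀) {ε : ℝ} (hε : ε ∈ Icc 0 ε₀)
    (hα : IsSmoothLoop α) (hβ : IsSmoothLoop β) (h : ∀ s t, Q.emb (α s) ≠ Q.push ε (β t)) :
    linkingNumber (fun s => Q.emb (α s)) (fun s => Q.push ε (β s)) = Q.linkingForm ε₀ α β := by
  have hε₀ : ε₀ ∈ Icc 0 ε₀ := ⟨ht.pos.le, le_rfl⟩
  obtain ⟨U, hU0, hU, hdeg⟩ := ht.exists_hasDeg_push hα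
  have h1 := hdeg ε hε β hβ h
  have h2 := hdeg ε₀ hε₀ β hβ fun s t => ht.emb_ne_push ht.pos le_rfl _ _
  have hmem : ∀ t ∈ Icc (0 : ℝ) 1, ε + t * (ε₀ - ε) ∈ Icc 0 ε₀ := fun t ht =>
    ⟨by nlinarith [hε.1, hε.2, ht.1, ht.2], by nlinarith [hε.1, hε.2, ht.1, ht.2]⟩
  -- only the initial push-off can meet the surface
  have hne : ∀ t ∈ Icc (0 : ℝ) 1, ∀ s s', Q.emb (α s) ≠ Q.push (ε + t * (ε₀ - ε)) (β s') := by
    intro t h4 s s'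
    rcases hε.1.eq_or_lt with h0 | h0
    · rcases h4.1.eq_or_lt with h5 | h5
      · simpa only [← h5, zero_mul, add_zero] using h s s'
      · refine ht.emb_ne_push ?_ (hmem _ h4).2 _ _
        rw [← h0, zero_add, sub_zero]
        exact mul_pos h5 ht.pos
    · refine ht.emb_ne_push ?_ (hmem _ h4).2 _ _
      nlinarith [hε.2, h4.1]
  set f : ℝ × ℝ → ℝ × S := fun q => (ε + q.1 * (ε₀ - ε), β q.2) with hf
  have hfc : Continuous f := (by fun_prop : Continuous fun q : ℝ × ℝ => ε + q.1 * (ε₀ - ε)).prodMk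
    (hβ.smooth.continuous.comp continuous_snd)
  have hUf := (hU (f '' (Icc 0 1 ×ˢ univ)) (by
    rintro _ ⟨q, hq, rfl⟩
    exact ⟨hmem _ hq.1, fun s => hne _ hq.1 _ _⟩)).comp hfc.continuousOn (mapsTo_image f _)
  have h3 := HasDeg.homotopy hUf
    (fun t _ s => by simp only [hf, Function.comp_apply, hβ.periodic s]) (fun _ _ _ => hU0 _)
    (by simpa only [hf, Function.comp_apply, zero_mul, add_zero] using h1)
  simp only [hf, Function.comp_apply, one_mul, add_sub_cancel] at h3
  exact h3.unique h2

theorem linkingForm_of_disjoint (ht : Q.IsTubular ε₀) (hα : IsSmoothLoop α) (hβ : IsSmoothLoop β)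
    (h : ∀ s t, α s ≠ β t) : Q.linkingForm ε₀ α β =
      linkingNumber (fun s => Q.emb (α s)) fun s => Q.emb (β s) := by
  rw [← ht.linkingNumber_push_eq (ε := 0) ⟨le_rfl, ht.pos.le⟩ hα hβ fun s t => ?_]
  · simp only [push_zero]
  · rw [push_zero]
    exact Q.emb_injective.ne (h s t)

theorem linkingForm_comm_of_disjoint (ht : Q.IsTubular ε₀) (hα : IsSmoothLoop α)
    (hβ : IsSmoothLoop β) (h : ∀ s t, α s ≠ β t) : Q.linkingForm ε₀ α β = Q.linkingForm ε₀ β α := by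
  have h1 := ht.linkingNumber_push_comm (ε := 0) ⟨le_rfl, ht.pos.le⟩ hα hβ fun s t => by
    rw [push_zero]
    exact Q.emb_injective.ne (h s t)
  simp only [push_zero] at h1
  rw [ht.linkingForm_of_disjoint hα hβ h, h1,
    ht.linkingForm_of_disjoint hβ hα fun s t h' => h t s h'.symm]

theorem selfLinking_eq (ht : Q.IsTubular ε₀) (hα : IsSmoothLoop α) :
    Q.selfLinking α = Q.linkingForm ε₀ α α := by
  refine Tendsto.limUnder_eq (tendsto_const_nhds.congr' ?_)
  filter_upwards [Ioc_mem_nhdsGT ht.pos] with ε hε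
  exact (ht.linkingNumber_push_eq ⟨hε.1.le, hε.2⟩ hα hα
    fun s t => ht.emb_ne_push hε.1 hε.2 _ _).symm

theorem linkingForm_self_eq_of_isotopicCurves (ht : Q.IsTubular ε₀)
    (h : IsotopicCurves (𝓡∂ 2) α β) :
    Q.linkingForm ε₀ α α = Q.linkingForm ε₀ β β := by
  have hα := h.isSmoothLoop_left
  have hβ := h.isSmoothLoop_right
  obtain ⟨u, hu, hu0, hul⟩ := ht.exists_hasDeg_left hα
  obtain ⟨v, hv, hv0, hvr⟩ := ht.exists_hasDeg_right hβ
  exact (((hul α hα).of_isotopicCurves h hu hu0).unique (hul β hβ)).trans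
    (((hvr α hα).of_isotopicCurves h hv hv0).unique (hvr β hβ))

end IsTubular

end SeifertSurface

/-! ### Degrees along curves in a subsurface -/

section Subsurface

variable {S F : Type*} [TopologicalSpace S] [TopologicalSpace F] {κ : S → F} {u : S → ℂ}

theorem continuousOn_extend [CompactSpace S] [T2Space F] (hκ : Continuous κ)
    (hκi : Function.Injective κ) (hu : Continuous u) :
    ContinuousOn (Function.extend κ u 1) (range κ) := by
  rw [← image_univ]
  refine ContinuousOn.of_comp_image isCompact_univ hκ.continuousOn ?_
  rw [Function.extend_comp hκi]
  exact hu.continuousOn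

theorem extend_ne_zero {S F : Type*} {κ : S → F} {u : S → ℂ} (hκi : Function.Injective κ)
    (hu0 : ∀ x, u x ≠ 0) :
    ∀ z ∈ range κ, Function.extend κ u 1 z ≠ 0 := by
  rintro _ ⟨x, rfl⟩
  rw [hκi.extend_apply]
  exact hu0 x

/-- The boundary curve of the subsurface has the same degree modulo `2` as the boundary curve of the
disk glued to it. -/
theorem exists_hasDeg_disk [CompactSpace S] [T2Space F] (hκ : Continuous κ)
    (hκi : Function.Injective κ) (hu : Continuous u) (hu0 : ∀ x, u x ≠ 0) {Δ : ℝ → S}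
    (hΔ : IsSimpleLoop Δ) {D : ℂ → F} (hD : ContinuousOn D (closedBall 0 1))
    (hDi : InjOn D (closedBall 0 1)) (hDΔ : D '' sphere 0 1 = κ '' range Δ) {n : ℤ}
    (hn : HasDeg (fun s => u (Δ s)) n) :
    ∃ m : ℤ, HasDeg (fun s => Function.extend κ u 1 (D (circ s))) m ∧ (m : ZMod 2) = n := by
  have hloop := isSimpleLoop_disk hD hDi
  have hr : range (D ∘ circ) = range (κ ∘ Δ) := by
    rw [image_circ_eq_sphere, hDΔ, range_comp κ Δ]
  have hmem : ∀ s, D (circ s) ∈ range κ := fun s => by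
    obtain ⟨t, ht⟩ : D (circ s) ∈ range (κ ∘ Δ) := hr ▸ mem_range_self (f := D ∘ circ) s
    exact ⟨Δ t, ht⟩
  obtain ⟨m, hm⟩ := HasDeg.of_continuous
    (u := fun s => Function.extend κ u 1 (D (circ s)))
    ((continuousOn_extend hκ hκi hu).comp_continuous hloop.continuous hmem)
    (fun s => by simp only [circ_periodic s]) fun s => extend_ne_zero hκi hu0 _ (hmem s)
  refine ⟨m, hm, hloop.deg_modTwo_eq (c := κ ∘ Δ) (U := Function.extend κ u 1)
    ⟨hκ.comp hΔ.continuous, fun s => congrArg κ (hΔ.periodic s),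
      fun s hs t ht h => hΔ.injOn hs ht (hκi h)⟩ hr hm ?_⟩
  exact hn.congr fun s => hκi.extend_apply _ _ _

end Subsurface

/-! ### Sliding curves on a Seifert surface -/

theorem IsSimpleClosedCurve.isSimpleLoop {S : Type*} [TopologicalSpace S]
    [ChartedSpace (EuclideanHalfSpace 2) S] {γ : ℝ → S} (h : IsSimpleClosedCurve (𝓡∂ 2) γ) :
    IsSimpleLoop γ :=
  ⟨h.smooth.continuous, h.periodic, h.injOn⟩

section Slide

variable {S F : Type*} [TopologicalSpace S] [CompactSpace S] [TopologicalSpace F] [T2Space F]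
  {κ : S → F} {u : S → ℂ}

/-- Sliding a curve of the subsurface across a disk changes the degree of a nonvanishing function on
the subsurface by its degree along the boundary of the disk, modulo `2`. -/
theorem deg_slide_modTwo (hκ : Continuous κ) (hκi : Function.Injective κ) (hu : Continuous u)
    (hu0 : ∀ x, u x ≠ 0) {Δ : ℝ → S} (hΔ : IsSimpleLoop Δ) {D : ℂ → F}
    (hD : ContinuousOn D (closedBall 0 1)) (hDi : InjOn D (closedBall 0 1))
    (hDΔ : D '' sphere 0 1 = κ '' range Δ)
    (hκD : range κ ∩ D '' closedBall 0 1 = D '' sphere 0 1) {a : ℝ × ℝ → F}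
    (ha : ContinuousOn a (Icc 0 1 ×ˢ univ))
    (hap : ∀ t ∈ Icc (0 : ℝ) 1, Function.Periodic (fun s => a (t, s)) 1)
    (hai : InjOn a (Icc 0 1 ×ˢ Ico 0 1)) (hDa : D '' closedBall 0 1 ⊆ a '' (Ioo 0 1 ×ˢ univ))
    (haκ : a '' (Icc 0 1 ×ˢ univ) ⊆ range κ ∪ D '' closedBall 0 1) {γ₀ γ₁ : ℝ → S}
    (h₀ : ∀ s, a (0, s) = κ (γ₀ s)) (h₁ : ∀ s, a (1, s) = κ (γ₁ s)) {m n₀ n₁ : ℤ}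
    (hm : HasDeg (fun s => u (Δ s)) m) (hn₀ : HasDeg (fun s => u (γ₀ s)) n₀)
    (hn₁ : HasDeg (fun s => u (γ₁ s)) n₁) : (n₁ : ZMod 2) = n₀ + m := by
  obtain ⟨m', hm', hmm⟩ := exists_hasDeg_disk hκ hκi hu hu0 hΔ hD hDi hDΔ hm
  rw [← hmm]
  exact deg_annulus_modTwo ha hap hai hD hDi hDa (isCompact_range hκ).isClosed hκD haκ
    (continuousOn_extend hκ hκi hu) (extend_ne_zero hκi hu0) hm'
    (hn₀.congr fun s => by rw [h₀, hκi.extend_apply])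
    (hn₁.congr fun s => by rw [h₁, hκi.extend_apply])

/-- A nonvanishing function on a subsurface, whose complement in a closed surface consists of open
disks, has even total degree along its boundary. -/
theorem sum_deg_modTwo [ChartedSpace E2 F] [IsManifold (𝓡 2) ∞ F] [CompactSpace F]
    (hκ : Continuous κ) (hκi : Function.Injective κ) (hu : Continuous u) (hu0 : ∀ x, u x ≠ 0)
    {n : ℕ} {Δ : Fin n → ℝ → S} (hΔ : ∀ k, IsSimpleLoop (Δ k)) {D : Fin n → ℂ → F}
    (hD : ∀ k, ContinuousOn (D k) (closedBall 0 1)) (hDi : ∀ k, InjOn (D k) (closedBall 0 1))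
    (hDdisj : ∀ j k, j ≠ k → Disjoint (D j '' closedBall 0 1) (D k '' closedBall 0 1))
    (hDΔ : ∀ k, D k '' sphere 0 1 = κ '' range (Δ k))
    (hcover : range κ ∪ ⋃ k, D k '' closedBall 0 1 = univ) {m : Fin n → ℤ}
    (hm : ∀ k, HasDeg (fun s => u (Δ k s)) (m k)) : (∑ k, (m k : ZMod 2)) = 0 := by
  choose m' hm' hmm using fun k =>
    exists_hasDeg_disk hκ hκi hu hu0 (hΔ k) (hD k) (hDi k) (hDΔ k) (hm k)
  simp only [← hmm]
  exact sum_deg_disks_modTwo hD hDi hDdisj (isCompact_range hκ).isClosed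
    (fun k => hDΔ k ▸ image_subset_range _ _) hcover (continuousOn_extend hκ hκi hu)
    (extend_ne_zero hκi hu0) hm'

end Slide

theorem mainTheorem6
    -- the smooth 4-manifold `M` (boundary and corners are allowed)
    {H : Type*} [TopologicalSpace H] (I : ModelWithCorners ℝ E4 H)
    {M : Type*} [TopologicalSpace M] [T2Space M] [ChartedSpace H M] [IsManifold I ∞ M]
    -- the closed surface `Σ = i(F)` in `M`
    {F : Type*} [TopologicalSpace F] [CompactSpace F] [T2Space F]
    [ChartedSpace E2 F] [IsManifold (𝓡 2) ∞ F]
    (i : F → M) (hi : SmoothEmbeddingOn (𝓡 2) I i univ)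
    -- the embedded 4-ball `Φ(B⁴)` in `M`
    (Φ : E4 → M) (hΦ : SmoothEmbeddingOn 𝓘(ℝ, E4) I Φ (closedBall 0 1))
    -- the Seifert surface `S` in `S³`, for a non-proper link
    {S : Type*} [TopologicalSpace S] [CompactSpace S] [T2Space S]
    [ChartedSpace (EuclideanHalfSpace 2) S] [IsManifold (𝓡∂ 2) ∞ S]
    {n : ℕ} (Q : SeifertSurface S n) (hQ : ¬ IsProperLink Q.link)
    -- the surface meets the ball, and the boundary of the ball, exactly in `S`
    (hball : range i ∩ Φ '' closedBall 0 1 = Φ '' range Q.emb)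
    (hsphere : range i ∩ Φ '' sphere 0 1 = Φ '' range Q.emb)
    -- the inclusion `κ` of the subsurface `S` in `Σ`
    (κ : S → F) (hκ : SmoothEmbeddingOn (𝓡∂ 2) (𝓡 2) κ univ)
    (hκΦ : ∀ x, i (κ x) = Φ (Q.emb x))
    -- the complement of the interior of `S` in `Σ` is a disjoint union of closed disks, the `k`-th
    -- of which is bounded by the `k`-th component of the boundary of `S`
    (D : Fin n → E2 → F)
    (hD : ∀ k, SmoothEmbeddingOn 𝓘(ℝ, E2) (𝓡 2) (D k) (closedBall 0 1))
    (hDdisj : ∀ j k, j ≠ k → Disjoint (D j '' closedBall 0 1) (D k '' closedBall 0 1))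
    (hDunion : ⋃ k, D k '' closedBall 0 1 = (κ '' (𝓡∂ 2).interior S)ᶜ)
    (hDbdry : ∀ k, D k '' sphere 0 1 = κ '' range (Q.bdry k)) :
    ∃ k : Fin n, ∀ γ γ' : ℝ → S,
      IsSimpleClosedCurve (𝓡∂ 2) γ → IsSimpleClosedCurve (𝓡∂ 2) γ' →
      SlidesAcross κ (D k '' closedBall 0 1) γ γ' →
      Q.theta γ' = Q.theta γ + 1 := by
  obtain ⟨ε₀, hε₀, hpush⟩ := Q.exists_push_ne
  have ht : Q.IsTubular ε₀ := ⟨hε₀, hpush⟩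
  have hκc : Continuous κ := (contMDiffOn_univ.1 hκ.smooth).continuous
  have hκi : Function.Injective κ := injOn_univ.1 hκ.injOn
  have hloop : ∀ k, IsSmoothLoop (Q.bdry k) := fun k => (Q.bdry_simple k).isSmoothLoop
  have hsimple : ∀ k, IsSimpleLoop (Q.bdry k) := fun k => (Q.bdry_simple k).isSimpleLoop
  have hne : ∀ j k, j ≠ k → ∀ s t, Q.bdry j s ≠ Q.bdry k t := fun j k hjk s t h =>
    disjoint_left.1 (Q.bdry_disjoint j k hjk) (mem_range_self s) (h ▸ mem_range_self t)
  -- the disks, parametrized by the unit disk of `ℂ`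
  set B : Fin n → ℂ → F := fun k => D k ∘ planeIso with hB
  have hBc : ∀ k, B k '' closedBall 0 1 = D k '' closedBall 0 1 := fun k => by
    rw [hB, image_comp, planeIso.image_closedBall, map_zero]
  have hBs : ∀ k, B k '' sphere 0 1 = D k '' sphere 0 1 := fun k => by
    rw [hB, image_comp, planeIso.image_sphere, map_zero]
  have hmaps : MapsTo planeIso (closedBall 0 1) (closedBall 0 1) := fun z hz => by
    simpa using hz
  have hBcont : ∀ k, ContinuousOn (B k) (closedBall 0 1) := fun k =>
    (hD k).smooth.continuousOn.comp planeIso.continuous.continuousOn hmaps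
  have hBi : ∀ k, InjOn (B k) (closedBall 0 1) := fun k =>
    (hD k).injOn.comp planeIso.injective.injOn hmaps
  have hBΔ : ∀ k, B k '' sphere 0 1 = κ '' range (Q.bdry k) := fun k =>
    (hBs k).trans (hDbdry k)
  have hBdisj : ∀ j k, j ≠ k → Disjoint (B j '' closedBall 0 1) (B k '' closedBall 0 1) :=
    fun j k hjk => by simpa only [hBc] using hDdisj j k hjk
  have hcover : range κ ∪ ⋃ k, B k '' closedBall 0 1 = univ := by
    simp only [hBc, hDunion]
    exact eq_univ_of_forall fun z => or_iff_not_imp_right.2 fun hz =>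
      image_subset_range _ _ (not_not.1 hz)
  have hκB : ∀ k, range κ ∩ B k '' closedBall 0 1 = B k '' sphere 0 1 := by
    intro k
    refine subset_antisymm ?_ (subset_inter (hBΔ k ▸ image_subset_range _ _)
      (image_mono sphere_subset_closedBall))
    rintro _ ⟨⟨x, rfl⟩, hx⟩
    have h1 : κ x ∈ (κ '' (𝓡∂ 2).interior S)ᶜ := by
      rw [← hDunion]
      exact mem_iUnion.2 ⟨k, hBc k ▸ hx⟩
    have h2 : x ∈ ⋃ k, range (Q.bdry k) := by
      rw [Q.bdry_union, ← ModelWithCorners.compl_interior]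
      exact fun h => h1 (mem_image_of_mem κ h)
    obtain ⟨j, hj⟩ := mem_iUnion.1 h2
    have h3 : κ x ∈ B j '' sphere 0 1 := hBΔ j ▸ mem_image_of_mem κ hj
    obtain rfl : j = k := by
      by_contra hjk
      exact disjoint_left.1 (hBdisj j k hjk) (image_mono sphere_subset_closedBall h3) hx
    exact h3
  -- a component with odd total linking number
  obtain ⟨k, hk⟩ := not_forall.1 hQ
  have hself : (Q.linkingForm ε₀ (Q.bdry k) (Q.bdry k) : ZMod 2) = 1 := by
    obtain ⟨u, hu, hu0, hdeg⟩ := ht.exists_hasDeg_left (hloop k)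
    have h1 := sum_deg_modTwo hκc hκi hu hu0 hsimple hBcont hBi hBdisj hBΔ hcover
      fun j => hdeg _ (hloop j)
    rw [← Finset.add_sum_erase _ _ (Finset.mem_univ k)] at h1
    have h2 : ∑ j ∈ Finset.univ.erase k, (Q.linkingForm ε₀ (Q.bdry j) (Q.bdry k) : ZMod 2) = 1 := by
      rw [← ZMod.intCast_eq_one_iff_odd.2 (Int.not_even_iff_odd.1 hk)]
      push_cast
      refine Finset.sum_congr rfl fun j hj => ?_
      rw [ht.linkingForm_of_disjoint (hloop j) (hloop k) (hne j k (Finset.ne_of_mem_erase hj))]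
      rfl
    rw [h2] at h1
    linear_combination h1 - CharTwo.two_eq_zero (R := ZMod 2)
  refine ⟨k, fun γ γ' hγ hγ' hslide => ?_⟩
  obtain ⟨γ₀, γ₁, hiso₀, hiso₁, a, ha, ha0, ha1, hDa, haD⟩ := hslide
  have hγ₀ := hiso₀.isSmoothLoop_right
  have hγ₁ := hiso₁.isSmoothLoop_left
  rw [← hBc] at hDa haD
  -- the degree formula for the slide from `γ₀` to `γ₁`
  have hstep : ∀ u : S → ℂ, Continuous u → (∀ x, u x ≠ 0) → ∀ {n₀ n₁ m : ℤ},
      HasDeg (fun s => u (Q.bdry k s)) m → HasDeg (fun s => u (γ₀ s)) n₀ →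
      HasDeg (fun s => u (γ₁ s)) n₁ → (n₁ : ZMod 2) = n₀ + m := fun u hu hu0 _ _ _ hm h0 h1 =>
    deg_slide_modTwo hκc hκi hu hu0 (hsimple k) (hBcont k) (hBi k) (hBΔ k) (hκB k)
      ha.smooth.continuousOn ha.periodic ha.injOn hDa haD ha0 ha1 hm h0 h1
  -- `γ₀` is an end of the annulus, so it misses the disk
  have hdisj : ∀ s t, γ₀ s ≠ Q.bdry k t := by
    intro s t h
    have h1 : κ (γ₀ s) ∈ B k '' closedBall 0 1 := by
      refine image_mono sphere_subset_closedBall ?_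
      rw [hBΔ k, h]
      exact mem_image_of_mem κ (mem_range_self t)
    obtain ⟨⟨r, w⟩, ⟨hr, -⟩, hrw⟩ := hDa h1
    have hfr : ∀ t ∈ Icc (0 : ℝ) 1, ∀ s, a (t, s) = a (t, Int.fract s) := fun t ht s => by
      have := (ha.periodic t ht).sub_int_mul_eq (x := s) ⌊s⌋
      rw [mul_one, Int.self_sub_floor] at this
      exact this.symm
    have h0 : (0 : ℝ) ∈ Icc (0 : ℝ) 1 := left_mem_Icc.2 zero_le_one
    have hr' : r ∈ Icc (0 : ℝ) 1 := Ioo_subset_Icc_self hr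
    rw [← ha0, hfr _ h0, hfr _ hr'] at hrw
    have h2 := ha.injOn ⟨hr', Int.fract_nonneg _, Int.fract_lt_one _⟩
      ⟨h0, Int.fract_nonneg _, Int.fract_lt_one _⟩ hrw
    exact hr.1.ne' (congrArg Prod.fst h2)
  have hcomm := ht.linkingForm_comm_of_disjoint hγ₀ (hloop k) hdisj
  obtain ⟨u, hu, hu0, hul⟩ := ht.exists_hasDeg_left hγ₁
  obtain ⟨v, hv, hv0, hvr⟩ := ht.exists_hasDeg_right hγ₀
  obtain ⟨w, hw, hw0, hwr⟩ := ht.exists_hasDeg_right (hloop k)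
  have e1 := hstep u hu hu0 (hul _ (hloop k)) (hul _ hγ₀) (hul _ hγ₁)
  have e2 := hstep v hv hv0 (hvr _ (hloop k)) (hvr _ hγ₀) (hvr _ hγ₁)
  have e3 := hstep w hw hw0 (hwr _ (hloop k)) (hwr _ hγ₀) (hwr _ hγ₁)
  rw [SeifertSurface.theta, SeifertSurface.theta, ht.selfLinking_eq hγ'.isSmoothLoop,
    ht.selfLinking_eq hγ.isSmoothLoop, ← ht.linkingForm_self_eq_of_isotopicCurves hiso₁,
    ht.linkingForm_self_eq_of_isotopicCurves hiso₀]
  rw [hcomm] at e2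
  linear_combination e1 + e2 + e3 + hself +
    (Q.linkingForm ε₀ (Q.bdry k) γ₀ : ZMod 2) * CharTwo.two_eq_zero (R := ZMod 2)
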